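/- Let $d,k,n$ be integers with $d$ odd and $n\ge k\ge d\ge 5$. Let $P=P^{d,k,n}\subset\mathbb R^d$ be an ordinary $d$-polytope with ordered vertices $x_0,x_1,\dots,x_n$ whose first vertex $x_0$ lies on exactly $k$ edges. We identify faces with their sets of vertex indices, and use the following terms. * $P$ is ordinary if (i) the vertex set $Y$ of every facet is a Gale subset of $\{0,\dots,n\}$, that is, between any two elements not in $Y$ there is an even number of elements of $Y$, and (ii) every facet is a $(d-1)$-dimensional multiplex in the induced order of its vertices. * An $e$-dimensional polytope with ordered vertices $z_0,\dots,z_q$ is a multiplex if its facets are exactly the convex hulls of $\{z_{i-e+1},\dots,z_{i-1},z_{i+1},\dots,z_{i+e-1}\}$, $0\le i\le q$, where $z_j$ means $z_0$ if $j<0$ and $z_q$ if $j>q$. * A shelling of a pure $e$-dimensional simplicial complex is, for $e=0$, any ordering of its points, and for $e>0$ an ordering of its facets such that the intersection of each facet except the first with the union of the preceding ones is nonempty and is the union of the ridges (the $(e-1)$-dimensional faces) forming an initial segment of a shelling of the boundary of that facet. Let $F_1,F_2,\dots,F_v$ be the facets of $P$ in colex order ($F$ precedes $F'$ if the largest element of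 the symmetric difference of $F$ and $F'$ lies in $F'$). For each $j$ write $F_j=\{z_1<z_2<\dots<z_{p_j}\}$, and for $1\le\ell\le p_j-d+1$ let $T_{j,\ell}=\{z_\ell,z_{\ell+1},\dots,z_{\ell+d-1}\}$. Let $\mathcal T=\mathcal T(P)$ be the simplicial complex generated by all the sets $T_{j,\ell}$ (the triangulation of $\partial P$ obtained by triangulating each facet by its blocks of $d$ consecutive vertices). Then $$T_{1,1},\dots,T_{1,p_1-d+1},\;T_{2,1},\dots,T_{2,p_2-d+1},\;\dots,\;T_{v,1},\dots,T_{v,p_v-d+1}$$ is a shelling of $\mathcal T$. Moreover, each $T_{j,\ell}$ has a unique minimal face $U_{j,\ell}$ that is not contained in any preceding simplex of this list, each facet $F_j$ of $P$ has a unique minimal face $G_j$ that is not contained in any of $F_1,\dots,F_{j-1}$, and, as vertex sets, $U_{j,p_j-d+1}=G_j$ for every $j$. -/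

import Mathlib

namespace OrdinaryPolytope

/-! ### Polytopes with an ordered list of vertices -/

section Polytope

variable {n d : ℕ}

/-- The number of elements of `A` below `a`: in the increasing list `z_0 < z_1 < ...` of the
elements of `A`, the element `a ∈ A` is `z_(rank A a)`. -/
def rank (A : Finset (Fin (n + 1))) (a : Fin (n + 1)) : ℕ :=
  (A.filter (fun b => b < a)).card

/-- The block of `s` consecutive elements of `A` that starts at position `l`, positions being
counted from `0`. -/
def window (A : Finset (Fin (n + 1))) (s l : ℕ) : Finset (Fin (n + 1)) :=
  A.filter (fun a => l ≤ rank A a ∧ rank A a < l + s)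

/-- For points `x_0, ..., x_n` in convex position, `B` is the vertex set of a face of the polytope
`conv {x_i : i ∈ A}`. The empty face and the polytope itself are included. -/
def IsFace (x : Fin (n + 1) → EuclideanSpace ℝ (Fin d)) (A B : Finset (Fin (n + 1))) : Prop :=
  B ⊆ A ∧ IsExposed ℝ (convexHull ℝ (x '' (A : Set (Fin (n + 1)))))
    (convexHull ℝ (x '' (B : Set (Fin (n + 1)))))

/-- The dimension of `conv {x_i : i ∈ A}`, for nonempty `A`. -/
noncomputable def polytopeDim (x : Fin (n + 1) → EuclideanSpace ℝ (Fin d))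
    (A : Finset (Fin (n + 1))) : ℕ :=
  Module.finrank ℝ (vectorSpan ℝ (x '' (A : Set (Fin (n + 1)))))

/-- `B` is the vertex set of a facet (a face of codimension one) of `conv {x_i : i ∈ A}`. -/
def IsFacet (x : Fin (n + 1) → EuclideanSpace ℝ (Fin d)) (A B : Finset (Fin (n + 1))) : Prop :=
  IsFace x A B ∧ B.Nonempty ∧ polytopeDim x B + 1 = polytopeDim x A

/-- If `z_0 < ... < z_q` are the elements of `A`, this is
`{z_(i-e+1), ..., z_(i-1), z_(i+1), ..., z_(i+e-1)}`, where `z_j` is read as `z_0` for `j < 0`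
and as `z_q` for `j > q`. -/
noncomputable def multiplexFacet (A : Finset (Fin (n + 1))) (e i : ℕ) : Finset (Fin (n + 1)) :=
  A.filter (fun a => ∃ t ∈ (Finset.Ioo (-(e : ℤ)) (e : ℤ)).erase 0,
    (rank A a : ℤ) = max 0 (min ((i : ℤ) + t) ((A.card : ℤ) - 1)))

/-- For points `x_0, ..., x_n` in convex position, `conv {x_i : i ∈ A}` is an `e`-dimensional
multiplex with respect to the order of the indices. -/
def IsMultiplex (x : Fin (n + 1) → EuclideanSpace ℝ (Fin d)) (A : Finset (Fin (n + 1)))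
    (e : ℕ) : Prop :=
  polytopeDim x A = e ∧ ∀ B, IsFacet x A B ↔ ∃ i < A.card, B = multiplexFacet A e i

/-- Between any two elements outside `Y` there is an even number of elements of `Y`. -/
def IsGaleSubset (Y : Finset (Fin (n + 1))) : Prop :=
  ∀ a b, a ∉ Y → b ∉ Y → a < b → Even (Y.filter (fun y => a < y ∧ y < b)).card

/-- `x_0, ..., x_n` is the ordered list of vertices of an ordinary `d`-polytope in `ℝ^d`:
a Gale polytope all of whose facets are multiplexes in the induced order of the vertices. -/
structure IsOrdinaryPolytope (x : Fin (n + 1) → EuclideanSpace ℝ (Fin d)) : Prop where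
  convexIndependent : ConvexIndependent ℝ x
  full_dimensional : affineSpan ℝ (Set.range x) = ⊤
  gale : ∀ F, IsFacet x Finset.univ F → IsGaleSubset F
  multiplex : ∀ F, IsFacet x Finset.univ F → IsMultiplex x F (d - 1)

/-- The number of edges of `conv {x_0, ..., x_n}` that contain the first vertex. -/
noncomputable def firstVertexDegree (x : Fin (n + 1) → EuclideanSpace ℝ (Fin d)) : ℕ :=
  Set.ncard {B : Finset (Fin (n + 1)) | IsFace x Finset.univ B ∧ B.card = 2 ∧ 0 ∈ B}

/-- The simplicial complex generated by all sets of `d` consecutive vertices of facets: each facet,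
a multiplex, is triangulated by its blocks of `d` consecutive vertices. -/
def boundaryTriangulation (x : Fin (n + 1) → EuclideanSpace ℝ (Fin d)) :
    PreAbstractSimplicialComplex (Fin (n + 1)) where
  faces := {S | S.Nonempty ∧
    ∃ F, IsFacet x Finset.univ F ∧ ∃ l, l + d ≤ F.card ∧ S ⊆ window F d l}
  isRelLowerSet_faces := by
    rintro S ⟨hS, F, hF, l, hl, hSl⟩
    exact ⟨hS, fun S' hS' hne => ⟨hne, F, hF, l, hl, hS'.trans hSl⟩⟩

end Polytope

/-! ### Shellings of simplicial complexes -/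

section Shelling

variable {V : Type*}

/-- The boundary complex of the simplex with vertex set `F`. -/
def simplexBoundary (F : Finset V) : PreAbstractSimplicialComplex V where
  faces := {S | S.Nonempty ∧ S ⊂ F}
  isRelLowerSet_faces := by
    rintro S ⟨hS, hSF⟩
    exact ⟨hS, fun S' hS' hne => ⟨hne, lt_of_le_of_lt hS' hSF⟩⟩

/-- The list `L` enumerates, without repetition, the facets of the complex `K`, which is pure of
dimension `e`. -/
def EnumeratesFacets (e : ℕ) (K : PreAbstractSimplicialComplex V) (L : List (Finset V)) : Prop :=
  L.Nodup ∧ (∀ S, S ∈ L ↔ Maximal (fun A => A ∈ K) S) ∧ ∀ S ∈ L, S.card = e + 1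

/-- The list `L` is a shelling of the pure `e`-dimensional simplicial complex `K`: for `e = 0` any
ordering of the points; for `e > 0` an ordering of the facets such that the intersection of each
facet `F` but the first with the union `⋃ E ∈ L₁, E` of the earlier ones is nonempty, and is the
union of the ridges in an initial segment `R₁` of a shelling of the boundary of `F`. -/
def IsShelling : ℕ → PreAbstractSimplicialComplex V → List (Finset V) → Prop
  | 0, K, L => EnumeratesFacets 0 K L
  | e + 1, K, L => EnumeratesFacets (e + 1) K L ∧
      ∀ (L₁ : List (Finset V)) (F : Finset V) (L₂ : List (Finset V)),
        L = L₁ ++ F :: L₂ → L₁ ≠ [] →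
        ∃ R₁ R₂ : List (Finset V), IsShelling e (simplexBoundary F) (R₁ ++ R₂) ∧ R₁ ≠ [] ∧
          ∀ A : Finset V, A.Nonempty → A ⊆ F → ((∃ E ∈ L₁, A ⊆ E) ↔ ∃ R ∈ R₁, A ⊆ R)

/-- `G` is the unique minimal element among those of the given `faces` that are not contained in
any of the `earlier` cells. -/
def IsMinimalNewFace (faces earlier : Set (Finset V)) (G : Finset V) : Prop :=
  IsLeast {A | A ∈ faces ∧ ∀ E ∈ earlier, ¬ A ⊆ E} G

end Shelling

/-! ### The ordering of the simplices -/

section Ordering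

variable {n v : ℕ}

/-- The list of all `window (F j) d l` with `l + d ≤ #(F j)`, ordered by increasing `j` and, for
each `j`, by increasing `l`. -/
def simplexList (F : Fin v → Finset (Fin (n + 1))) (d : ℕ) : List (Finset (Fin (n + 1))) :=
  (List.finRange v).flatMap
    (fun j => (List.range ((F j).card + 1 - d)).map (fun l => window (F j) d l))

/-- The simplices that precede `window (F j) d l` in `simplexList F d`. -/
def earlierSimplices (F : Fin v → Finset (Fin (n + 1))) (d : ℕ) (j : Fin v) (l : ℕ) :
    Set (Finset (Fin (n + 1))) :=
  {S | ∃ i r, r + d ≤ (F i).card ∧ (i < j ∨ (i = j ∧ r < l)) ∧ S = window (F i) d r}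

end Ordering

end OrdinaryPolytope

/-!
Let `F` be a facet with vertices `z_0 < ... < z_q`. Being a multiplex, it has one facet opposite to
each position `s`, called here a ridge. A ridge of `F` is *early* if it lies in a facet that
precedes `F` in the colexicographic order. For the block `z_l, ..., z_(l+d-1)` one declares new
(`IsNew`): its last vertex, if `l > 0` or the ridge opposite to `z_0` is early; each inner vertex
whose opposite ridge is early; and its first vertex, if the block is the last one of `F` and the
ridge opposite to `z_q` is early. Let `U` be the set of the new vertices. Three facts give the
theorem.

* If a new vertex is removed from a block, the rest lies in an earlier block
  (`FacetSystem.exists_window_of_isNew`): two facets that share a ridge list its vertices at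
  positions that differ by a shift, up to the one position missing on either side.
* No earlier facet contains `U` (`FacetSystem.exists_isNew_notMem`).
* For the last block of `F`, the set `U` is the intersection of the ridges of `F` that are not
  early (`FacetSystem.isNew_last_iff`).

By the first two facts, the faces of a block that lie in no earlier block are those that contain
`U` (`newFace_subset_iff`). So `U` is the minimal new face, and the block meets the union of the
earlier ones in the ridges opposite to the vertices in `U`. These ridges form an initial segment of
a shelling, because every ordering of the facets of a simplex is a shelling of its boundary
(`isShelling_simplexBoundary`). By the third fact, for the last block of `F` the set `U` is a face
of `F`. A face of `F` that misses a vertex of `U` lies in a ridge of `F` that misses it. That ridge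
is early, so the given face lies in an earlier facet. Hence `U` is also the least new face of `F`
(`isMinimalNewFace_facet`).

The second fact is the core. Let the earlier facet `H` differ from `F`, from above, first in `z_p`.
The inequalities and parity arguments needed depend on the facets only through the properties
collected in `FacetSystem`, with Gale's condition read as a statement on parities of gaps. Crossing
suitable ridges of a facet with more than `d` vertices shows that its first and last runs of
vertices are consecutive (`FacetSystem.en_succ_of_lt`, `FacetSystem.en_succ_of_le`). Sliding a
facet towards `0, ..., d - 1` shows that all blocks of such facets span the same length `κ`, and
all blocks of simplices at most `κ` (`FacetSystem.exists_spread`). If a ridge is not early, the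
facet across it has an element that is missing in `F` and lies above the element of `F` opposite to
the ridge. Together with Gale's condition this leads to a block of the wrong length, which makes
the following ridges early: the ridges opposite to `z_0, ..., z_(q-d+1)`, if `F` is not a simplex
(`FacetSystem.exists_early_of_le`, `FacetSystem.exists_early_zero`), the ridge opposite to `z_p`
for `p` beyond these positions and `p < q` (`FacetSystem.exists_early_of_colexDiff`), or the one
opposite to `z_0` if `F` is a simplex and `p = q` (`FacetSystem.exists_early_zero_of_simplex`).
Thus `z_p`, which is not in `H`, is new if it lies in the block but is not its first vertex. If
`z_p` is below the block, or the first vertex of a block that is not the last one of `F`, then `H`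
contains a whole block of `F`, which is impossible. If `z_p` is the first vertex of the last block,
then `H` itself shows that the ridge opposite to `z_q` is early, and `z_p` is new. The remaining
case, `z_p` above the block, is `FacetSystem.not_mem_of_colexDiff`.
-/

namespace OrdinaryPolytope

/-! ### Faces of polytopes and supporting functionals -/

section Faces

variable {n d : ℕ} {x : Fin (n + 1) → EuclideanSpace ℝ (Fin d)}

/-- The affine functional `l - c` is nonpositive on the points `x_i`, `i ∈ A`, and vanishes exactly
at those with `i ∈ B`. -/
def Supports (x : Fin (n + 1) → EuclideanSpace ℝ (Fin d)) (A B : Finset (Fin (n + 1)))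
    (l : Module.Dual ℝ (EuclideanSpace ℝ (Fin d))) (c : ℝ) : Prop :=
  ∀ i ∈ A, l (x i) ≤ c ∧ (l (x i) = c ↔ i ∈ B)

/-- The linear subspace parallel to the affine hull of the points `x_i`, `i ∈ A`. -/
noncomputable def dirSpan (x : Fin (n + 1) → EuclideanSpace ℝ (Fin d)) (A : Finset (Fin (n + 1))) :
    Submodule ℝ (EuclideanSpace ℝ (Fin d)) :=
  vectorSpan ℝ (x '' (A : Set (Fin (n + 1))))

lemma polytopeDim_eq (A : Finset (Fin (n + 1))) :
    polytopeDim x A = Module.finrank ℝ (dirSpan x A) := rfl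

lemma dirSpan_mono {A B : Finset (Fin (n + 1))} (h : A ⊆ B) : dirSpan x A ≤ dirSpan x B :=
  vectorSpan_mono ℝ (Set.image_mono (by exact_mod_cast h))

lemma sub_mem_dirSpan {A : Finset (Fin (n + 1))} {i j : Fin (n + 1)} (hi : i ∈ A) (hj : j ∈ A) :
    x i - x j ∈ dirSpan x A :=
  vsub_mem_vectorSpan ℝ (Set.mem_image_of_mem _ hi) (Set.mem_image_of_mem _ hj)

lemma dirSpan_le_ker {A : Finset (Fin (n + 1))} {l : Module.Dual ℝ (EuclideanSpace ℝ (Fin d))}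
    {c : ℝ} (h : ∀ i ∈ A, l (x i) = c) : dirSpan x A ≤ LinearMap.ker l := by
  refine Submodule.span_le.2 ?_
  rintro _ ⟨_, ⟨i, hi, rfl⟩, _, ⟨j, hj, rfl⟩, rfl⟩
  simp [h i hi, h j hj]

lemma eq_of_dirSpan_le_ker {A : Finset (Fin (n + 1))}
    {l : Module.Dual ℝ (EuclideanSpace ℝ (Fin d))} (h : dirSpan x A ≤ LinearMap.ker l)
    {i j : Fin (n + 1)} (hi : i ∈ A) (hj : j ∈ A) : l (x i) = l (x j) := by
  have := h (sub_mem_dirSpan (x := x) hi hj)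
  simpa [sub_eq_zero] using this

lemma mem_convexHull_of_supports {A B : Finset (Fin (n + 1))}
    {l : Module.Dual ℝ (EuclideanSpace ℝ (Fin d))} {c : ℝ} (h : Supports x A B l c)
    {y : EuclideanSpace ℝ (Fin d)} (hy : y ∈ convexHull ℝ (x '' (A : Set (Fin (n + 1)))))
    (hyc : l y = c) (hBA : B ⊆ A) : y ∈ convexHull ℝ (x '' (B : Set (Fin (n + 1)))) := by
  have hB : ∀ z ∈ convexHull ℝ (x '' (B : Set (Fin (n + 1)))), l z = c := by
    intro z hz
    refine convexHull_min (t := {z | l z = c}) ?_ ?_ hz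
    · rintro _ ⟨i, hi, rfl⟩
      exact (h i (hBA hi)).2.2 hi
    · exact convex_hyperplane l.isLinear c
  -- The points where `l < c` form, together with the face, a convex set containing all `x_i`.
  have hS : Convex ℝ ({z | l z < c} ∪ convexHull ℝ (x '' (B : Set (Fin (n + 1))))) := by
    rw [convex_iff_forall_pos]
    intro u hu v hv a b ha hb hab
    have hule : l u ≤ c := hu.elim (fun h => le_of_lt h) (fun h => (hB u h).le)
    have hvle : l v ≤ c := hv.elim (fun h => le_of_lt h) (fun h => (hB v h).le)
    have hc : a * c + b * c = c := by rw [← add_mul, hab, one_mul]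
    rcases hu with hu | hu
    · left
      have hu' : l u < c := hu
      simp only [Set.mem_ofPred_eq, map_add, map_smul, smul_eq_mul]
      linarith [mul_lt_mul_of_pos_left hu' ha, mul_le_mul_of_nonneg_left hvle hb.le]
    · rcases hv with hv | hv
      · left
        have hv' : l v < c := hv
        simp only [Set.mem_ofPred_eq, map_add, map_smul, smul_eq_mul]
        linarith [mul_lt_mul_of_pos_left hv' hb, mul_le_mul_of_nonneg_left hule ha.le]
      · right
        exact convex_convexHull ℝ _ hu hv ha.le hb.le hab
  have : y ∈ {z | l z < c} ∪ convexHull ℝ (x '' (B : Set (Fin (n + 1)))) := by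
    refine convexHull_min ?_ hS hy
    rintro _ ⟨i, hi, rfl⟩
    rcases lt_or_eq_of_le (h i hi).1 with hlt | heq
    · exact Or.inl hlt
    · exact Or.inr (subset_convexHull _ _ ⟨i, (h i hi).2.1 heq, rfl⟩)
  rcases this with h1 | h1
  · exact absurd hyc (ne_of_lt h1)
  · exact h1

lemma isFace_iff (hx : ConvexIndependent ℝ x) {A B : Finset (Fin (n + 1))} :
    IsFace x A B ↔ B ⊆ A ∧ (B.Nonempty → ∃ l c, Supports x A B l c) := by
  constructor
  · rintro ⟨hBA, hexp⟩
    refine ⟨hBA, fun ⟨b, hb⟩ => ?_⟩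
    obtain ⟨l, hl⟩ := hexp ⟨x b, subset_convexHull _ _ ⟨b, hb, rfl⟩⟩
    have hbm : x b ∈ convexHull ℝ (x '' (B : Set (Fin (n + 1)))) :=
      subset_convexHull _ _ ⟨b, hb, rfl⟩
    rw [hl] at hbm
    refine ⟨(l : EuclideanSpace ℝ (Fin d) →ₗ[ℝ] ℝ), l (x b), fun i hi => ?_⟩
    have hiA : x i ∈ convexHull ℝ (x '' (A : Set (Fin (n + 1)))) :=
      subset_convexHull _ _ ⟨i, hi, rfl⟩
    refine ⟨hbm.2 _ hiA, fun h => ?_, fun h => ?_⟩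
    · rw [← Finset.mem_coe, ← hx.mem_convexHull_iff, hl]
      refine ⟨hiA, fun y hy => ?_⟩
      have h' : l (x i) = l (x b) := h
      rw [h']
      exact hbm.2 y hy
    · have him : x i ∈ convexHull ℝ (x '' (B : Set (Fin (n + 1)))) :=
        subset_convexHull _ _ ⟨i, h, rfl⟩
      rw [hl] at him
      exact le_antisymm (hbm.2 _ hiA) (him.2 _ hbm.1)
  · rintro ⟨hBA, h⟩
    refine ⟨hBA, ?_⟩
    rcases B.eq_empty_or_nonempty with rfl | ⟨b, hb⟩
    · simpa using isExposed_empty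
    · obtain ⟨l, c, hl⟩ := h ⟨b, hb⟩
      intro _
      refine ⟨LinearMap.toContinuousLinearMap l, ?_⟩
      have hA : ∀ z ∈ convexHull ℝ (x '' (A : Set (Fin (n + 1)))), l z ≤ c := by
        intro z hz
        refine convexHull_min (t := {z | l z ≤ c}) ?_ ?_ hz
        · rintro _ ⟨i, hi, rfl⟩
          exact (hl i hi).1
        · exact convex_halfSpace_le l.isLinear c
      have hbc : l (x b) = c := (hl b (hBA hb)).2.2 hb
      ext y
      constructor
      · intro hy
        refine ⟨convexHull_mono (Set.image_mono (by exact_mod_cast hBA)) hy, fun z hz => ?_⟩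
        have hyc : l y = c := by
          refine convexHull_min (t := {z | l z = c}) ?_ ?_ hy
          · rintro _ ⟨i, hi, rfl⟩
            exact (hl i (hBA hi)).2.2 hi
          · exact convex_hyperplane l.isLinear c
        simpa [hyc] using hA z hz
      · rintro ⟨hy, hmax⟩
        refine mem_convexHull_of_supports hl hy (le_antisymm (hA y hy) ?_) hBA
        have := hmax (x b) (subset_convexHull _ _ ⟨b, hBA hb, rfl⟩)
        simpa [hbc] using this

lemma IsFace.inter (hx : ConvexIndependent ℝ x) {A B C : Finset (Fin (n + 1))}
    (hB : IsFace x A B) (hC : IsFace x A C) : IsFace x A (B ∩ C) := by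
  rw [isFace_iff hx] at hB hC ⊢
  refine ⟨Finset.inter_subset_left.trans hB.1, fun ⟨b, hb⟩ => ?_⟩
  obtain ⟨hb1, hb2⟩ := Finset.mem_inter.1 hb
  obtain ⟨l, c, hl⟩ := hB.2 ⟨b, hb1⟩
  obtain ⟨m, e, hm⟩ := hC.2 ⟨b, hb2⟩
  refine ⟨l + m, c + e, fun i hi => ⟨?_, ?_⟩⟩
  · simpa using add_le_add (hl i hi).1 (hm i hi).1
  · have h1 := hl i hi
    have h2 := hm i hi
    rw [Finset.mem_inter, ← h1.2, ← h2.2, LinearMap.add_apply]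
    constructor
    · intro h
      constructor <;> linarith [h1.1, h2.1]
    · rintro ⟨h, h'⟩
      rw [h, h']

lemma isFace_self (hx : ConvexIndependent ℝ x) (A : Finset (Fin (n + 1))) : IsFace x A A := by
  rw [isFace_iff hx]
  exact ⟨subset_rfl, fun _ => ⟨0, 0, fun i hi => by simp [hi]⟩⟩

lemma IsFace.restrict (hx : ConvexIndependent ℝ x) {A A' B : Finset (Fin (n + 1))}
    (hB : IsFace x A B) (hA : A' ⊆ A) : IsFace x A' (A' ∩ B) := by
  rw [isFace_iff hx] at hB ⊢
  refine ⟨Finset.inter_subset_left, fun ⟨b, hb⟩ => ?_⟩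
  obtain ⟨l, c, hl⟩ := hB.2 ⟨b, (Finset.mem_inter.1 hb).2⟩
  exact ⟨l, c, fun i hi => ⟨(hl i (hA hi)).1, by simp [(hl i (hA hi)).2, hi]⟩⟩

/-- A proper face of a polytope that misses the vertex `x_u` lies in a facet missing `x_u`. A face
that is maximal among those missing `x_u` is a facet: otherwise its supporting functional can be
tilted, with its value at `x_u` kept, until it meets a further vertex. -/
theorem exists_isFacet_of_notMem (hx : ConvexIndependent ℝ x) {A B : Finset (Fin (n + 1))}
    (hA : 2 ≤ A.card) (hB : IsFace x A B) {u : Fin (n + 1)} (huA : u ∈ A) (huB : u ∉ B) :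
    ∃ C, IsFacet x A C ∧ B ⊆ C ∧ u ∉ C := by
  classical
  have key : ∀ C, IsFace x A C → u ∉ C → C.Nonempty →
      (∀ D, IsFace x A D → C ⊂ D → u ∈ D) → IsFacet x A C := by
    intro C hC huC hCne hmax
    refine ⟨hC, hCne, ?_⟩
    obtain ⟨hCA, hC'⟩ := (isFace_iff hx).1 hC
    obtain ⟨m, c, hm⟩ := hC' hCne
    obtain ⟨b, hb⟩ := hCne
    have hmu : m (x u) < c :=
      lt_of_le_of_ne (hm u huA).1 (fun h => huC ((hm u huA).2.1 h))
    have hlt : dirSpan x C < dirSpan x A := by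
      refine lt_of_le_of_ne (dirSpan_mono hCA) (fun h => ?_)
      have h1 : dirSpan x C ≤ LinearMap.ker m :=
        dirSpan_le_ker (c := c) (fun i hi => (hm i (hCA hi)).2.2 hi)
      rw [h] at h1
      have := eq_of_dirSpan_le_ker h1 huA (hCA hb)
      rw [(hm b (hCA hb)).2.2 hb] at this
      exact hmu.ne this
    have hlt' := Submodule.finrank_lt_finrank_of_lt hlt
    rw [polytopeDim_eq, polytopeDim_eq]
    by_contra hne
    have hins : Module.finrank ℝ (dirSpan x (insert u C)) < Module.finrank ℝ (dirSpan x A) := by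
      have h1 : Module.finrank ℝ (dirSpan x (insert u C)) ≤ Module.finrank ℝ (dirSpan x C) + 1 := by
        have e : dirSpan x (insert u C) =
            vectorSpan ℝ (insert (x u) (x '' (C : Set (Fin (n + 1))))) := by
          rw [dirSpan, Finset.coe_insert, Set.image_insert_eq]
        rw [e]
        exact finrank_vectorSpan_insert_le_set ℝ (x '' (C : Set (Fin (n + 1)))) (x u)
      omega
    have hinsA : insert u C ⊆ A := Finset.insert_subset huA hCA
    obtain ⟨v, hvA, hv⟩ := SetLike.exists_of_lt
      (lt_of_le_of_ne (dirSpan_mono (x := x) hinsA) (fun h => by rw [h] at hins; omega))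
    obtain ⟨f, hfv, hf⟩ := Submodule.exists_le_ker_of_notMem hv
    have hfu : f (x u) = f (x b) :=
      eq_of_dirSpan_le_ker hf (Finset.mem_insert_self _ _) (Finset.mem_insert_of_mem hb)
    obtain ⟨w, hwA, hw⟩ : ∃ w ∈ A, f (x w) ≠ f (x b) := by
      by_contra hcon
      push Not at hcon
      exact hfv (dirSpan_le_ker (c := f (x b)) hcon hvA)
    -- The sign of the tilting functional is chosen so that it is positive somewhere on `A`.
    obtain ⟨g, hgC, hgu, w, hwA, hw⟩ : ∃ g : Module.Dual ℝ (EuclideanSpace ℝ (Fin d)),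
        (∀ i ∈ C, g (x i) = g (x b)) ∧ g (x u) = g (x b) ∧ ∃ w ∈ A, g (x b) < g (x w) := by
      have hfC : ∀ i ∈ C, f (x i) = f (x b) := fun i hi =>
        eq_of_dirSpan_le_ker hf (Finset.mem_insert_of_mem hi) (Finset.mem_insert_of_mem hb)
      rcases lt_or_gt_of_ne hw with h | h
      · exact ⟨-f, by simpa using hfC, by simpa using hfu, w, hwA, by simpa using h⟩
      · exact ⟨f, hfC, hfu, w, hwA, h⟩
    have hpos : (A.filter (fun i => g (x b) < g (x i))).Nonempty := ⟨w, by simp [hwA, hw]⟩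
    obtain ⟨p, hp, hpmin⟩ := Finset.exists_min_image _
      (fun i => (c - m (x i)) / (g (x i) - g (x b))) hpos
    obtain ⟨hpA, hp⟩ := Finset.mem_filter.1 hp
    set t := (c - m (x p)) / (g (x p) - g (x b)) with ht
    have ht0 : 0 ≤ t := div_nonneg (by linarith [(hm p hpA).1]) (by linarith)
    have hle : ∀ i ∈ A, m (x i) + t * (g (x i) - g (x b)) ≤ c := by
      intro i hi
      rcases lt_or_ge (g (x b)) (g (x i)) with h | h
      · have := hpmin i (by simp [hi, h])
        rw [le_div_iff₀ (by linarith)] at this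
        linarith
      · nlinarith [(hm i hi).1]
    have hpeq : m (x p) + t * (g (x p) - g (x b)) = c := by
      rw [ht, div_mul_cancel₀ _ (by linarith)]
      ring
    set D := A.filter (fun i => m (x i) + t * (g (x i) - g (x b)) = c) with hD
    have hDface : IsFace x A D := by
      rw [isFace_iff hx]
      refine ⟨Finset.filter_subset _ _, fun _ => ⟨m + t • g, c + t * g (x b), fun i hi => ?_⟩⟩
      have h1 := hle i hi
      simp only [LinearMap.add_apply, LinearMap.smul_apply, smul_eq_mul, hD, Finset.mem_filter, hi,
        true_and]
      constructor
      · linarith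
      · constructor <;> intro h <;> linarith
    have hCD : C ⊆ D := by
      intro i hi
      simp only [hD, Finset.mem_filter]
      refine ⟨hCA hi, ?_⟩
      rw [hgC i hi, (hm i (hCA hi)).2.2 hi]
      ring
    have hpC : p ∉ C := fun h => by
      rw [hgC p h] at hp
      exact lt_irrefl _ hp
    have huD := hmax D hDface ⟨hCD, fun h => hpC (h (by simp [hD, hpA, hpeq]))⟩
    rw [hD, Finset.mem_filter, hgu] at huD
    linarith [huD.2]
  -- A nonempty face missing `x_u`: if `B` is empty, a functional that is not maximal at `x_u`.
  obtain ⟨B', hB', hBB', huB', hB'ne⟩ : ∃ B', IsFace x A B' ∧ B ⊆ B' ∧ u ∉ B' ∧ B'.Nonempty := by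
    rcases B.eq_empty_or_nonempty with rfl | hne
    · obtain ⟨w, hwA, hwu⟩ := Finset.exists_mem_ne (by omega : 1 < A.card) u
      have hne : x w - x u ≠ 0 := sub_ne_zero.2 (fun h => hwu (hx.injective h))
      obtain ⟨f, hf, -⟩ := Submodule.exists_le_ker_of_notMem (p := (⊥ : Submodule ℝ _))
        (by simpa using hne : x w - x u ∉ (⊥ : Submodule ℝ (EuclideanSpace ℝ (Fin d))))
      obtain ⟨g, hg⟩ : ∃ g : Module.Dual ℝ (EuclideanSpace ℝ (Fin d)), g (x u) < g (x w) := by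
        rw [map_sub, sub_ne_zero] at hf
        rcases lt_or_gt_of_ne hf with h | h
        · exact ⟨-f, by simpa using h⟩
        · exact ⟨f, h⟩
      obtain ⟨p, hpA, hpmax⟩ := Finset.exists_max_image A (fun i => g (x i)) ⟨u, huA⟩
      refine ⟨A.filter (fun i => g (x i) = g (x p)), ?_, by simp, ?_, ⟨p, by simp [hpA]⟩⟩
      · rw [isFace_iff hx]
        exact ⟨Finset.filter_subset _ _, fun _ => ⟨g, g (x p), fun i hi =>
          ⟨hpmax i hi, by simp [hi]⟩⟩⟩
      · intro h
        have := hpmax w hwA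
        rw [← (Finset.mem_filter.1 h).2] at this
        linarith
    · exact ⟨B, hB, subset_rfl, huB, hne⟩
  obtain ⟨C, hC, hCmax⟩ := Finset.exists_max_image
    (A.powerset.filter (fun C => IsFace x A C ∧ B' ⊆ C ∧ u ∉ C)) Finset.card
    ⟨B', by simp [hB', hB'.1, huB']⟩
  simp only [Finset.mem_filter, Finset.mem_powerset] at hC hCmax
  refine ⟨C, key C hC.2.1 hC.2.2.2 (hB'ne.mono hC.2.2.1) ?_, hBB'.trans hC.2.2.1, hC.2.2.2⟩
  intro D hD hCD
  by_contra huD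
  exact absurd (Finset.card_lt_card hCD)
    (not_lt.2 (hCmax D ⟨hD.1, hD, hC.2.2.1.trans hCD.1, huD⟩))

end Faces

/-! ### Facets and ridges -/

section Ridges

variable {n d : ℕ} {x : Fin (n + 1) → EuclideanSpace ℝ (Fin d)}

lemma polytopeDim_univ (hfull : affineSpan ℝ (Set.range x) = ⊤) :
    polytopeDim x Finset.univ = d := by
  have h : vectorSpan ℝ (Set.range x) = ⊤ := by
    rw [← direction_affineSpan, hfull, AffineSubspace.direction_top]
  rw [polytopeDim, Finset.coe_univ, Set.image_univ, h]
  simp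

lemma IsFacet.exists_supports (hx : ConvexIndependent ℝ x) {A F : Finset (Fin (n + 1))}
    (hF : IsFacet x A F) : ∃ l c, Supports x A F l c :=
  ((isFace_iff hx).1 hF.1).2 hF.2.1

lemma IsFacet.exists_lt {A F : Finset (Fin (n + 1))} (hF : IsFacet x A F)
    {l : Module.Dual ℝ (EuclideanSpace ℝ (Fin d))} {c : ℝ} (hl : Supports x A F l c) :
    ∃ i ∈ A, i ∉ F ∧ l (x i) < c := by
  obtain ⟨i, hi, hiF⟩ : ∃ i ∈ A, i ∉ F := by
    by_contra hcon
    push Not at hcon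
    have h := hF.2.2
    rw [Finset.Subset.antisymm hF.1.1 hcon] at h
    omega
  exact ⟨i, hi, hiF, lt_of_le_of_ne (hl i hi).1 (fun h => hiF ((hl i hi).2.1 h))⟩

/-- A facet of a full-dimensional polytope spans a hyperplane, so that an affine functional that
vanishes on it is a multiple of its supporting functional. -/
lemma exists_mul_eq_of_isFacet (hfull : affineSpan ℝ (Set.range x) = ⊤) {F : Finset (Fin (n + 1))}
    (hF : IsFacet x Finset.univ F) {l : Module.Dual ℝ (EuclideanSpace ℝ (Fin d))} {c : ℝ}
    (hl : Supports x Finset.univ F l c) {g : Module.Dual ℝ (EuclideanSpace ℝ (Fin d))} {e : ℝ}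
    (hg : ∀ i ∈ F, g (x i) = e) : ∃ α : ℝ, ∀ i, g (x i) - e = α * (l (x i) - c) := by
  obtain ⟨j, -, hjF, hj⟩ := hF.exists_lt hl
  obtain ⟨b, hb⟩ := hF.2.1
  have hbc : l (x b) = c := (hl b (Finset.mem_univ _)).2.2 hb
  have hl0 : l ≠ 0 := by
    rintro rfl
    simp only [LinearMap.zero_apply] at hj hbc
    linarith
  have hker : dirSpan x F = LinearMap.ker l := by
    refine Submodule.eq_of_le_of_finrank_le
      (dirSpan_le_ker (c := c) (fun i hi => (hl i (Finset.mem_univ _)).2.2 hi)) ?_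
    have h1 := Module.Dual.finrank_ker_add_one_of_ne_zero hl0
    have h2 := hF.2.2
    rw [polytopeDim_univ hfull, polytopeDim_eq] at h2
    rw [finrank_euclideanSpace, Fintype.card_fin] at h1
    omega
  have hle : LinearMap.ker l ≤ LinearMap.ker g := hker ▸ dirSpan_le_ker hg
  have hmem : g ∈ Submodule.span ℝ (Set.range (fun _ : Unit => l)) :=
    mem_span_of_iInf_ker_le_ker (by simpa using hle)
  rw [Set.range_const, Submodule.mem_span_singleton] at hmem
  obtain ⟨α, rfl⟩ := hmem
  refine ⟨α, fun i => ?_⟩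
  rw [← hg b hb, LinearMap.smul_apply, LinearMap.smul_apply, hbc, smul_eq_mul, smul_eq_mul]
  ring

lemma eq_of_isFacet_subset (hx : ConvexIndependent ℝ x)
    (hfull : affineSpan ℝ (Set.range x) = ⊤) {F G : Finset (Fin (n + 1))}
    (hF : IsFacet x Finset.univ F) (hG : IsFacet x Finset.univ G) (h : F ⊆ G) : F = G := by
  obtain ⟨l, c, hl⟩ := hF.exists_supports hx
  obtain ⟨g, e, hg⟩ := hG.exists_supports hx
  obtain ⟨α, hα⟩ := exists_mul_eq_of_isFacet hfull hF hl
    (fun i hi => (hg i (Finset.mem_univ _)).2.2 (h hi))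
  obtain ⟨j, -, hjG, hj⟩ := hG.exists_lt hg
  refine Finset.Subset.antisymm h (fun i hi => ?_)
  have h0 : α ≠ 0 := by
    rintro rfl
    have := hα j
    linarith
  have := hα i
  rw [(hg i (Finset.mem_univ _)).2.2 hi, sub_self] at this
  rcases mul_eq_zero.1 this.symm with h1 | h1
  · exact absurd h1 h0
  · exact (hl i (Finset.mem_univ _)).2.1 (sub_eq_zero.1 h1)

/-- The supporting functional of a facet `G ≠ F` through the ridge `B` of `F` is, up to scaling,
the sum of one that cuts out `B` on `F` and of a multiple of the one that supports `F`. -/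
lemma exists_supports_of_ridge_subset (hx : ConvexIndependent ℝ x)
    (hfull : affineSpan ℝ (Set.range x) = ⊤) {F B G : Finset (Fin (n + 1))}
    (hF : IsFacet x Finset.univ F) (hB : IsFacet x F B) (hG : IsFacet x Finset.univ G)
    (hGF : G ≠ F) (hBG : B ⊆ G) {l m : Module.Dual ℝ (EuclideanSpace ℝ (Fin d))} {c e : ℝ}
    (hl : Supports x Finset.univ F l c) (hm : Supports x F B m e) :
    ∃ t : ℝ, ∀ i, (m (x i) - e) + t * (l (x i) - c) ≤ 0 ∧
      ((m (x i) - e) + t * (l (x i) - c) = 0 ↔ i ∈ G) := by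
  obtain ⟨g, r, hg⟩ := hG.exists_supports hx
  obtain ⟨f, hfF, hfB, hf⟩ := hB.exists_lt hm
  obtain ⟨b, hb⟩ := hB.2.1
  set β := (g (x f) - r) / (m (x f) - e) with hβ
  have hβ0 : 0 ≤ β := div_nonneg_of_nonpos (by linarith [(hg f (Finset.mem_univ _)).1])
    (by linarith)
  have hβf : g (x f) - r = β * (m (x f) - e) := by
    rw [hβ, div_mul_cancel₀ _ (by linarith : m (x f) - e ≠ 0)]
  have hgb : ∀ i ∈ B, g (x i) = r := fun i hi => (hg i (Finset.mem_univ _)).2.2 (hBG hi)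
  have hmb : ∀ i ∈ B, m (x i) = e := fun i hi => (hm i (hB.1.1 hi)).2.2 hi
  have hspan : dirSpan x (insert f B) = dirSpan x F := by
    refine Submodule.eq_of_le_of_finrank_le
      (dirSpan_mono (Finset.insert_subset hfF hB.1.1)) ?_
    have hlt : dirSpan x B < dirSpan x (insert f B) := by
      refine lt_of_le_of_ne (dirSpan_mono (Finset.subset_insert _ _)) (fun h => ?_)
      have h1 : dirSpan x B ≤ LinearMap.ker m := dirSpan_le_ker hmb
      rw [h] at h1
      have := eq_of_dirSpan_le_ker h1 (Finset.mem_insert_self f B) (Finset.mem_insert_of_mem hb)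
      rw [hmb b hb] at this
      linarith
    have h1 := Submodule.finrank_lt_finrank_of_lt hlt
    have h2 := hB.2.2
    rw [polytopeDim_eq, polytopeDim_eq] at h2
    omega
  have hgF : ∀ i ∈ F, (g - β • m) (x i) = r - β * e := by
    intro i hi
    have h1 : dirSpan x (insert f B) ≤ LinearMap.ker (g - β • m) := by
      refine dirSpan_le_ker (c := r - β * e) (fun j hj => ?_)
      rcases Finset.mem_insert.1 hj with rfl | hj
      · simp only [LinearMap.sub_apply, LinearMap.smul_apply, smul_eq_mul]
        linarith
      · simp [hgb j hj, hmb j hj]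
    rw [hspan] at h1
    rw [eq_of_dirSpan_le_ker h1 hi (hB.1.1 hb)]
    simp [hgb b hb, hmb b hb]
  obtain ⟨α, hα⟩ := exists_mul_eq_of_isFacet hfull hF hl hgF
  simp only [LinearMap.sub_apply, LinearMap.smul_apply, smul_eq_mul] at hα
  have hβpos : 0 < β := by
    refine lt_of_le_of_ne hβ0 (fun h => hGF ?_)
    refine (eq_of_isFacet_subset hx hfull hF hG (fun i hi => ?_)).symm
    have h1 := hα i
    rw [(hl i (Finset.mem_univ _)).2.2 hi, ← h] at h1
    exact (hg i (Finset.mem_univ _)).2.1 (by linarith)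
  refine ⟨α / β, fun i => ?_⟩
  have h1 : g (x i) - r = β * ((m (x i) - e) + α / β * (l (x i) - c)) := by
    rw [mul_add, ← mul_assoc, mul_div_cancel₀ _ hβpos.ne']
    linarith [hα i]
  obtain ⟨h2, h3⟩ := hg i (Finset.mem_univ _)
  constructor
  · by_contra hcon
    push Not at hcon
    nlinarith [mul_pos hβpos hcon]
  · rw [← h3, ← sub_eq_zero (a := g (x i)), h1, mul_eq_zero]
    simp [hβpos.ne']

/-- At most one facet besides `F` contains a given ridge of `F`. -/
theorem eq_of_ridge_subset (hx : ConvexIndependent ℝ x)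
    (hfull : affineSpan ℝ (Set.range x) = ⊤) {F B G G' : Finset (Fin (n + 1))}
    (hF : IsFacet x Finset.univ F) (hB : IsFacet x F B) (hG : IsFacet x Finset.univ G)
    (hG' : IsFacet x Finset.univ G') (hGF : G ≠ F) (hGF' : G' ≠ F) (hBG : B ⊆ G) (hBG' : B ⊆ G') :
    G = G' := by
  obtain ⟨l, c, hl⟩ := hF.exists_supports hx
  obtain ⟨m, e, hm⟩ := hB.exists_supports hx
  obtain ⟨t, ht⟩ := exists_supports_of_ridge_subset hx hfull hF hB hG hGF hBG hl hm
  obtain ⟨t', ht'⟩ := exists_supports_of_ridge_subset hx hfull hF hB hG' hGF' hBG' hl hm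
  -- With the larger of two parameters, the functional vanishes on the ridge only.
  have key : ∀ {G G' : Finset (Fin (n + 1))} {t t' : ℝ}, IsFacet x Finset.univ G' →
      (∀ i, (m (x i) - e) + t * (l (x i) - c) ≤ 0 ∧
        ((m (x i) - e) + t * (l (x i) - c) = 0 ↔ i ∈ G)) →
      (∀ i, (m (x i) - e) + t' * (l (x i) - c) ≤ 0 ∧
        ((m (x i) - e) + t' * (l (x i) - c) = 0 ↔ i ∈ G')) → ¬ t < t' := by
    intro G G' t t' hG' ht ht' hlt
    have hsub : G' ⊆ F := by
      intro i hi
      have h1 := (ht' i).2.2 hi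
      have h2 := (ht i).1
      have h3 := (hl i (Finset.mem_univ _)).1
      refine (hl i (Finset.mem_univ _)).2.1 ?_
      nlinarith
    have hFG := eq_of_isFacet_subset hx hfull hG' hF hsub
    obtain ⟨f, hfF, hfB, hf⟩ := hB.exists_lt hm
    have h1 := (ht' f).2.2 (hFG ▸ hfF)
    rw [(hl f (Finset.mem_univ _)).2.2 hfF] at h1
    linarith
  have htt : t = t' := le_antisymm (not_lt.1 (key hG ht' ht)) (not_lt.1 (key hG' ht ht'))
  ext i
  rw [← (ht i).2, ← (ht' i).2, htt]

/-- Every ridge of a facet `F` is the intersection of `F` with another facet, of which it is a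
ridge too: the supporting functional of `F` is rotated about the ridge. -/
theorem exists_isFacet_inter_eq (hx : ConvexIndependent ℝ x) {F B : Finset (Fin (n + 1))}
    (hF : IsFacet x Finset.univ F) (hB : IsFacet x F B) :
    ∃ G, IsFacet x Finset.univ G ∧ F ∩ G = B ∧ IsFacet x G B := by
  classical
  obtain ⟨l, c, hl⟩ := hF.exists_supports hx
  obtain ⟨m, e, hm⟩ := hB.exists_supports hx
  obtain ⟨j, -, hjF, hj⟩ := hF.exists_lt hl
  obtain ⟨f, hfF, hfB, hf⟩ := hB.exists_lt hm
  obtain ⟨b, hb⟩ := hB.2.1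
  obtain ⟨p, hp, hpmax⟩ := Finset.exists_max_image Fᶜ
    (fun i => (m (x i) - e) / (c - l (x i))) ⟨j, by simpa using hjF⟩
  rw [Finset.mem_compl] at hp
  have hlt : ∀ i ∉ F, l (x i) < c := fun i hi =>
    lt_of_le_of_ne (hl i (Finset.mem_univ _)).1 (fun h => hi ((hl i (Finset.mem_univ _)).2.1 h))
  set t := (m (x p) - e) / (c - l (x p)) with ht
  have hpos : ∀ i ∉ F, m (x i) + t * l (x i) ≤ e + t * c := by
    intro i hi
    have h1 := hpmax i (by simpa using hi)
    rw [div_le_iff₀ (by linarith [hlt i hi])] at h1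
    linarith
  have hpeq : m (x p) + t * l (x p) = e + t * c := by
    have : t * (c - l (x p)) = m (x p) - e := by
      rw [ht, div_mul_cancel₀ _ (by linarith [hlt p hp])]
    linarith
  have hFeq : ∀ i ∈ F, m (x i) + t * l (x i) = m (x i) + t * c := fun i hi => by
    rw [(hl i (Finset.mem_univ _)).2.2 hi]
  set G := Finset.univ.filter (fun i => m (x i) + t * l (x i) = e + t * c) with hG
  have hGmem : ∀ i, i ∈ G ↔ m (x i) + t * l (x i) = e + t * c := fun i => by simp [hG]
  have hsupp : Supports x Finset.univ G (m + t • l) (e + t * c) := by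
    intro i _
    simp only [LinearMap.add_apply, LinearMap.smul_apply, smul_eq_mul, hGmem, and_true]
    by_cases hi : i ∈ F
    · rw [hFeq i hi]
      linarith [(hm i hi).1]
    · exact hpos i hi
  have hFG : F ∩ G = B := by
    ext i
    rw [Finset.mem_inter, hGmem]
    constructor
    · rintro ⟨hi, h⟩
      rw [hFeq i hi] at h
      exact (hm i hi).2.1 (by linarith)
    · intro hi
      refine ⟨hB.1.1 hi, ?_⟩
      rw [hFeq i (hB.1.1 hi), (hm i (hB.1.1 hi)).2.2 hi]
  have hBG : B ⊆ G := hFG ▸ Finset.inter_subset_right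
  have hGface : IsFace x Finset.univ G :=
    (isFace_iff hx).2 ⟨Finset.subset_univ _, fun _ => ⟨_, _, hsupp⟩⟩
  -- The dimension of `G` is larger than that of `B`, since `G` is not contained in `F`.
  have hlt1 : dirSpan x B < dirSpan x G := by
    refine lt_of_le_of_ne (dirSpan_mono hBG) (fun h => ?_)
    have h1 : dirSpan x B ≤ LinearMap.ker l :=
      dirSpan_le_ker (c := c) (fun i hi => (hl i (Finset.mem_univ _)).2.2 (hB.1.1 hi))
    rw [h] at h1
    have := eq_of_dirSpan_le_ker h1 ((hGmem p).2 hpeq) (hBG hb)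
    rw [(hl b (Finset.mem_univ _)).2.2 (hB.1.1 hb)] at this
    exact (hlt p hp).ne this
  have hlt2 : dirSpan x G < dirSpan x Finset.univ := by
    refine lt_of_le_of_ne (dirSpan_mono (Finset.subset_univ _)) (fun h => ?_)
    have h1 : dirSpan x G ≤ LinearMap.ker (m + t • l) :=
      dirSpan_le_ker (c := e + t * c) (fun i hi => (hsupp i (Finset.mem_univ _)).2.2 hi)
    rw [h] at h1
    have := eq_of_dirSpan_le_ker h1 (Finset.mem_univ f) (Finset.mem_univ b)
    have hbG := (hsupp b (Finset.mem_univ _)).2.2 (hBG hb)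
    rw [hbG, LinearMap.add_apply, LinearMap.smul_apply, smul_eq_mul, hFeq f hfF] at this
    linarith
  have h1 := Submodule.finrank_lt_finrank_of_lt hlt1
  have h2 := Submodule.finrank_lt_finrank_of_lt hlt2
  have h3 := hF.2.2
  have h4 := hB.2.2
  simp only [polytopeDim_eq] at h3 h4
  refine ⟨G, ⟨hGface, ⟨b, hBG hb⟩, ?_⟩, hFG, ⟨?_, ⟨b, hb⟩, ?_⟩⟩
  · simp only [polytopeDim_eq]
    omega
  · have := hF.1.restrict hx (Finset.subset_univ G)
    rwa [Finset.inter_comm, hFG] at this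
  · simp only [polytopeDim_eq]
    omega

theorem exists_ridge_inter_subset (hx : ConvexIndependent ℝ x)
    (hfull : affineSpan ℝ (Set.range x) = ⊤) {F G : Finset (Fin (n + 1))}
    (hF : IsFacet x Finset.univ F) (hG : IsFacet x Finset.univ G) (hFG : F ≠ G)
    (hcard : 2 ≤ F.card) : ∃ B, IsFacet x F B ∧ F ∩ G ⊆ B := by
  obtain ⟨u, huF, huG⟩ := Finset.not_subset.1
    (fun h => hFG (eq_of_isFacet_subset hx hfull hF hG h))
  obtain ⟨C, hC, hsub, -⟩ := exists_isFacet_of_notMem hx hcard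
    (hG.1.restrict hx (Finset.subset_univ F)) huF (fun h => huG (Finset.mem_inter.1 h).2)
  exact ⟨C, hC, hsub⟩

end Ridges

/-! ### Enumerations of finite sets of natural numbers -/

section Enumeration

/-- The increasing enumeration of a finite set, continued above its maximum so as to be strictly
monotone on all of `ℕ`. -/
noncomputable def en (F : Finset ℕ) (i : ℕ) : ℕ :=
  if h : i < F.card then F.orderEmbOfFin rfl ⟨i, h⟩ else F.sup id + 1 + i

variable {F : Finset ℕ}

lemma en_mem {i : ℕ} (h : i < F.card) : en F i ∈ F := by
  rw [en, dif_pos h]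
  exact Finset.orderEmbOfFin_mem _ _ _

lemma en_strictMono (F : Finset ℕ) : StrictMono (en F) := by
  intro i j hij
  by_cases hj : j < F.card
  · rw [en, en, dif_pos hj, dif_pos (hij.trans hj)]
    exact (F.orderEmbOfFin rfl).strictMono (by simpa using hij)
  · by_cases hi : i < F.card
    · have h1 : en F i ≤ F.sup id := Finset.le_sup (f := id) (en_mem hi)
      rw [en.eq_1 F j, dif_neg hj]
      omega
    · rw [en, en, dif_neg hi, dif_neg hj]
      omega

lemma exists_en {y : ℕ} (h : y ∈ F) : ∃ i < F.card, en F i = y := by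
  have h1 : y ∈ Set.range (F.orderEmbOfFin rfl) := by
    rw [Finset.range_orderEmbOfFin]
    exact h
  obtain ⟨⟨i, hi⟩, rfl⟩ := h1
  exact ⟨i, hi, by rw [en, dif_pos hi]⟩

lemma en_lt_iff {i j : ℕ} : en F i < en F j ↔ i < j := (en_strictMono F).lt_iff_lt

lemma en_le_iff {i j : ℕ} : en F i ≤ en F j ↔ i ≤ j := (en_strictMono F).le_iff_le

lemma en_inj {i j : ℕ} : en F i = en F j ↔ i = j := (en_strictMono F).injective.eq_iff

lemma lt_of_en_lt {i j : ℕ} (h : en F i < en F j) : i < j := en_lt_iff.1 h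

lemma notMem_of_en_lt {i y : ℕ} (h1 : en F i < y) (h2 : y < en F (i + 1)) : y ∉ F := by
  intro h
  obtain ⟨j, -, rfl⟩ := exists_en h
  rw [en_lt_iff] at h1 h2
  omega

/-- Exactly the first `i` elements of `F` are smaller than `y`, and `y` itself is not in `F`. -/
def IsGap (F : Finset ℕ) (i y : ℕ) : Prop :=
  i ≤ F.card ∧ (∀ j < i, en F j < y) ∧ ∀ j, i ≤ j → j < F.card → y < en F j

lemma isGap_zero {y : ℕ} (h : y < en F 0) : IsGap F 0 y :=
  ⟨Nat.zero_le _, fun _ hj => absurd hj (Nat.not_lt_zero _),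
    fun _ _ _ => h.trans_le (en_le_iff.2 (Nat.zero_le _))⟩

lemma isGap_succ {i y : ℕ} (hi : i < F.card) (h1 : en F i < y)
    (h2 : i + 1 < F.card → y < en F (i + 1)) : IsGap F (i + 1) y :=
  ⟨hi, fun j hj => (en_le_iff.2 (by omega)).trans_lt h1,
    fun j hj hjc => (h2 (by omega)).trans_le (en_le_iff.2 hj)⟩

lemma exists_isGap {y : ℕ} (h : y ∉ F) : ∃ i, IsGap F i y := by
  by_cases h0 : y < en F 0
  · exact ⟨0, isGap_zero h0⟩
  push Not at h0
  rcases F.eq_empty_or_nonempty with rfl | hne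
  · exact ⟨0, by simp [IsGap]⟩
  have hc : 0 < F.card := hne.card_pos
  have hs : ((Finset.range F.card).filter (fun i => en F i ≤ y)).Nonempty :=
    ⟨0, by simp [hne, h0]⟩
  obtain ⟨i, hi, hmax⟩ := Finset.exists_max_image _ id hs
  simp only [Finset.mem_filter, Finset.mem_range, id] at hi hmax
  refine ⟨i + 1, isGap_succ hi.1 (lt_of_le_of_ne hi.2 (fun he => h (he ▸ en_mem hi.1))) ?_⟩
  intro hi1
  by_contra hcon
  have := hmax (i + 1) ⟨hi1, by omega⟩
  omega

end Enumeration

/-! ### Systems of multiplex facets -/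

section System

/-- The set of positions `lo, ..., lo + p` without `lo + u` is the position set of a facet, with
`p` vertices, of a `(d-1)`-dimensional multiplex with `c` vertices: positions `lo + u - d + 2` to
`lo + u + d - 2` without the middle one, cut off at both ends, or the first or the last `d - 1`
positions. -/
def IsRidge (d c lo u p : ℕ) : Prop :=
  lo + p + 1 ≤ c ∧ d ≤ p + 1 ∧
  ((1 ≤ u ∧ u + 2 ≤ d ∧ u + 1 ≤ p ∧ p + 2 ≤ u + d ∧ (lo = 0 ∨ u + 2 = d) ∧
      (lo + p + 1 = c ∨ p + 2 = u + d)) ∨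
    (lo = 0 ∧ u + 1 = d ∧ p + 1 = d) ∨ (lo + p + 1 = c ∧ u = 0 ∧ p + 1 = d))

/-- The positions `lo, ..., lo + p` without `lo + u`. -/
def InRidge (lo u p j : ℕ) : Prop := lo ≤ j ∧ j ≤ lo + p ∧ j ≠ lo + u

/-- The facets `F` and `G` meet in a common ridge, which is obtained from positions
`lo, ..., lo + p` of `F` by leaving out the position `lo + u`, and from positions `v, ..., v + p` of
`G` by leaving out the position `v + w`. -/
structure Adjacent (d : ℕ) (F : Finset ℕ) (lo u p : ℕ) (G : Finset ℕ) (v w : ℕ) : Prop where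
  isRidge : IsRidge d G.card v w p
  index : ∀ j, InRidge lo u p j → ∃ k, en G k = en F j ∧
    ((j < lo + u ∧ ((j < lo + w ∧ k + lo = v + j) ∨ (lo + w ≤ j ∧ k + lo = v + j + 1))) ∨
      (lo + u < j ∧ ((j < lo + w + 1 ∧ k + lo + 1 = v + j) ∨ (lo + w + 1 ≤ j ∧ k + lo = v + j))))
  inRidge_of_mem : ∀ j < F.card, en F j ∈ G → InRidge lo u p j

/-- The combinatorial properties of the collection of the facets of an ordinary `d`-polytope with
vertices `0, ..., n` that are used here: every facet is a Gale set (all elements outside it have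
the same parity of the number of smaller elements in it), every ridge lies in exactly one other
facet, and any two facets meet inside a ridge. -/
structure FacetSystem (d n : ℕ) (S : Set (Finset ℕ)) : Prop where
  odd : Odd d
  five_le : 5 ≤ d
  le_of_mem : ∀ F ∈ S, ∀ y ∈ F, y ≤ n
  le_card : ∀ F ∈ S, d ≤ F.card
  gale : ∀ F ∈ S, ∀ i i' y y', y ≤ n → y' ≤ n → IsGap F i y → IsGap F i' y' → i % 2 = i' % 2
  exists_adjacent : ∀ F ∈ S, ∀ lo u p, IsRidge d F.card lo u p →
    ∃ G ∈ S, ∃ v w, Adjacent d F lo u p G v w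
  unique : ∀ F ∈ S, ∀ G ∈ S, ∀ H ∈ S, ∀ lo u p, IsRidge d F.card lo u p → G ≠ F → H ≠ F →
    (∀ j, InRidge lo u p j → en F j ∈ G) → (∀ j, InRidge lo u p j → en F j ∈ H) → G = H
  inter : ∀ F ∈ S, ∀ G ∈ S, F ≠ G → ∃ lo u p, IsRidge d F.card lo u p ∧
    ∀ j < F.card, en F j ∈ G → InRidge lo u p j

variable {d n : ℕ} {S : Set (Finset ℕ)} {F G : Finset ℕ} {lo u p v w : ℕ}

lemma Adjacent.mem (h : Adjacent d F lo u p G v w) (hR : IsRidge d F.card lo u p) {j : ℕ}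
    (hj : InRidge lo u p j) : en F j ∈ G := by
  obtain ⟨k, hk, hk'⟩ := h.index j hj
  rw [← hk]
  refine en_mem ?_
  have := h.isRidge
  simp only [IsRidge, InRidge] at this hR hj
  omega

lemma Adjacent.notMem (h : Adjacent d F lo u p G v w) {j : ℕ} (hj : j < F.card)
    (hn : ¬ InRidge lo u p j) : en F j ∉ G := fun hm => hn (h.inRidge_of_mem j hj hm)

lemma Adjacent.center_notMem (h : Adjacent d F lo u p G v w) (hR : IsRidge d F.card lo u p) :
    en F (lo + u) ∉ G := by
  simp only [IsRidge] at hR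
  exact h.notMem (by omega) (by simp [InRidge])

lemma Adjacent.ne (h : Adjacent d F lo u p G v w) (hR : IsRidge d F.card lo u p) : G ≠ F := by
  rintro rfl
  refine h.center_notMem hR (en_mem ?_)
  simp only [IsRidge] at hR
  omega

namespace FacetSystem

variable (hS : FacetSystem d n S)
include hS

lemma en_le (hF : F ∈ S) {i : ℕ} (hi : i < F.card) : en F i ≤ n :=
  hS.le_of_mem F hF _ (en_mem hi)

lemma mod_two : d % 2 = 1 := Nat.odd_iff.1 hS.odd

/-- A facet has no isolated element, except for `0` and `n`. -/
lemma not_isolated (hF : F ∈ S) {y : ℕ} (h1 : y + 1 ∈ F) (h0 : y ∉ F) (h2 : y + 2 ∉ F)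
    (hn : y + 2 ≤ n) : False := by
  obtain ⟨i, hi, hiy⟩ := exists_en h1
  have hlow : ∀ j < i, en F j < y := fun j hj => by
    have h3 := en_lt_iff (F := F).2 hj
    rcases Nat.lt_or_ge (en F j) y with h | h
    · exact h
    · exact absurd (en_mem (by omega : j < F.card)) ((show en F j = y by omega) ▸ h0)
  have hhigh : ∀ j, i < j → j < F.card → y + 2 < en F j := fun j hj hjc => by
    have h3 := en_lt_iff (F := F).2 hj
    rcases Nat.lt_or_ge (y + 2) (en F j) with h | h
    · exact h
    · exact absurd (en_mem hjc) ((show en F j = y + 2 by omega) ▸ h2)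
  have := hS.gale F hF i (i + 1) y (y + 2) (by omega) hn
    ⟨hi.le, hlow, fun j hj hjc => lt_of_lt_of_le (by omega) (en_le_iff (F := F).2 hj)⟩
    ⟨hi, fun j hj => lt_of_le_of_lt (en_le_iff (F := F).2 (by omega : j ≤ i)) (by omega),
      fun j hj hjc => hhigh j (by omega) hjc⟩
  omega

/-- A facet that contains all elements of `d` consecutive positions of `F` is equal to `F`. -/
lemma eq_of_window_subset (hF : F ∈ S) (hG : G ∈ S) {l : ℕ} (hl : l + d ≤ F.card)
    (h : ∀ j, l ≤ j → j < l + d → en F j ∈ G) : F = G := by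
  by_contra hne
  obtain ⟨lo, u, p, hR, hin⟩ := hS.inter F hF G hG hne
  have h5 := hS.five_le
  have a1 := hin l (by omega) (h l le_rfl (by omega))
  have a2 := hin (l + d - 1) (by omega) (h _ (by omega) (by omega))
  by_cases hc : l ≤ lo + u ∧ lo + u < l + d
  · have := hin (lo + u) (by omega) (h _ hc.1 hc.2)
    simp [InRidge] at this
  · simp only [InRidge, IsRidge] at *
    omega

/-- In a facet with more than `d` elements, the elements from position `d - 1` on are
consecutive. -/
theorem en_succ_of_le (hF : F ∈ S) {i : ℕ} (hi : d ≤ i + 1)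
    (hic : i + 1 < F.card) : en F (i + 1) = en F i + 1 := by
  by_contra hne
  have h5 := hS.five_le
  have hlt := en_strictMono F (show i < i + 1 by omega)
  have hlt' := en_strictMono F (show i - 1 < i by omega)
  have hgap : en F i + 1 ∉ F := notMem_of_en_lt (i := i) (by omega) (by omega)
  have hn := hS.en_le hF hic
  have hprev : en F (i - 1) + 1 = en F i := by
    by_contra hne'
    refine hS.not_isolated hF (y := en F i - 1) ?_ ?_ ?_ (by omega)
    · rw [show en F i - 1 + 1 = en F i by omega]
      exact en_mem (by omega)
    · exact notMem_of_en_lt (i := i - 1) (by omega)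
        (by rw [show i - 1 + 1 = i by omega]; omega)
    · rwa [show en F i - 1 + 2 = en F i + 1 by omega]
  -- The facet on the other side of the ridge opposite to position `i - 1` must contain
  -- `en F i + 1`, which is a vertex between positions `i` and `i + 1` of `F`.
  obtain ⟨p, hp⟩ : ∃ p, p = min (F.card - 1 - (i + 1 - d)) (2 * d - 4) := ⟨_, rfl⟩
  have hR : IsRidge d F.card (i + 1 - d) (d - 2) p := by
    unfold IsRidge; omega
  obtain ⟨G, hG, v, w, hA⟩ := hS.exists_adjacent F hF _ _ _ hR
  have hcen := hA.center_notMem hR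
  rw [show i + 1 - d + (d - 2) = i - 1 by omega] at hcen
  have hiR : InRidge (i + 1 - d) (d - 2) p i := by unfold InRidge; omega
  have hiR' : InRidge (i + 1 - d) (d - 2) p (i + 1) := by unfold InRidge; omega
  have hmem : en F i + 1 ∈ G := by
    by_contra hcon
    refine hS.not_isolated hG (y := en F (i - 1)) ?_ hcen ?_ (by omega)
    · rw [hprev]; exact hA.mem hR hiR
    · rwa [show en F (i - 1) + 2 = en F i + 1 by omega]
  obtain ⟨k, hk, hke⟩ := exists_en hmem
  obtain ⟨k1, hk1, hk1'⟩ := hA.index _ hiR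
  obtain ⟨k2, hk2, hk2'⟩ := hA.index _ hiR'
  have e1 : k1 < k := lt_of_en_lt (F := G) (by omega)
  have e2 : k < k2 := lt_of_en_lt (F := G) (by omega)
  have hR' := hA.isRidge
  simp only [IsRidge] at hR'
  omega

/-- In a facet with `c > d` elements, those at the first `c - d + 1` positions are consecutive. -/
theorem en_succ_of_lt (hF : F ∈ S) {i : ℕ} (hi : i + d < F.card) :
    en F (i + 1) = en F i + 1 := by
  by_contra hne
  have h5 := hS.five_le
  have hlt := en_strictMono F (show i < i + 1 by omega)
  have hlt' := en_strictMono F (show i + 1 < i + 2 by omega)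
  have hgap : en F (i + 1) - 1 ∉ F := notMem_of_en_lt (i := i) (by omega) (by omega)
  have hn := hS.en_le hF (show i + 2 < F.card by omega)
  have hnext : en F (i + 2) = en F (i + 1) + 1 := by
    by_contra hne'
    refine hS.not_isolated hF (y := en F (i + 1) - 1) ?_ hgap ?_ (by omega)
    · rw [show en F (i + 1) - 1 + 1 = en F (i + 1) by omega]
      exact en_mem (by omega)
    · exact notMem_of_en_lt (i := i + 1) (by omega)
        (by rw [show i + 1 + 1 = i + 2 by omega]; omega)
  obtain ⟨u, hu⟩ : ∃ u, u = min (i + 2) (d - 2) := ⟨_, rfl⟩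
  have hR : IsRidge d F.card (i + 2 - u) u (u + (d - 2)) := by
    unfold IsRidge; omega
  obtain ⟨G, hG, v, w, hA⟩ := hS.exists_adjacent F hF _ _ _ hR
  have hcen := hA.center_notMem hR
  rw [show i + 2 - u + u = i + 2 by omega] at hcen
  have hiR : InRidge (i + 2 - u) u (u + (d - 2)) i := by unfold InRidge; omega
  have hiR' : InRidge (i + 2 - u) u (u + (d - 2)) (i + 1) := by unfold InRidge; omega
  have hmem : en F (i + 1) - 1 ∈ G := by
    by_contra hcon
    refine hS.not_isolated hG (y := en F (i + 1) - 1) ?_ hcon ?_ (by omega)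
    · rw [show en F (i + 1) - 1 + 1 = en F (i + 1) by omega]
      exact hA.mem hR hiR'
    · rwa [show en F (i + 1) - 1 + 2 = en F (i + 2) by omega]
  obtain ⟨k, hk, hke⟩ := exists_en hmem
  obtain ⟨k1, hk1, hk1'⟩ := hA.index _ hiR
  obtain ⟨k2, hk2, hk2'⟩ := hA.index _ hiR'
  have e1 : k1 < k := lt_of_en_lt (F := G) (by omega)
  have e2 : k < k2 := lt_of_en_lt (F := G) (by omega)
  have hR' := hA.isRidge
  simp only [IsRidge] at hR'
  omega

end FacetSystem

end System

/-! ### The common spread of the blocks of `d` consecutive vertices -/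

section Spread

variable {d n : ℕ} {S : Set (Finset ℕ)} {F G : Finset ℕ} {lo u p v w : ℕ}

lemma en_eq_self_of_forall_mem {m : ℕ} (h : ∀ y < m, y ∈ G) : ∀ j < m, en G j = j := by
  intro j
  induction j using Nat.strong_induction_on with
  | _ j ih =>
    intro hj
    obtain ⟨k, -, hk⟩ := exists_en (h j hj)
    have h1 : k ≤ en G k := (en_strictMono G).le_apply
    rcases Nat.lt_or_ge k j with hlt | hge
    · have := ih k hlt (by omega)
      omega
    · rwa [show k = j by omega] at hk

namespace FacetSystem

variable (hS : FacetSystem d n S)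
include hS

lemma en_eq_add (hF : F ∈ S) {i : ℕ} (hi : i + d ≤ F.card) : en F i = en F 0 + i := by
  induction i with
  | zero => simp
  | succ i ih =>
    have := ih (by omega)
    have := hS.en_succ_of_lt hF (i := i) (by omega)
    omega

lemma en_eq_add' (hF : F ∈ S) {i : ℕ} (hi : i + d ≤ F.card) :
    en F (i + d - 1) = en F (d - 1) + i := by
  have h5 := hS.five_le
  induction i with
  | zero => simp
  | succ i ih =>
    have h1 := ih (by omega)
    have h2 := hS.en_succ_of_le hF (i := i + d - 1) (by omega) (by omega)
    rw [show i + d - 1 + 1 = i + 1 + d - 1 by omega] at h2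
    omega

/-- The facet across the ridge opposite to the second vertex of `F` contains a vertex that precedes
those of `F`. It has a block that is at least as long as the first one of `F`, and equally long if
`F` has more than `d` vertices. -/
lemma exists_en_zero_lt (hF : F ∈ S) (h0 : 0 < en F 0) :
    ∃ G ∈ S, en G 0 < en F 0 ∧ ∃ j, j + d ≤ G.card ∧
      en F (d - 1) + en G j ≤ en G (j + d - 1) + en F 0 ∧
      (d < F.card → d < G.card ∧ en F (d - 1) + en G j = en G (j + d - 1) + en F 0) := by
  have h5 := hS.five_le
  have hd2 := hS.mod_two
  have hc := hS.le_card F hF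
  have h1n := hS.en_le hF (show 1 < F.card by omega)
  have h01 := en_strictMono F (show 0 < 1 by omega)
  have hz : en F 1 = en F 0 + 1 := by
    by_contra hne
    refine hS.not_isolated hF (y := en F 0 - 1) ?_ ?_ ?_ (by omega)
    · rw [show en F 0 - 1 + 1 = en F 0 by omega]
      exact en_mem (by omega)
    · intro h
      obtain ⟨k, -, hk⟩ := exists_en h
      have := en_le_iff (F := F).2 (Nat.zero_le k)
      omega
    · exact notMem_of_en_lt (i := 0) (by omega) (by simp only [zero_add]; omega)
  have hR : IsRidge d F.card 0 1 (d - 1) := by unfold IsRidge; omega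
  obtain ⟨G, hG, v, w, hA⟩ := hS.exists_adjacent F hF _ _ _ hR
  have hcen := hA.center_notMem hR
  rw [zero_add, hz] at hcen
  have hin0 : InRidge 0 1 (d - 1) 0 := by unfold InRidge; omega
  have hin2 : InRidge 0 1 (d - 1) 2 := by unfold InRidge; omega
  have hind : InRidge 0 1 (d - 1) (d - 1) := by unfold InRidge; omega
  have hmem : en F 0 - 1 ∈ G := by
    by_contra hcon
    refine hS.not_isolated hG (y := en F 0 - 1) ?_ hcon ?_ (by omega)
    · rw [show en F 0 - 1 + 1 = en F 0 by omega]
      exact hA.mem hR hin0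
    · rwa [show en F 0 - 1 + 2 = en F 0 + 1 by omega]
  obtain ⟨k, hk, hke⟩ := exists_en hmem
  obtain ⟨k0, hk0, hk0'⟩ := hA.index _ hin0
  obtain ⟨k2, hk2, hk2'⟩ := hA.index _ hin2
  obtain ⟨k3, hk3, hk3'⟩ := hA.index _ hind
  have e1 : k < k0 := lt_of_en_lt (F := G) (by omega)
  have hR' := hA.isRidge
  simp only [IsRidge] at hR'
  refine ⟨G, hG, ?_, v, by omega, ?_, fun hcd => ?_⟩
  · have := en_le_iff (F := G).2 (Nat.zero_le k)
    omega
  · have i1 : en G v ≤ en G k0 := en_le_iff.2 (by omega)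
    have i2 : en G k3 ≤ en G (v + d - 1) := en_le_iff.2 (by omega)
    omega
  · have hw : w ≠ 0 := by
      intro hw
      have hdn := hS.en_le hF hcd
      have hdl := en_strictMono F (show d - 1 < d by omega)
      have h12 := en_strictMono F (show 1 < 2 by omega)
      -- Otherwise `en F (d - 1)` is the last element of `G`, which contradicts the parity of gaps.
      have g1 : IsGap G (v + 1 + 1) (en F 0 + 1) := by
        refine isGap_succ (by omega) ?_ (fun _ => ?_)
        · rw [show v + 1 = k0 by omega]; omega
        · rw [show v + 1 + 1 = k2 by omega]; omega
      have g2 : IsGap G (v + d - 1 + 1) (en F (d - 1) + 1) := by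
        refine isGap_succ (by omega) ?_ (fun _ => by omega)
        rw [show v + d - 1 = k3 by omega]; omega
      have := hS.gale G hG _ _ _ _ (by omega) (by omega) g1 g2
      omega
    have ek0 : k0 = v := by omega
    have ek3 : k3 = v + d - 1 := by omega
    rw [← ek3, hk3, ← ek0, hk0]
    omega

lemma exists_en_zero_eq (hne : S.Nonempty) : ∃ F ∈ S, en F 0 = 0 := by
  obtain ⟨F, hF⟩ := hne
  induction hm : en F 0 using Nat.strong_induction_on generalizing F with
  | _ m ih =>
    rcases Nat.eq_zero_or_pos m with rfl | hpos
    · exact ⟨F, hF, hm⟩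
    · obtain ⟨G, hG, hlt, -⟩ := hS.exists_en_zero_lt hF (hm ▸ hpos)
      exact ih _ (hm ▸ hlt) G hG rfl

/-- If a facet contains `0`, then the pairs among its first `d` elements other than the last one can
be moved down one after the other, by passing to adjacent facets. -/
lemma exists_slide (hF : F ∈ S) (h0 : en F 0 = 0) :
    ∃ G ∈ S, en G (d - 1) = en F (d - 1) ∧ (d < F.card → d < G.card) ∧
      (∀ j, j + 3 ≤ d → en G j = j) ∧
      (en G (d - 2) = d - 2 ∨ en G (d - 2) + 1 = en G (d - 1)) := by
  have h5 := hS.five_le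
  induction hm : ∑ j ∈ Finset.range d, en F j using Nat.strong_induction_on generalizing F with
  | _ m ih =>
  have hc := hS.le_card F hF
  by_cases hall : ∀ j, j + 3 ≤ d → en F j = j
  · refine ⟨F, hF, rfl, id, hall, ?_⟩
    by_contra! hcon
    have e3 := hall (d - 3) (by omega)
    have l1 := en_strictMono F (show d - 3 < d - 2 by omega)
    have l2 := en_strictMono F (show d - 2 < d - 1 by omega)
    have hn := hS.en_le hF (show d - 1 < F.card by omega)
    refine hS.not_isolated hF (y := en F (d - 2) - 1) ?_ ?_ ?_ (by omega)
    · rw [show en F (d - 2) - 1 + 1 = en F (d - 2) by omega]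
      exact en_mem (by omega)
    · exact notMem_of_en_lt (i := d - 3) (by omega)
        (by rw [show d - 3 + 1 = d - 2 by omega]; omega)
    · exact notMem_of_en_lt (i := d - 2) (by omega)
        (by rw [show d - 2 + 1 = d - 1 by omega]; omega)
  · push Not at hall
    obtain ⟨i, ⟨hi, hne⟩, hmin⟩ : ∃ i, (i + 3 ≤ d ∧ en F i ≠ i) ∧ ∀ j < i, en F j = j := by
      refine ⟨Nat.find hall, Nat.find_spec hall, fun j hj => ?_⟩
      by_contra hne
      have := (Nat.find_spec hall).1
      exact Nat.find_min hall hj ⟨by omega, hne⟩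
    have hi0 : 0 < i := Nat.pos_of_ne_zero (fun h => hne (h ▸ h0))
    have hprev := hmin (i - 1) (by omega)
    have hge : i ≤ en F i := (en_strictMono F).le_apply
    have l2 := en_strictMono F (show i < i + 1 by omega)
    have l3 := en_strictMono F (show i + 1 < i + 2 by omega)
    have hn := hS.en_le hF (show i + 1 < F.card by omega)
    have hgap : en F i - 1 ∉ F := notMem_of_en_lt (i := i - 1) (by omega)
      (by rw [show i - 1 + 1 = i by omega]; omega)
    have hnext : en F (i + 1) = en F i + 1 := by
      by_contra hne'
      refine hS.not_isolated hF (y := en F i - 1) ?_ hgap ?_ (by omega)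
      · rw [show en F i - 1 + 1 = en F i by omega]
        exact en_mem (by omega)
      · exact notMem_of_en_lt (i := i) (by omega) (by omega)
    obtain ⟨p, hp⟩ : ∃ p, p = i + 1 + min (F.card - 1 - (i + 1)) (d - 2) := ⟨_, rfl⟩
    have hR : IsRidge d F.card 0 (i + 1) p := by unfold IsRidge; omega
    obtain ⟨G, hG, v, w, hA⟩ := hS.exists_adjacent F hF _ _ _ hR
    have hcen := hA.center_notMem hR
    rw [zero_add, hnext] at hcen
    have hin : ∀ j, j < d → j ≠ i + 1 → InRidge 0 (i + 1) p j := by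
      intro j hj hj'
      unfold InRidge; omega
    have hmem : en F i - 1 ∈ G := by
      by_contra hcon
      refine hS.not_isolated hG (y := en F i - 1) ?_ hcon ?_ (by omega)
      · rw [show en F i - 1 + 1 = en F i by omega]
        exact hA.mem hR (hin i (by omega) (by omega))
      · rwa [show en F i - 1 + 2 = en F i + 1 by omega]
    obtain ⟨k, hk, hke⟩ := exists_en hmem
    obtain ⟨k0, hk0, hk0'⟩ := hA.index _ (hin 0 (by omega) (by omega))
    obtain ⟨k1, hk1, hk1'⟩ := hA.index _ (hin (i - 1) (by omega) (by omega))
    obtain ⟨k2, hk2, hk2'⟩ := hA.index _ (hin i (by omega) (by omega))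
    have hk00 : k0 = 0 := by
      have : k0 ≤ en G k0 := (en_strictMono G).le_apply
      omega
    have e1 : k1 < k := lt_of_en_lt (F := G) (by omega)
    have e2 : k < k2 := lt_of_en_lt (F := G) (by omega)
    have hv : v = 0 := by omega
    have hw : w = i := by omega
    have hki : k = i := by omega
    have hcase : ∀ j < d, (j = i ∧ en G j + 1 = en F i) ∨ (j = i + 1 ∧ en G j = en F i) ∨
        (j ≠ i ∧ j ≠ i + 1 ∧ en G j = en F j) := by
      intro j hj
      by_cases h1 : j = i
      · refine Or.inl ⟨h1, ?_⟩
        have : en G j = en G k := by congr 1; omega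
        omega
      · by_cases h2 : j = i + 1
        · refine Or.inr (Or.inl ⟨h2, ?_⟩)
          rw [h2, show i + 1 = k2 by omega]; omega
        · obtain ⟨k', hk', hk''⟩ := hA.index _ (hin j hj h2)
          refine Or.inr (Or.inr ⟨h1, h2, ?_⟩)
          rw [← hk']
          congr 1
          omega
    have hR' := hA.isRidge
    simp only [IsRidge] at hR'
    have hsum : ∑ j ∈ Finset.range d, en G j < ∑ j ∈ Finset.range d, en F j := by
      refine Finset.sum_lt_sum (fun j hj => ?_) ⟨i, by simp; omega, ?_⟩
      · rcases hcase j (by simpa using hj) with ⟨rfl, h⟩ | ⟨rfl, h⟩ | ⟨-, -, h⟩ <;> omega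
      · rcases hcase i (by omega) with ⟨_, h⟩ | ⟨h', h⟩ | ⟨h', -, h⟩ <;> omega
    have hG0 : en G 0 = 0 := by
      rw [← hk00]; omega
    obtain ⟨H, hH, h1, h2, h3⟩ := ih _ (hm ▸ hsum) hG hG0 rfl
    refine ⟨H, hH, ?_, fun hcd => h2 (by omega), h3⟩
    rw [h1]
    rcases hcase (d - 1) (by omega) with ⟨h', h⟩ | ⟨h', h⟩ | ⟨-, -, h⟩
    · omega
    · omega
    · exact h

/-- From a facet that starts with `0, ..., d - 2, t` one gets a facet that starts with
`0, ..., d - 3, t - 1, t`. -/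
lemma exists_pair_of_initial (hF : F ∈ S) (hinit : ∀ j, j + 2 ≤ d → en F j = j) {t : ℕ}
    (ht : en F (d - 1) = t) (hdt : d ≤ t) :
    ∃ G ∈ S, (∀ j, j + 3 ≤ d → en G j = j) ∧ en G (d - 2) + 1 = t ∧ en G (d - 1) = t ∧
      (t < n → t + 1 ∈ G) := by
  have h5 := hS.five_le
  have hd2 := hS.mod_two
  have hc := hS.le_card F hF
  have e2 := hinit (d - 2) (by omega)
  have e3 := hinit (d - 3) (by omega)
  have htn := hS.en_le hF (show d - 1 < F.card by omega)
  rw [ht] at htn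
  have hcd : t < n → d < F.card := by
    intro htn'
    by_contra hcon
    have g1 : IsGap F (d - 2 + 1) (d - 1) := by
      refine isGap_succ (by omega) (by omega) (fun _ => ?_)
      rw [show d - 2 + 1 = d - 1 by omega]; omega
    have g2 : IsGap F (d - 1 + 1) (t + 1) :=
      isGap_succ (by omega) (by omega) (fun _ => by omega)
    have := hS.gale F hF _ _ _ _ (by omega) (by omega) g1 g2
    omega
  obtain ⟨p, hp⟩ : ∃ p, p = d - 2 + min (F.card - 1 - (d - 2)) (d - 2) := ⟨_, rfl⟩
  have hR : IsRidge d F.card 0 (d - 2) p := by unfold IsRidge; omega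
  obtain ⟨G, hG, v, w, hA⟩ := hS.exists_adjacent F hF _ _ _ hR
  have hcen := hA.center_notMem hR
  rw [zero_add, e2] at hcen
  have hin : ∀ j, j < d → j ≠ d - 2 → InRidge 0 (d - 2) p j := by
    intro j hj hj'
    unfold InRidge; omega
  have hvw : v = 0 ∧ 1 ≤ w := by
    obtain ⟨k0, hk0, hk0'⟩ := hA.index _ (hin 0 (by omega) (by omega))
    have h1 : k0 ≤ en G k0 := (en_strictMono G).le_apply
    have h2 := hinit 0 (by omega)
    clear hcd hp
    omega
  obtain ⟨rfl, hw0⟩ := hvw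
  have hw1 : ¬ w + 3 ≤ d := by
    intro hw
    obtain ⟨a, ha, ha'⟩ := hA.index _ (hin (w - 1) (by omega) (by omega))
    obtain ⟨b, hb, hb'⟩ := hA.index _ (hin w (by omega) (by omega))
    rw [hinit (w - 1) (by omega)] at ha
    rw [hinit w (by omega)] at hb
    have i1 := en_strictMono G (show a < w by omega)
    have i2 := en_strictMono G (show w < b by omega)
    omega
  obtain ⟨k1, hk1, hk1'⟩ := hA.index _ (hin (d - 1) (by omega) (by omega))
  have hGc : d ≤ G.card := hS.le_card G hG
  have hw2 : w = d - 2 := by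
    by_contra hne
    have h1 := hS.en_le hG (show d - 1 < G.card by omega)
    have h2 := en_strictMono G (show k1 < d - 1 by omega)
    have hpd : p + 1 = d := by
      have := hA.isRidge
      simp only [IsRidge] at this
      omega
    have := hcd (by omega)
    omega
  obtain ⟨k3, hk3, hk3'⟩ := hA.index _ (hin (d - 3) (by omega) (by omega))
  have hGl : en G (d - 1) = t := by
    rw [show d - 1 = k1 by omega, hk1, ht]
  have hG3 : en G (d - 3) = d - 3 := by
    rw [show en G (d - 3) = en G k3 by congr 1; omega, hk3, e3]
  have i1 := en_strictMono G (show d - 3 < d - 2 by omega)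
  have i2 := en_strictMono G (show d - 2 < d - 1 by omega)
  refine ⟨G, hG, fun j hj => ?_, ?_, hGl, fun htn' => ?_⟩
  · obtain ⟨k', hk', hk''⟩ := hA.index _ (hin j (by omega) (by omega))
    rw [show en G j = en G k' by congr 1; omega, hk', hinit j (by omega)]
  · by_contra hne
    have hne2 : en G (d - 2) ≠ d - 2 := fun h => hcen (h ▸ en_mem (by omega))
    refine hS.not_isolated hG (y := en G (d - 2) - 1) ?_ ?_ ?_ (by omega)
    · rw [show en G (d - 2) - 1 + 1 = en G (d - 2) by omega]
      exact en_mem (by omega)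
    · exact notMem_of_en_lt (i := d - 3) (by omega)
        (by rw [show d - 3 + 1 = d - 2 by omega]; omega)
    · exact notMem_of_en_lt (i := d - 2) (by omega)
        (by rw [show d - 2 + 1 = d - 1 by omega]; omega)
  · have hcd' := hcd htn'
    have h1 := hS.en_succ_of_le hF (i := d - 1) (by omega) (by omega)
    rw [ht, show d - 1 + 1 = d by omega] at h1
    rw [← h1]
    exact hA.mem hR (by unfold InRidge; omega)

/-- The last pair among the first `d` elements can be moved down as well. -/
lemma exists_pair_pred (hF : F ∈ S) (hinit : ∀ j, j + 3 ≤ d → en F j = j) {t : ℕ}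
    (ht' : en F (d - 2) + 1 = t) (ht : en F (d - 1) = t) (hdt : d ≤ t) :
    ∃ G ∈ S, (∀ j, j + 3 ≤ d → en G j = j) ∧ en G (d - 2) + 1 = t - 1 ∧
      en G (d - 1) = t - 1 := by
  have h5 := hS.five_le
  have hc := hS.le_card F hF
  have htn := hS.en_le hF (show d - 1 < F.card by omega)
  have e3 := hinit (d - 3) (by omega)
  have hR : IsRidge d F.card 0 (d - 1) (d - 1) := by unfold IsRidge; omega
  obtain ⟨G, hG, v, w, hA⟩ := hS.exists_adjacent F hF _ _ _ hR
  have hcen := hA.center_notMem hR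
  rw [zero_add, ht] at hcen
  have hin : ∀ j, j < d - 1 → InRidge 0 (d - 1) (d - 1) j := by
    intro j hj
    unfold InRidge; omega
  have hmem : t - 2 ∈ G := by
    by_contra hcon
    refine hS.not_isolated hG (y := t - 2) ?_ hcon ?_ (by omega)
    · rw [show t - 2 + 1 = en F (d - 2) by omega]
      exact hA.mem hR (hin _ (by omega))
    · rwa [show t - 2 + 2 = t by omega]
  obtain ⟨k, hk, hke⟩ := exists_en hmem
  obtain ⟨k0, hk0, hk0'⟩ := hA.index _ (hin 0 (by omega))
  obtain ⟨k3, hk3, hk3'⟩ := hA.index _ (hin (d - 3) (by omega))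
  obtain ⟨k2, hk2, hk2'⟩ := hA.index _ (hin (d - 2) (by omega))
  have hk00 : k0 = 0 := by
    have : k0 ≤ en G k0 := (en_strictMono G).le_apply
    have := hinit 0 (by omega)
    omega
  have e1 : k3 < k := lt_of_en_lt (F := G) (by omega)
  have e2 : k < k2 := lt_of_en_lt (F := G) (by omega)
  refine ⟨G, hG, fun j hj => ?_, ?_, ?_⟩
  · obtain ⟨k', hk', hk''⟩ := hA.index _ (hin j (by omega))
    rw [show en G j = en G k' by congr 1; omega, hk', hinit j (by omega)]
  · rw [show en G (d - 2) = en G k by congr 1; omega]; omega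
  · rw [show en G (d - 1) = en G k2 by congr 1; omega]; omega

lemma exists_pair_of_le (hF : F ∈ S) (hinit : ∀ j, j + 3 ≤ d → en F j = j) {t : ℕ}
    (ht' : en F (d - 2) + 1 = t) (ht : en F (d - 1) = t) {s : ℕ} (hs : d ≤ s + 1) (hst : s ≤ t) :
    ∃ G ∈ S, (∀ j, j + 3 ≤ d → en G j = j) ∧ en G (d - 2) + 1 = s ∧ en G (d - 1) = s := by
  induction t, hst using Nat.le_induction generalizing F with
  | base => exact ⟨F, hF, hinit, ht', ht⟩
  | succ t hst ih =>
    obtain ⟨G, hG, h1, h2, h3⟩ := hS.exists_pair_pred hF hinit ht' ht (by omega)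
    exact ih hG h1 h2 h3

/-- If `F` starts with `0, ..., d - 3, t - 1, t`, a facet that contains these elements is `F`. -/
lemma eq_of_pair (hF : F ∈ S) (hG : G ∈ S) (hinit : ∀ j, j + 3 ≤ d → en F j = j) {t : ℕ}
    (ht' : en F (d - 2) + 1 = t) (ht : en F (d - 1) = t) (h : ∀ j, j + 3 ≤ d → j ∈ G)
    (hG' : t - 1 ∈ G) (hGt : t ∈ G) : F = G := by
  have h5 := hS.five_le
  refine hS.eq_of_window_subset hF hG (l := 0) (by have := hS.le_card F hF; omega) ?_
  intro j _ hj
  rcases (by omega : j + 3 ≤ d ∨ j = d - 2 ∨ j = d - 1) with h1 | rfl | rfl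
  · rw [hinit j h1]; exact h j h1
  · rwa [show en F (d - 2) = t - 1 by omega]
  · rwa [ht]

/-- There is a number `κ` such that the `d`-th element of a facet that contains `0` is at most `κ`,
with equality if the facet has more than `d` elements. -/
lemma exists_spread_zero (hne : S.Nonempty) :
    ∃ κ, d ≤ κ ∧ ∀ F ∈ S, en F 0 = 0 →
      en F (d - 1) ≤ κ ∧ (d < F.card → en F (d - 1) = κ) := by
  have h5 := hS.five_le
  -- the facet that starts with `0, ..., d - 1`
  obtain ⟨Y, hY, hYinit⟩ : ∃ Y ∈ S, ∀ j, j < d → en Y j = j := by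
    obtain ⟨F, hF, h0⟩ := hS.exists_en_zero_eq hne
    have key : ∀ G ∈ S, (∀ j, j + 3 ≤ d → en G j = j) → en G (d - 2) + 1 = en G (d - 1) →
        ∃ Y ∈ S, ∀ j, j < d → en Y j = j := by
      intro G hG h3 h4
      have : d - 1 ≤ en G (d - 1) := (en_strictMono G).le_apply
      obtain ⟨Y, hY, h5, h6, h7⟩ :=
        hS.exists_pair_of_le hG h3 h4 rfl (s := d - 1) (by omega) this
      refine ⟨Y, hY, fun j hj => ?_⟩
      rcases (by omega : j + 3 ≤ d ∨ j = d - 2 ∨ j = d - 1) with h | rfl | rfl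
      · exact h5 j h
      · omega
      · exact h7
    obtain ⟨G, hG, -, -, h3, h4 | h4⟩ := hS.exists_slide hF h0
    · have hin : ∀ j, j + 2 ≤ d → en G j = j := by
        intro j hj
        rcases (by omega : j + 3 ≤ d ∨ j = d - 2) with h | rfl
        · exact h3 j h
        · exact h4
      have hle : d - 1 ≤ en G (d - 1) := (en_strictMono G).le_apply
      rcases (by omega : en G (d - 1) = d - 1 ∨ d ≤ en G (d - 1)) with h | h
      · exact key G hG h3 (by omega)
      · obtain ⟨H, hH, h6, h7, h8, -⟩ := hS.exists_pair_of_initial hG hin rfl h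
        exact key H hH h6 (by omega)
    · exact key G hG h3 h4
  have hYc := hS.le_card Y hY
  have hRY : IsRidge d Y.card 0 (d - 1) (d - 1) := by unfold IsRidge; omega
  obtain ⟨X, hX, v, w, hA⟩ := hS.exists_adjacent Y hY _ _ _ hRY
  have hXne := hA.ne hRY
  have hXinit : ∀ j, j + 2 ≤ d → en X j = j := by
    intro j hj
    refine en_eq_self_of_forall_mem (m := d - 1) (fun y hy => ?_) j (by omega)
    have := hA.mem hRY (j := y) (by unfold InRidge; omega)
    rwa [hYinit y (by omega)] at this
  have hcen := hA.center_notMem hRY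
  rw [zero_add, hYinit _ (by omega)] at hcen
  have hXc := hS.le_card X hX
  have hκ : d ≤ en X (d - 1) := by
    have h1 : d - 1 ≤ en X (d - 1) := (en_strictMono X).le_apply
    rcases (by omega : en X (d - 1) = d - 1 ∨ d ≤ en X (d - 1)) with h | h
    · exact absurd (h ▸ en_mem (by omega)) hcen
    · exact h
  obtain ⟨κ, hκdef⟩ : ∃ κ, en X (d - 1) = κ := ⟨_, rfl⟩
  rw [hκdef] at hκ
  have hκn := hS.en_le hX (show d - 1 < X.card by omega)
  rw [hκdef] at hκn
  -- the ridge `0, ..., d - 2` lies in no facet besides `Y` and `X`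
  have huniq : ∀ G ∈ S, (∀ j, j + 2 ≤ d → en G j = j) → d ≤ en G (d - 1) →
      en G (d - 1) = κ := by
    intro G hG hin hd
    have hGc := hS.le_card G hG
    have hGX : G = X := by
      refine hS.unique Y hY G hG X hX _ _ _ hRY ?_ hXne (fun j hj => ?_)
        (fun j hj => hA.mem hRY hj)
      · rintro rfl
        have := hYinit (d - 1) (by omega)
        omega
      · simp only [InRidge] at hj
        rw [hYinit j (by omega), ← hin j (by omega)]
        exact en_mem (by omega)
    rw [hGX, hκdef]
  obtain ⟨P, hP, hP1, hP2, hP3, hP4⟩ := hS.exists_pair_of_initial hX hXinit hκdef hκ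
  have hPc := hS.le_card P hP
  have hPmem : ∀ j, j + 3 ≤ d → j ∈ P := fun j hj => by
    have := en_mem (F := P) (i := j) (by omega)
    rwa [hP1 j hj] at this
  have hPκ : κ ∈ P := by
    have := en_mem (F := P) (i := d - 1) (by omega)
    rwa [hP3] at this
  have hPκ' : κ - 1 ∈ P := by
    have := en_mem (F := P) (i := d - 2) (by omega)
    rwa [show en P (d - 2) = κ - 1 by omega] at this
  have hpair : ∀ G ∈ S, (∀ j, j + 3 ≤ d → en G j = j) → en G (d - 2) + 1 = en G (d - 1) →
      en G (d - 1) ≤ κ := by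
    intro G hG h3 h4
    by_contra hcon
    push Not at hcon
    have hGn := hS.en_le hG (show d - 1 < G.card by have := hS.le_card G hG; omega)
    obtain ⟨H, hH, h6, h7, h8⟩ :=
      hS.exists_pair_of_le hG h3 h4 rfl (s := κ + 1) (by omega) hcon
    have hHP : H = P := hS.eq_of_pair hH hP h6 h7 h8 hPmem (by simpa using hPκ)
      (hP4 (by omega))
    rw [hHP] at h8
    omega
  refine ⟨κ, hκ, fun F hF h0 => ?_⟩
  obtain ⟨G, hG, h1, h2, h3, h4⟩ := hS.exists_slide hF h0
  have hle : d - 1 ≤ en G (d - 1) := (en_strictMono G).le_apply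
  have hin : en G (d - 2) = d - 2 → ∀ j, j + 2 ≤ d → en G j = j := by
    intro h4 j hj
    rcases (by omega : j + 3 ≤ d ∨ j = d - 2) with h | rfl
    · exact h3 j h
    · exact h4
  have hGκ : en G (d - 1) ≤ κ := by
    rcases h4 with h4 | h4
    · rcases (by omega : en G (d - 1) = d - 1 ∨ d ≤ en G (d - 1)) with h | h
      · omega
      · exact (huniq G hG (hin h4) h).le
    · exact hpair G hG h3 h4
  rw [← h1]
  refine ⟨hGκ, fun hcd => ?_⟩
  by_contra hlt
  have hGc := h2 hcd
  have h4' : en G (d - 2) + 1 = en G (d - 1) := by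
    rcases h4 with h4 | h4
    · rcases (by omega : en G (d - 1) = d - 1 ∨ d ≤ en G (d - 1)) with h | h
      · omega
      · exact absurd (huniq G hG (hin h4) h) hlt
    · exact h4
  -- `G` also contains the element after its `d`-th one, and so the block of another facet
  have hnext := hS.en_succ_of_le hG (i := d - 1) (by omega) (by omega)
  rw [show d - 1 + 1 = d by omega] at hnext
  obtain ⟨H, hH, h6, h7, h8⟩ :=
    hS.exists_pair_of_le hP hP1 hP2 hP3 (s := en G (d - 1) + 1) (by omega) (by omega)
  have hHG : H = G := by
    refine hS.eq_of_pair hH hG h6 h7 h8 (fun j hj => ?_) ?_ ?_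
    · have := en_mem (F := G) (i := j) (by omega)
      rwa [h3 j hj] at this
    · simpa using en_mem (F := G) (i := d - 1) (by omega)
    · rw [← hnext]
      exact en_mem (by omega)
  rw [hHG] at h8
  omega

/-- All blocks of `d` consecutive elements of facets with more than `d` elements have the same
difference `κ` between the last and the first element, and no block of a facet has a larger one. -/
theorem exists_spread (hne : S.Nonempty) :
    ∃ κ, d ≤ κ ∧ ∀ F ∈ S, ∀ i j, i + d = j + 1 → j < F.card →
      en F j ≤ en F i + κ ∧ (d < F.card → en F j = en F i + κ) := by
  have h5 := hS.five_le
  obtain ⟨κ, hκ, h0⟩ := hS.exists_spread_zero hne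
  refine ⟨κ, hκ, fun F hF => ?_⟩
  have key : en F (d - 1) ≤ en F 0 + κ ∧ (d < F.card → en F (d - 1) = en F 0 + κ) := by
    induction hm : en F 0 using Nat.strong_induction_on generalizing F with
    | _ m ih =>
      rcases Nat.eq_zero_or_pos m with rfl | hpos
      · simpa using h0 F hF hm
      · obtain ⟨G, hG, hlt, j, hj, h1, h2⟩ := hS.exists_en_zero_lt hF (hm ▸ hpos)
        have h3 := ih _ (hm ▸ hlt) G hG rfl
        have h4 := hS.en_eq_add hG hj
        have h6 := hS.en_eq_add' hG hj
        refine ⟨by omega, fun hcd => ?_⟩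
        have := h2 hcd
        have := h3.2 this.1
        omega
  intro i j hij hj
  have h4 := hS.en_eq_add hF (i := i) (by omega)
  have h6 := hS.en_eq_add' hF (i := i) (by omega)
  rw [show i + d - 1 = j by omega] at h6
  refine ⟨by omega, fun hcd => ?_⟩
  have := key.2 hcd
  omega

end FacetSystem

end Spread

/-! ### Ridges shared with earlier facets -/

section Early

variable {d n κ : ℕ} {S : Set (Finset ℕ)} {F G H : Finset ℕ} {lo u p v w : ℕ}

/-- `G` precedes `F` in the colexicographic order, and `y` is the largest element of their symmetric
difference. -/
def ColexDiff (G F : Finset ℕ) (y : ℕ) : Prop :=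
  y ∈ F ∧ y ∉ G ∧ ∀ z, y < z → (z ∈ F ↔ z ∈ G)

lemma ColexDiff.ne {y : ℕ} (h : ColexDiff G F y) : G ≠ F := by
  rintro rfl
  exact h.2.1 h.1

lemma exists_colexDiff (h : G ≠ F) : (∃ y, ColexDiff G F y) ∨ ∃ y, ColexDiff F G y := by
  have hne : (symmDiff F G).Nonempty := by
    rw [Finset.nonempty_iff_ne_empty]
    intro h'
    exact h (symmDiff_eq_bot.1 h').symm
  obtain ⟨y, hy, hmax⟩ := Finset.exists_max_image _ id hne
  have habove : ∀ z, y < z → (z ∈ F ↔ z ∈ G) := by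
    intro z hz
    by_contra hcon
    have : z ∈ symmDiff F G := by
      rw [Finset.mem_symmDiff]
      tauto
    exact absurd (hmax z this) (not_le.2 hz)
  rw [Finset.mem_symmDiff] at hy
  rcases hy with hy | hy
  · exact Or.inl ⟨y, hy.1, hy.2, habove⟩
  · exact Or.inr ⟨y, hy.1, hy.2, fun z hz => (habove z hz).symm⟩

/-- If `F` precedes `G`, then `G` has an element outside `F` above each element of `F \ G`. -/
lemma exists_lt_of_not_colexDiff (hne : G ≠ F) (hcon : ¬ ∃ y, ColexDiff G F y) {z : ℕ}
    (hzF : z ∈ F) (hzG : z ∉ G) : ∃ y ∈ G, y ∉ F ∧ z < y := by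
  obtain ⟨y, hy1, hy2, hy3⟩ := (exists_colexDiff hne).resolve_left hcon
  refine ⟨y, hy1, hy2, ?_⟩
  by_contra hle
  push Not at hle
  rcases lt_or_eq_of_le hle with hlt | heq
  · exact hzG ((hy3 z hlt).2 hzF)
  · exact hy2 (heq ▸ hzF)

/-- Every position `v, ..., v + p` of `G`, except for `v + w`, belongs to the common ridge. -/
lemma Adjacent.exists_eq (hA : Adjacent d F lo u p G v w) {k : ℕ} (h1 : v ≤ k) (h2 : k ≤ v + p)
    (h3 : k ≠ v + w) : ∃ j, InRidge lo u p j ∧ en G k = en F j := by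
  have hR' := hA.isRidge
  simp only [IsRidge] at hR'
  obtain ⟨i, hi⟩ : ∃ i, (k < v + w ∧ v + i = k) ∨ (v + w < k ∧ v + i + 1 = k) := by
    rcases lt_or_gt_of_ne h3 with h | h
    · exact ⟨k - v, Or.inl ⟨h, by omega⟩⟩
    · exact ⟨k - v - 1, Or.inr ⟨h, by omega⟩⟩
  have hip : i < p := by omega
  obtain ⟨j, hj⟩ : ∃ j, (i < u ∧ j = lo + i) ∨ (u ≤ i ∧ j = lo + i + 1) := by
    rcases Nat.lt_or_ge i u with h | h
    · exact ⟨_, Or.inl ⟨h, rfl⟩⟩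
    · exact ⟨_, Or.inr ⟨h, rfl⟩⟩
  clear hR'
  have hin : InRidge lo u p j := by unfold InRidge; omega
  obtain ⟨k', hk, hk'⟩ := hA.index j hin
  refine ⟨j, hin, ?_⟩
  rw [← hk]
  congr 1
  omega

lemma Adjacent.eq_center (hA : Adjacent d F lo u p G v w) {k : ℕ} (h1 : v ≤ k) (h2 : k ≤ v + p)
    (h3 : en G k ∉ F) (hR : IsRidge d F.card lo u p) : k = v + w := by
  by_contra hne
  obtain ⟨j, hj, hkj⟩ := hA.exists_eq h1 h2 hne
  refine h3 (hkj ▸ en_mem ?_)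
  simp only [IsRidge] at hR
  simp only [InRidge] at hj
  omega

lemma eq_card_of_max {y k : ℕ} (hk : k < F.card) (hky : en F k = y) (h : ∀ z ∈ F, z ≤ y) :
    k + 1 = F.card := by
  by_contra hne
  have h1 := h _ (en_mem (show k + 1 < F.card by omega))
  have h2 := en_strictMono F (show k < k + 1 by omega)
  omega

lemma le_en_last {q y : ℕ} (hq : q + 1 = F.card) (hy : y ∈ F) : y ≤ en F q := by
  obtain ⟨i, hi, rfl⟩ := exists_en hy
  exact en_le_iff.2 (by omega)

/-- If the elements of `H` from `en F b` on belong to `F`, then `H` is there at least as sparse as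
`F`. -/
lemma en_add_le {b h m : ℕ} (hin : ∀ y ∈ H, en F b ≤ y → y ∈ F) (hb : en F b ≤ en H h)
    (hm : h + m < H.card) : en F (b + m) ≤ en H (h + m) := by
  induction m with
  | zero => simpa using hb
  | succ m ih =>
    have h1 := ih (by omega)
    have h2 := en_strictMono H (show h + m < h + (m + 1) by omega)
    have h3 : en F b ≤ en F (b + m) := en_le_iff.2 (by omega)
    obtain ⟨j, -, hj⟩ := exists_en (hin _ (en_mem hm) (by omega))
    rw [← hj]
    rw [← hj] at h2
    have : b + m < j := lt_of_en_lt (F := F) (by omega)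
    exact en_le_iff.2 (by omega)

/-- If moreover `H` lacks an element `en F s` of `F`, it is strictly sparser. -/
lemma en_succ_le_of_notMem {b h s q : ℕ} (hin : ∀ y ∈ H, en F b ≤ y → y ∈ F)
    (hb : en F b ≤ en H h) (hbs : b ≤ s) (hsq : s ≤ q) (hs : en F s ∉ H)
    (hq : h + (q - b) < H.card) : en F (q + 1) ≤ en H (h + (q - b)) := by
  have h1 := en_add_le (m := s - b) hin hb (by omega)
  rw [show b + (s - b) = s by omega] at h1
  have hmem : en H (h + (s - b)) ∈ H := en_mem (by omega)
  have hbs' : en F b ≤ en F s := en_le_iff.2 hbs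
  have h2 : en F (s + 1) ≤ en H (h + (s - b)) := by
    obtain ⟨j, -, hj⟩ := exists_en (hin _ hmem (by omega))
    rw [← hj] at h1 hmem ⊢
    have hjs : j ≠ s := by
      rintro rfl
      exact hs hmem
    rw [en_le_iff] at h1 ⊢
    omega
  have h3 := en_add_le (m := q - s) (b := s + 1) (h := h + (s - b))
    (fun y hy hle => hin y hy (by have := en_strictMono F (show s < s + 1 by omega); omega))
    h2 (by omega)
  rwa [show s + 1 + (q - s) = q + 1 by omega, show h + (s - b) + (q - s) = h + (q - b) by omega]
    at h3

/-- The maximal run of consecutive elements of `F` below and including `y`. -/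
lemma exists_block_start {y : ℕ} (hy : y ∈ F) :
    ∃ a ≤ y, (∀ z, a ≤ z → z ≤ y → z ∈ F) ∧ (0 < a → a - 1 ∉ F) := by
  have hex : ∃ a, ∀ z, a ≤ z → z ≤ y → z ∈ F := ⟨y, fun z h1 h2 => by
    rwa [show z = y by omega]⟩
  classical
  refine ⟨Nat.find hex, Nat.find_min' hex (fun z h1 h2 => by rwa [show z = y by omega]),
    Nat.find_spec hex, fun h0 hmem => ?_⟩
  refine Nat.find_min hex (show Nat.find hex - 1 < Nat.find hex by omega) (fun z h1 h2 => ?_)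
  rcases (by omega : z = Nat.find hex - 1 ∨ Nat.find hex ≤ z) with h | h
  · exact h ▸ hmem
  · exact Nat.find_spec hex z h h2

/-- Every block of `d` consecutive elements of a facet spans at most `κ`, and exactly `κ` if the
facet has more than `d` elements. -/
def IsSpread (d : ℕ) (S : Set (Finset ℕ)) (κ : ℕ) : Prop :=
  d ≤ κ ∧ ∀ F ∈ S, ∀ i j, i + d = j + 1 → j < F.card →
    en F j ≤ en F i + κ ∧ (d < F.card → en F j = en F i + κ)

namespace FacetSystem

variable (hS : FacetSystem d n S)
include hS

/-- A run of consecutive elements of a facet between two missing ones has even length. -/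
lemma sub_mod_two (hF : F ∈ S) {y y' : ℕ} (hyy : y < y') (hy : y ∉ F) (hy' : y' ∉ F)
    (hn : y' ≤ n) (hin : ∀ z, y < z → z < y' → z ∈ F) : (y' - y) % 2 = 1 := by
  obtain ⟨i, hi⟩ := exists_isGap hy
  have key : ∀ j, y + 1 + j < y' → i + j < F.card ∧ en F (i + j) = y + 1 + j := by
    intro j
    induction j with
    | zero =>
      intro hj
      obtain ⟨m, hm, hmy⟩ := exists_en (hin (y + 1) (by omega) (by omega))
      have him : i ≤ m := by
        by_contra hcon
        have := hi.2.1 m (by omega)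
        omega
      have h1 := hi.2.2 i le_rfl (by omega)
      have h2 := en_le_iff (F := F).2 him
      exact ⟨by omega, by simp only [add_zero]; omega⟩
    | succ j ih =>
      intro hj
      obtain ⟨h1, h2⟩ := ih (by omega)
      obtain ⟨m, hm, hmy⟩ := exists_en (hin (y + 1 + (j + 1)) (by omega) (by omega))
      have h3 : i + j < m := lt_of_en_lt (F := F) (by omega)
      have h4 := en_strictMono F (show i + j < i + (j + 1) by omega)
      have h5 := en_le_iff (F := F).2 (show i + (j + 1) ≤ m by omega)
      exact ⟨by omega, by omega⟩
  have hgap : IsGap F (i + (y' - y - 1)) y' := by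
    rcases Nat.eq_or_lt_of_le (show y + 1 ≤ y' by omega) with h | h
    · refine ⟨by have := hi.1; omega, fun j hj => ?_, fun j hj hjc => ?_⟩
      · have := hi.2.1 j (by omega); omega
      · have h1 := hi.2.2 j (by omega) hjc
        have h2 : en F j ≠ y' := fun h => hy' (h ▸ en_mem hjc)
        omega
    · obtain ⟨h1, h2⟩ := key (y' - y - 2) (by omega)
      rw [show i + (y' - y - 1) = i + (y' - y - 2) + 1 by omega]
      refine isGap_succ h1 (by omega) (fun hc => ?_)
      have h3 := en_strictMono F (show i + (y' - y - 2) < i + (y' - y - 2) + 1 by omega)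
      have h4 : en F (i + (y' - y - 2) + 1) ≠ y' := fun h => hy' (h ▸ en_mem hc)
      omega
  have := hS.gale F hF _ _ _ _ (by omega) hn hi hgap
  omega

/-- A facet that is a simplex contains `0` or `n`. -/
lemma en_zero_eq_zero (hF : F ∈ S) {q : ℕ} (hq : q + 1 = F.card) (hd : F.card = d)
    (hn : en F q < n) : en F 0 = 0 := by
  have h5 := hS.five_le
  have hd2 := hS.mod_two
  by_contra hne
  have g1 : IsGap F 0 0 := isGap_zero (by omega)
  have g2 : IsGap F (q + 1) (en F q + 1) := isGap_succ (by omega) (by omega) (fun _ => by omega)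
  have := hS.gale F hF _ _ _ _ (by omega) (by omega) g1 g2
  omega

/-- If the last block of a facet spans `κ` and does not end with `n`, then its first element is the
end of a run of consecutive elements. -/
lemma succ_notMem (hκ : IsSpread d S κ) (hF : F ∈ S) {i q : ℕ} (hi : i + d = F.card)
    (hq : q + 1 = F.card) (hs : en F q = en F i + κ) (hn : en F q < n) : en F i + 1 ∉ F := by
  have h5 := hS.five_le
  have l1 := en_strictMono F (show q - 1 < q by omega)
  have hprev : en F (q - 1) + 1 = en F q := by
    by_contra hne
    refine hS.not_isolated hF (y := en F q - 1) ?_ ?_ ?_ (by omega)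
    · rw [show en F q - 1 + 1 = en F q by omega]
      exact en_mem (by omega)
    · exact notMem_of_en_lt (i := q - 1) (by omega)
        (by rw [show q - 1 + 1 = q by omega]; omega)
    · intro h
      have := le_en_last hq h
      omega
  have hR : IsRidge d F.card i (d - 2) (d - 1) := by unfold IsRidge; omega
  obtain ⟨G, hG, v, w, hA⟩ := hS.exists_adjacent F hF _ _ _ hR
  have hcen := hA.center_notMem hR
  rw [show i + (d - 2) = q - 1 by omega] at hcen
  have hinq : InRidge i (d - 2) (d - 1) q := by unfold InRidge; omega
  have hini : InRidge i (d - 2) (d - 1) i := by unfold InRidge; omega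
  have hini' : InRidge i (d - 2) (d - 1) (i + 1) := by unfold InRidge; omega
  have hmem : en F q + 1 ∈ G := by
    by_contra hcon
    refine hS.not_isolated hG (y := en F (q - 1)) ?_ hcen ?_ (by omega)
    · rw [hprev]; exact hA.mem hR hinq
    · rwa [show en F (q - 1) + 2 = en F q + 1 by omega]
  obtain ⟨k, hk, hke⟩ := exists_en hmem
  obtain ⟨kq, hkq, hkq'⟩ := hA.index _ hinq
  obtain ⟨ki, hki, hki'⟩ := hA.index _ hini
  have e1 : kq < k := lt_of_en_lt (F := G) (by omega)
  have e2 : k = kq + 1 := by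
    by_contra hne
    have := en_strictMono G (show kq < kq + 1 by omega)
    have := en_strictMono G (show kq + 1 < k by omega)
    omega
  have hR' := hA.isRidge
  simp only [IsRidge] at hR'
  have hw : w = 1 := by
    by_contra hne
    have hki0 : ki = 0 := by omega
    have hkd : k + 1 = d := by omega
    have := (hκ.2 G hG ki k (by omega) hk).1
    omega
  obtain ⟨k1, hk1, hk1'⟩ := hA.index _ hini'
  have i1 := en_strictMono G (show ki < v + 1 by omega)
  have i2 := en_strictMono G (show v + 1 < k1 by omega)
  exact notMem_of_en_lt (i := i) (by omega) (by omega)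

lemma add_two_le (hκ : IsSpread d S κ) (hF : F ∈ S) {L : ℕ} (hL : L + d = F.card) (hL0 : 0 < L) :
    L + 2 ≤ d := by
  have h5 := hS.five_le
  by_contra hcon
  have h1 := hS.en_eq_add hF (i := d - 1) (by omega)
  have h2 := (hκ.2 F hF 0 (d - 1) (by omega) (by omega)).2 (by omega)
  have := hκ.1
  omega

/-- In a facet with more than `d` elements, the ridge opposite to an element of the initial run
belongs to an earlier facet. -/
lemma exists_early_of_le (hκ : IsSpread d S κ) (hF : F ∈ S) {L s : ℕ} (hL : L + d = F.card)
    (hs : 1 ≤ s) (hsL : s ≤ L) :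
    ∃ G ∈ S, (∃ y, ColexDiff G F y) ∧
      ∀ j, InRidge 0 s (s + d - 2) j → en F j ∈ G := by
  have h5 := hS.five_le
  have hLd := hS.add_two_le hκ hF hL (by omega)
  have hR : IsRidge d F.card 0 s (s + d - 2) := by unfold IsRidge; omega
  obtain ⟨G, hG, v, w, hA⟩ := hS.exists_adjacent F hF _ _ _ hR
  refine ⟨G, hG, ?_, fun j hj => hA.mem hR hj⟩
  by_contra hcon
  have hzq : en F (L + d - 1) ∉ G := hA.notMem (by omega) (by unfold InRidge; omega)
  obtain ⟨y, hyG, hyF, hy⟩ :=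
    exists_lt_of_not_colexDiff (hA.ne hR) hcon (en_mem (by omega)) hzq
  have hcen := hA.center_notMem hR
  rw [zero_add] at hcen
  obtain ⟨k, hk, rfl⟩ := exists_en hyG
  obtain ⟨kl, hkl, hkl'⟩ := hA.index (s + d - 2) (by unfold InRidge; omega)
  obtain ⟨k0, hk0, hk0'⟩ := hA.index (s - 1) (by unfold InRidge; omega)
  have i1 := en_strictMono F (show s + d - 2 < L + d - 1 by omega)
  have e1 : kl < k := lt_of_en_lt (F := G) (by omega)
  have hR' := hA.isRidge
  simp only [IsRidge] at hR'
  have hFs := hS.en_succ_of_lt hF (i := s - 1) (by omega)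
  rw [show s - 1 + 1 = s by omega] at hFs
  rcases (by omega : (w = s ∧ kl = v + s + d - 2 ∧ v + s + d ≤ G.card) ∨
      (s = 1 ∧ v = 0 ∧ w + 1 = d)) with ⟨rfl, h1, h2⟩ | ⟨rfl, rfl, h2⟩
  · have hGs := hS.en_succ_of_lt hG (i := v + w - 1) (by omega)
    rw [show v + w - 1 + 1 = v + w by omega, show v + w - 1 = k0 by omega, hk0, ← hFs] at hGs
    exact hcen (hGs ▸ en_mem (by omega))
  · obtain ⟨k2, hk2, hk2'⟩ := hA.index 2 (by unfold InRidge; omega)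
    have hk00 : k0 = 0 := by omega
    have hk21 : k2 = 1 := by omega
    rw [hk00] at hk0
    rw [hk21] at hk2
    have i2 := en_strictMono F (show 1 < 2 by omega)
    rcases (by omega : d < G.card ∨ G.card = d) with h | h
    · have := hS.en_succ_of_lt hG (i := 0) (by omega)
      rw [zero_add] at this
      simp only [Nat.sub_self] at hk0 hFs
      omega
    · have h3 := (hκ.2 G hG 0 k (by omega) hk).1
      have h4 := (hκ.2 F hF 0 (d - 1) (by omega) (by omega)).2 (by omega)
      have h6 := en_le_iff (F := F).2 (show d - 1 ≤ L + d - 1 by omega)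
      simp only [Nat.sub_self] at hk0
      omega

/-- In a facet with more than `d` elements, the ridge of the first `d - 1` elements belongs to an
earlier facet. -/
lemma exists_early_zero (hκ : IsSpread d S κ) (hF : F ∈ S) (hc : d < F.card) :
    ∃ G ∈ S, (∃ y, ColexDiff G F y) ∧
      ∀ j, InRidge 0 (d - 1) (d - 1) j → en F j ∈ G := by
  have h5 := hS.five_le
  have hR : IsRidge d F.card 0 (d - 1) (d - 1) := by unfold IsRidge; omega
  obtain ⟨G, hG, v, w, hA⟩ := hS.exists_adjacent F hF _ _ _ hR
  refine ⟨G, hG, ?_, fun j hj => hA.mem hR hj⟩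
  by_contra hcon
  have hzq : en F (F.card - 1) ∉ G := hA.notMem (by omega) (by unfold InRidge; omega)
  obtain ⟨y, hyG, hyF, hy⟩ :=
    exists_lt_of_not_colexDiff (hA.ne hR) hcon (en_mem (by omega)) hzq
  have hcen := hA.center_notMem hR
  rw [zero_add] at hcen
  obtain ⟨k, hk, rfl⟩ := exists_en hyG
  obtain ⟨kl, hkl, hkl'⟩ := hA.index (d - 2) (by unfold InRidge; omega)
  obtain ⟨k0, hk0, hk0'⟩ := hA.index 0 (by unfold InRidge; omega)
  have i1 := en_strictMono F (show d - 2 < d - 1 by omega)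
  have i2 := en_le_iff (F := F).2 (show d - 1 ≤ F.card - 1 by omega)
  have e1 : kl < k := lt_of_en_lt (F := G) (by omega)
  have hR' := hA.isRidge
  simp only [IsRidge] at hR'
  have hsF := (hκ.2 F hF 0 (d - 1) (by omega) (by omega)).2 hc
  rcases (by omega : (w = 1 ∧ kl = v + d - 1 ∧ v + d < G.card ∧ k0 = v) ∨
      (v = 0 ∧ w + 1 = d ∧ k0 = 0)) with ⟨rfl, h1, h2, h3⟩ | ⟨rfl, h2, h3⟩
  · have := (hκ.2 G hG k0 kl (by omega) (by omega)).2 (by omega)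
    omega
  · rw [h3] at hk0
    rcases (by omega : d < G.card ∨ G.card = d) with h | h
    · have h4 := (hκ.2 G hG 0 (d - 1) (by omega) (by omega)).2 h
      rw [hk0, ← hsF] at h4
      exact hcen (h4 ▸ en_mem (by omega))
    · have h4 := (hκ.2 G hG 0 k (by omega) hk).1
      omega

/-- In a facet with more than `d` elements, the ridge of the last `d - 1` elements does not belong
to an earlier facet. -/
lemma not_early_last (hκ : IsSpread d S κ) (hF : F ∈ S) (hG : G ∈ S) {L : ℕ}
    (hL : L + d = F.card) (hL0 : 0 < L) {y : ℕ} (hGF : ColexDiff G F y)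
    (hsub : ∀ j, L < j → j < F.card → en F j ∈ G) : False := by
  have h5 := hS.five_le
  have hzL : en F L ∉ G := by
    intro h
    refine hGF.ne (hS.eq_of_window_subset hF hG hL.le (fun j h1 h2 => ?_)).symm
    rcases Nat.eq_or_lt_of_le h1 with rfl | h1
    · exact h
    · exact hsub j h1 (by omega)
  obtain ⟨hyF, hyG, hab⟩ := hGF
  obtain ⟨i, hi, rfl⟩ := exists_en hyF
  have hiL : i = L := by
    rcases lt_trichotomy i L with h | h | h
    · exact absurd ((hab _ (en_lt_iff.2 h)).1 (en_mem (by omega))) hzL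
    · exact h
    · exact absurd (hsub i h hi) hyG
  subst hiL
  obtain ⟨k, hk, hke⟩ := exists_en (hsub (i + d - 1) (by omega) (by omega))
  have i1 := en_strictMono F (show i < i + d - 1 by omega)
  have hmax := eq_card_of_max hk hke (fun z hz => by
    rcases Nat.lt_or_ge (en F i) z with h | h
    · exact le_en_last (by omega) ((hab z h).2 hz)
    · omega)
  have hsF := (hκ.2 F hF i (i + d - 1) (by omega) (by omega)).2 (by omega)
  have hGc := hS.le_card G hG
  obtain ⟨h1, h2⟩ := hκ.2 G hG (k + 1 - d) k (by omega) hk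
  have hmem := en_mem (F := G) (show k + 1 - d < G.card by omega)
  rcases (by omega : d < G.card ∨ G.card = d) with h | h
  · rw [show en G (k + 1 - d) = en F i by have := h2 h; omega] at hmem
    exact hzL hmem
  · rw [show k + 1 - d = 0 by omega] at h1 hmem
    have hne : en G 0 ≠ en F i := fun h => hzL (h ▸ hmem)
    have := en_succ_le_of_notMem (F := F) (H := G) (b := i) (h := 0) (s := i) (q := i + d - 1)
      (fun z hz hle => by
        rcases Nat.eq_or_lt_of_le hle with rfl | h
        · exact absurd hz hzL
        · exact (hab z h).2 hz) (by omega) le_rfl (by omega) hzL (by omega)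
    rw [show 0 + (i + d - 1 - i) = k by omega, hke] at this
    have := en_strictMono F (show i + d - 1 < i + d - 1 + 1 by omega)
    omega

/-- If an earlier facet differs from the simplex `F` in the maximum of `F`, then the ridge of the
first `d - 1` elements belongs to an earlier facet. -/
lemma exists_early_zero_of_simplex (hκ : IsSpread d S κ) (hF : F ∈ S) (hc : F.card = d) (hH : H ∈ S)
    (hHF : ColexDiff H F (en F (d - 1))) :
    ∃ G ∈ S, (∃ y, ColexDiff G F y) ∧
      ∀ j, InRidge 0 (d - 1) (d - 1) j → en F j ∈ G := by
  have h5 := hS.five_le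
  have hR : IsRidge d F.card 0 (d - 1) (d - 1) := by unfold IsRidge; omega
  obtain ⟨G, hG, v, w, hA⟩ := hS.exists_adjacent F hF _ _ _ hR
  refine ⟨G, hG, ?_, fun j hj => hA.mem hR hj⟩
  by_contra hcon
  have hcen := hA.center_notMem hR
  rw [zero_add] at hcen
  obtain ⟨y, hyG, hyF, hy⟩ :=
    exists_lt_of_not_colexDiff (hA.ne hR) hcon (en_mem (by omega)) hcen
  have hyn := hS.le_of_mem G hG y hyG
  have h0 := hS.en_zero_eq_zero hF (q := d - 1) (by omega) hc (by omega)
  have hlast : ∀ z ∈ F, z ≤ en F (d - 1) := fun z hz => le_en_last (by omega) hz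
  obtain ⟨a, haz, hin, ha⟩ := exists_block_start (en_mem (show d - 1 < F.card by omega))
  have ha0 : 0 < a := by
    by_contra ha0
    have h1 : en F (en F (d - 1)) = en F (d - 1) :=
      en_eq_self_of_forall_mem (m := en F (d - 1) + 1) (fun z hz => hin z (by omega) (by omega))
        _ (by omega)
    have h2 : en F (d - 1) = d - 1 := en_inj.1 h1
    have hHc := hS.le_card H hH
    have h3 : d - 1 ≤ en H (d - 1) := (en_strictMono H).le_apply
    have h4 : en H (d - 1) ∈ H := en_mem (by omega)
    rcases Nat.eq_or_lt_of_le h3 with h | h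
    · exact hHF.2.1 (by rw [h2, h]; exact h4)
    · have := hlast _ ((hHF.2.2 _ (by omega)).2 h4)
      omega
  have haF := ha ha0
  have hp1 := hS.sub_mod_two hF (show a - 1 < en F (d - 1) + 1 by omega) haF
    (fun h => by have := hlast _ h; omega) (by omega) (fun z h1 h2 => hin z (by omega) (by omega))
  have hsub : ∀ z ∈ F, z < en F (d - 1) → z ∈ G := by
    intro z hz hlt
    obtain ⟨j, hj, rfl⟩ := exists_en hz
    rw [en_lt_iff] at hlt
    exact hA.mem hR (by unfold InRidge; omega)
  have haG : a - 1 ∈ G := by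
    by_contra haG
    have := hS.sub_mod_two hG (show a - 1 < en F (d - 1) by omega) haG hcen (by omega)
      (fun z h1 h2 => hsub z (hin z (by omega) (by omega)) h2)
    omega
  obtain ⟨k, hk, hke⟩ := exists_en haG
  obtain ⟨k', hk', rfl⟩ := exists_en hyG
  obtain ⟨k0, hk0, hk0'⟩ := hA.index 0 (by unfold InRidge; omega)
  obtain ⟨kl, hkl, hkl'⟩ := hA.index (d - 2) (by unfold InRidge; omega)
  have i1 := en_strictMono F (show d - 2 < d - 1 by omega)
  have e0 : k0 < k := by
    refine lt_of_en_lt (F := G) ?_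
    have : a - 1 ≠ 0 := fun h => haF (by rw [h, ← h0]; exact en_mem (by omega))
    omega
  have e1 : k < kl := by
    refine lt_of_en_lt (F := G) ?_
    obtain ⟨m, hm, hme⟩ := exists_en (hin (en F (d - 1) - 1) (by omega) (by omega))
    have hmd : m < d - 1 := lt_of_en_lt (F := F) (by omega)
    have := en_le_iff (F := F).2 (show m ≤ d - 2 by omega)
    omega
  have e2 : kl < k' := lt_of_en_lt (F := G) (by omega)
  have hcent := hA.eq_center (k := k) (by omega) (by omega) (hke ▸ haF) hR
  have hk'p : ¬ k' ≤ v + (d - 1) := by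
    intro hle
    have := hA.eq_center (k := k') (by omega) hle hyF hR
    omega
  have hR' := hA.isRidge
  simp only [IsRidge] at hR'
  have hw : w = 1 := by omega
  have h6 := (hκ.2 G hG k0 kl (by omega) (by omega)).2 (by omega)
  have h7 := (hκ.2 F hF 0 (d - 1) (by omega) (by omega)).1
  omega

end FacetSystem

end Early

/-! ### Ridges opposite to the first difference from an earlier facet -/

section FirstDifference

variable {d n κ : ℕ} {S : Set (Finset ℕ)} {F G H : Finset ℕ} {lo u p v w : ℕ}

namespace FacetSystem

variable (hS : FacetSystem d n S)
include hS

/-- If the last block of `F` spans `κ` or starts with `0`, then an earlier facet `H` with the same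
maximum as `F` cannot be contained in `F` from the beginning of that block on: by the bound on
spans, `H` has at least `d` elements there, but it lacks one of the `d` elements of the block. -/
lemma not_forall_mem (hκ : IsSpread d S κ) (hH : H ∈ S) {L q s : ℕ}
    (hL : L + d = q + 1) (hLs : L ≤ s) (hsq : s < q)
    (hHF : ColexDiff H F (en F s)) (hK : en F q = en F L + κ ∨ en F L = 0) (hq : q < F.card)
    (hlast : ∀ y ∈ F, y ≤ en F q)
    (hin : ∀ y ∈ H, en F L ≤ y → y ≤ en F s → y ∈ F) : False := by
  have h5 := hS.five_le
  have hHc := hS.le_card H hH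
  have hqH : en F q ∈ H := (hHF.2.2 _ (en_lt_iff.2 hsq)).1 (en_mem hq)
  have hmaxH : ∀ y ∈ H, y ≤ en F q := fun y hy => by
    rcases Nat.lt_or_ge (en F s) y with h | h
    · exact hlast y ((hHF.2.2 _ h).2 hy)
    · exact h.trans (en_le_iff.2 hsq.le)
  obtain ⟨k, hk, hke⟩ := exists_en hqH
  have hkc := eq_card_of_max hk hke hmaxH
  have hsp := (hκ.2 H hH (k + 1 - d) k (by omega) hk).1
  have := en_succ_le_of_notMem (F := F) (H := H) (b := L) (h := k + 1 - d) (s := s) (q := q)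
    (fun y hy hle => by
      rcases Nat.lt_or_ge (en F s) y with h | h
      · exact (hHF.2.2 _ h).2 hy
      · exact hin y hy hle h) (by omega) hLs hsq.le hHF.2.1 (by omega)
  rw [show k + 1 - d + (q - L) = k by omega, hke] at this
  have := en_strictMono F (show q < q + 1 by omega)
  omega

set_option maxHeartbeats 2000000 in
/-- If an earlier facet differs from `F` first, from above, in the element at position `s`, and `s`
is neither among the first `#F - d + 1` positions nor the last one, then the ridge of `F` opposite
to position `s` belongs to an earlier facet. -/
theorem exists_early_of_colexDiff (hκ : IsSpread d S κ) (hF : F ∈ S) (hH : H ∈ S) {L q s : ℕ}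
    (hL : L + d = F.card) (hq : q + 1 = F.card) (hLs : L < s) (hsq : s < q)
    (hHF : ColexDiff H F (en F s)) :
    ∃ G ∈ S, (∃ y, ColexDiff G F y) ∧
      ∀ j, InRidge (s + 2 - d) (s - (s + 2 - d)) (q - (s + 2 - d)) j → en F j ∈ G := by
  have h5 := hS.five_le
  obtain ⟨lo, hlo⟩ : ∃ lo, lo = s + 2 - d := ⟨_, rfl⟩
  obtain ⟨u, hu⟩ : ∃ u, u = s - lo := ⟨_, rfl⟩
  obtain ⟨p, hp⟩ : ∃ p, p = q - lo := ⟨_, rfl⟩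
  rw [← hlo, ← hu, ← hp]
  have hR : IsRidge d F.card lo u p := by unfold IsRidge; omega
  obtain ⟨G, hG, v, w, hA⟩ := hS.exists_adjacent F hF _ _ _ hR
  refine ⟨G, hG, ?_, fun j hj => hA.mem hR hj⟩
  by_contra hcon
  have hcen := hA.center_notMem hR
  rw [show lo + u = s by omega] at hcen
  have hzs : en F s ∈ F := en_mem (by omega)
  obtain ⟨w0, hw0G, hw0F, hw0⟩ := exists_lt_of_not_colexDiff (hA.ne hR) hcon hzs hcen
  have hw0n := hS.le_of_mem G hG w0 hw0G
  have hHc := hS.le_card H hH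
  have hlast : ∀ y ∈ F, y ≤ en F q := fun y hy => le_en_last hq hy
  have hinR : ∀ j, lo ≤ j → j ≤ q → j ≠ s → InRidge lo u p j := by
    intro j h1 h2 h3
    unfold InRidge; omega
  have hR' := hA.isRidge
  simp only [IsRidge] at hR'
  obtain ⟨a, haz, hin, ha⟩ := exists_block_start hzs
  -- the element below the run of `F` that ends in `en F s` belongs to `G`, by parity
  have haG : 0 < a → en F lo ≤ a → a - 1 ∈ G := by
    intro ha0 hloa
    by_contra haG
    have hex : ∃ e, en F s < e ∧ e ∉ F := ⟨w0, hw0, hw0F⟩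
    classical
    obtain ⟨e, ⟨he1, he2⟩, hemin⟩ : ∃ e, (en F s < e ∧ e ∉ F) ∧
        ∀ z, en F s < z → z < e → z ∈ F :=
      ⟨Nat.find hex, Nat.find_spec hex, fun z h1 h2 => by
        by_contra h3
        exact Nat.find_min hex h2 ⟨h1, h3⟩⟩
    have hew : e ≤ w0 := by
      by_contra hlt
      exact hw0F (hemin w0 hw0 (by omega))
    have p1 := hS.sub_mod_two hF (show a - 1 < e by omega) (ha ha0) he2 (by omega)
      (fun z h1 h2 => by
        rcases Nat.lt_or_ge (en F s) z with h | h
        · exact hemin z h h2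
        · exact hin z (by omega) h)
    have p2 := hS.sub_mod_two hH he1 hHF.2.1 (fun h => he2 ((hHF.2.2 _ he1).2 h)) (by omega)
      (fun z h1 h2 => (hHF.2.2 _ h1).1 (hemin z h1 h2))
    have p3 := hS.sub_mod_two hG (show a - 1 < en F s by omega) haG hcen (by omega)
      (fun z h1 h2 => by
        obtain ⟨j, hj, rfl⟩ := exists_en (hin z (by omega) h2.le)
        have h3 := lt_of_en_lt h2
        have h4 : lo ≤ j := en_le_iff (F := F).1 (by omega)
        exact hA.mem hR (hinR j h4 (by omega) (by omega)))
    omega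
  obtain ⟨kL, hkL, hkL'⟩ := hA.index L (hinR L (by omega) (by omega) (by omega))
  obtain ⟨kq, hkq, hkq'⟩ := hA.index q (hinR q (by omega) (by omega) (by omega))
  have iLs := en_strictMono F hLs
  have isq := en_strictMono F hsq
  obtain ⟨k', hk', hke'⟩ := exists_en hw0G
  by_cases hK : en F q = en F L + κ ∨ (F.card = d ∧ en F 0 = 0)
  · have hK' : en F q = en F L + κ ∨ en F L = 0 := by
      rcases hK with hK | hK
      · exact Or.inl hK
      · exact Or.inr (by rw [show L = 0 by omega]; exact hK.2)
    have haL : en F L + 1 < a := by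
      by_contra hle
      refine hS.not_forall_mem hκ hH (by omega) hLs.le hsq hHF hK' (by omega) hlast ?_
      intro y _ h1 h2
      rcases (by omega : y = en F L ∨ a ≤ y) with rfl | h
      · exact en_mem (by omega)
      · exact hin y h h2
    have hloL := en_le_iff (F := F).2 (show lo ≤ L by omega)
    have haF := ha (by omega)
    obtain ⟨k, hk, hke⟩ := exists_en (haG (by omega) (by omega))
    have e1 : kL < k := lt_of_en_lt (F := G) (by omega)
    have e2 : k < kq := lt_of_en_lt (F := G) (by omega)
    have e3 : k < k' := lt_of_en_lt (F := G) (by omega)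
    have hc := hA.eq_center (k := k) (by omega) (by omega) (hke ▸ haF) hR
    have hk'p : ¬ k' ≤ v + p := by
      intro hle
      have := hA.eq_center (k := k') (by omega) hle (hke' ▸ hw0F) hR
      omega
    have hpw : p + 2 = w + d := by omega
    have e4 : kL + 1 = k := by omega
    have e5 := hS.en_succ_of_lt hG (i := kL) (by omega)
    rw [e4] at e5
    have e6 := (hκ.2 G hG kL kq (by omega) (by omega)).2 (by omega)
    have hw0q : en F q < w0 := by
      rw [← hkq, ← hke', en_lt_iff]
      omega
    have hmemH : en F L + 1 ∈ H := by
      by_contra hnot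
      refine hS.not_forall_mem hκ hH (by omega) hLs.le hsq hHF hK' (by omega) hlast ?_
      intro y hy h1 h2
      rcases (by omega : y = en F L ∨ y = en F L + 1 ∨ a ≤ y) with rfl | rfl | h
      · exact en_mem (by omega)
      · exact absurd hy hnot
      · exact hin y h h2
    have hqH : en F q ∈ H := (hHF.2.2 _ (en_lt_iff.2 hsq)).1 (en_mem (by omega))
    have hmaxH : ∀ y ∈ H, y ≤ en F q := fun y hy => by
      rcases Nat.lt_or_ge (en F s) y with h | h
      · exact hlast y ((hHF.2.2 _ h).2 hy)
      · exact h.trans (en_le_iff.2 hsq.le)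
    obtain ⟨m, hm, hme⟩ := exists_en hqH
    have hmc := eq_card_of_max hm hme hmaxH
    have hsp := (hκ.2 H hH (m + 1 - d) m (by omega) hm).1
    have hHL : en H (m + 1 - d) = en F L := by
      by_contra hne
      have i1 := en_strictMono H (show m + 1 - d < m + 1 - d + 1 by omega)
      have i2 := en_strictMono F (show L < L + 1 by omega)
      have i3 : en F (L + 1) ≠ en F L + 1 := by
        intro h
        refine haF ?_
        rw [show a - 1 = en F (L + 1) by omega]
        exact en_mem (by omega)
      obtain ⟨j, hj, hja⟩ := exists_en (hin a le_rfl haz)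
      have hLj : L < j := lt_of_en_lt (F := F) (by omega)
      have i4 := en_le_iff (F := F).2 (show L + 1 ≤ j by omega)
      have := en_succ_le_of_notMem (F := F) (H := H) (b := L + 1) (h := m + 1 - d + 1) (s := s)
        (q := q)
        (fun y hy hle => by
          rcases Nat.lt_or_ge (en F s) y with h | h
          · exact (hHF.2.2 _ h).2 hy
          · exact hin y (by omega) h) (by omega) (by omega) hsq.le hHF.2.1 (by omega)
      rw [show m + 1 - d + 1 + (q - (L + 1)) = m by omega, hme] at this
      have := en_strictMono F (show q < q + 1 by omega)
      omega
    have := hS.succ_notMem hκ hH (i := m + 1 - d) (q := m) (by omega) hmc (by omega) (by omega)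
    rw [hHL] at this
    exact this hmemH
  · push Not at hK
    have hcd : F.card = d := by
      by_contra hne
      exact hK.1 ((hκ.2 F hF L q (by omega) (by omega)).2 (by omega))
    have hL0 : L = 0 := by omega
    subst hL0
    have hz0 := hK.2 hcd
    have hqn : ¬ en F q < n := fun h => hz0 (hS.en_zero_eq_zero hF hq hcd h)
    have hqn' := hS.en_le hF (show q < F.card by omega)
    have hw0q : w0 ≠ en F q := fun h => hw0F (h ▸ en_mem (by omega))
    have e1 : kL < k' := lt_of_en_lt (F := G) (by omega)
    have e2 : k' < kq := lt_of_en_lt (F := G) (by omega)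
    have hc' := hA.eq_center (k := k') (by omega) (by omega) (hke' ▸ hw0F) hR
    have hlo0 : lo = 0 := by omega
    subst hlo0
    have haF : a ∈ F := hin a le_rfl haz
    obtain ⟨ja, hja, hja'⟩ := exists_en haF
    have h0a := en_le_iff (F := F).2 (Nat.zero_le ja)
    have haG' := haG (by omega) (by omega)
    have haF' := ha (by omega)
    obtain ⟨k, hk, hke⟩ := exists_en haG'
    have e3 : k < k' := lt_of_en_lt (F := G) (by omega)
    have e4 : k < kL := by
      by_contra hge
      have := hA.eq_center (k := k) (by omega) (by omega) (hke ▸ haF') hR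
      omega
    exact hK.1 (by rw [← hkq, ← hkL]; exact (hκ.2 G hG kL kq (by omega) (by omega)).2 (by omega))

/-- If the largest difference of `F` and an earlier facet `H` is above the block of `F` at position
`l`, then `H` does not contain the last element of this block together with the first elements of
all later blocks. -/
theorem not_mem_of_colexDiff (hκ : IsSpread d S κ) (hF : F ∈ S) (hH : H ∈ S) {L l p : ℕ}
    (hL : L + d = F.card) (hl : l < L) (hp : l + d ≤ p) (hpF : p < F.card)
    (hHF : ColexDiff H F (en F p)) (hmem : ∀ i, l < i → i ≤ L → en F i ∈ H)
    (hmem' : en F (l + d - 1) ∈ H) : False := by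
  have h5 := hS.five_le
  have hHc := hS.le_card H hH
  obtain ⟨q, hq⟩ : ∃ q, q + 1 = F.card := ⟨F.card - 1, by omega⟩
  have hlast : ∀ y ∈ F, y ≤ en F q := fun y hy => le_en_last hq hy
  have hsF : ∀ i, i ≤ L → en F (i + d - 1) = en F i + κ := fun i hi =>
    (hκ.2 F hF i (i + d - 1) (by omega) (by omega)).2 (by omega)
  have hsL := hsF L le_rfl
  rw [show L + d - 1 = q by omega] at hsL
  have hadd : ∀ i, i ≤ L → en F i = en F 0 + i := fun i hi => hS.en_eq_add hF (by omega)
  rcases (by omega : p < q ∨ p = q) with hpq | rfl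
  · have hqH : en F q ∈ H := (hHF.2.2 _ (en_lt_iff.2 hpq)).1 (en_mem (by omega))
    have hmaxH : ∀ y ∈ H, y ≤ en F q := fun y hy => by
      rcases Nat.lt_or_ge (en F p) y with h | h
      · exact hlast y ((hHF.2.2 _ h).2 hy)
      · exact h.trans (en_le_iff.2 hpq.le)
    obtain ⟨k, hk, hke⟩ := exists_en hqH
    have hkc := eq_card_of_max hk hke hmaxH
    have hsp := hκ.2 H hH (k + 1 - d) k (by omega) hk
    obtain ⟨mL, hmL, hmLe⟩ := exists_en (hmem L hl le_rfl)
    have hHL : en H (k + 1 - d) = en F L := by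
      rcases (by omega : d < H.card ∨ H.card = d) with h | h
      · have := hsp.2 h
        omega
      · have h1 := en_le_iff (F := H).2 (Nat.zero_le mL)
        have h2 := hsp.1
        rw [show k + 1 - d = 0 by omega] at h2 ⊢
        omega
    obtain ⟨m, hm, hme⟩ := exists_en (hmem (l + 1) (by omega) (by omega))
    have hmk : m ≤ k + 1 - d := by
      rw [← en_le_iff (F := H), hme, hHL, en_le_iff]
      omega
    have hmk' : m ≠ k + 1 - d := by
      rintro rfl
      rw [hHL, en_inj] at hme
      omega
    have h1 := (hκ.2 H hH m (m + d - 1) (by omega) (by omega)).2 (by omega)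
    have h2 := hsF (l + 1) (by omega)
    have h3 := hS.en_eq_add' hH (i := m) (by omega)
    have h4 := hS.en_eq_add' hH (i := k + 1 - d) (by omega)
    rw [show k + 1 - d + d - 1 = k by omega] at h4
    have h6 := en_le_iff (F := F).2 (show l + 1 + d - 1 ≤ p by omega)
    have h7 := en_strictMono F hpq
    have h8 := hS.en_eq_add' hH (i := en F p - en H (d - 1)) (by omega)
    refine hHF.2.1 ?_
    rw [show en F p = en H (en F p - en H (d - 1) + d - 1) by omega]
    exact en_mem (by omega)
  · obtain ⟨k, hk⟩ : ∃ k, k + 1 = H.card := ⟨H.card - 1, by omega⟩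
    have hkH : en H k ∈ H := en_mem (by omega)
    have hkq : en H k < en F p := by
      rcases lt_trichotomy (en F p) (en H k) with h | h | h
      · have := hlast _ ((hHF.2.2 _ h).2 hkH)
        omega
      · exact absurd (h ▸ hkH) hHF.2.1
      · exact h
    have hpn := hS.en_le hF hpF
    have hlk := le_en_last hk hmem'
    have hsl := hsF l hl.le
    have hsp := hκ.2 H hH (k + 1 - d) k (by omega) (by omega)
    have hsk : en H k = en H (k + 1 - d) + κ := by
      rcases (by omega : d < H.card ∨ H.card = d) with h | h
      · exact hsp.2 h
      · have h0 := hS.en_zero_eq_zero hH hk h (by omega)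
        have h1 := hsp.1
        rw [show k + 1 - d = 0 by omega] at h1 ⊢
        omega
    refine hS.succ_notMem hκ hH (i := k + 1 - d) (q := k) (by omega) hk hsk (by omega) ?_
    have h1 := hadd l hl.le
    have h2 := hadd L le_rfl
    have h3 := hadd (en H (k + 1 - d) + 1 - en F 0) (by omega)
    rw [show en H (k + 1 - d) + 1 = en F (en H (k + 1 - d) + 1 - en F 0) by omega]
    exact hmem _ (by omega) (by omega)

end FacetSystem

end FirstDifference

/-! ### The new vertices of a block -/

section NewVertices

variable {d n κ : ℕ} {S : Set (Finset ℕ)} {F G H : Finset ℕ}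

/-- In a `(d-1)`-dimensional multiplex with `c` vertices, position `j` belongs to the facet
opposite to position `s`. -/
def OnRidge (d c s j : ℕ) : Prop :=
  j < c ∧ ((s = 0 ∧ j + 1 < d) ∨ (0 < s ∧ s + 1 < c ∧ j ≠ s ∧ j + 2 ≤ s + d ∧ s + 2 ≤ j + d) ∨
    (s + 1 = c ∧ c < j + d))

/-- The ridge of `F` opposite to position `s` is contained in a facet that precedes `F`. -/
def Early (d : ℕ) (S : Set (Finset ℕ)) (F : Finset ℕ) (s : ℕ) : Prop :=
  ∃ G ∈ S, (∃ y, ColexDiff G F y) ∧ ∀ j, OnRidge d F.card s j → en F j ∈ G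

/-- Position `i` of `F` belongs to the minimal new face of the block of `F` that starts at position
`l`. -/
def IsNew (d : ℕ) (S : Set (Finset ℕ)) (F : Finset ℕ) (l i : ℕ) : Prop :=
  (i + 1 = l + d ∧ (0 < l ∨ Early d S F 0)) ∨ (l < i ∧ i + 1 < l + d ∧ Early d S F i) ∨
    (i = l ∧ l + d = F.card ∧ Early d S F (F.card - 1))

lemma IsNew.le {l i : ℕ} (h5 : 5 ≤ d) (h : IsNew d S F l i) : l ≤ i ∧ i < l + d := by
  rcases h with h | h | h <;> omega

/-- Positions of ridges in terms of the opposite position. -/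
lemma exists_isRidge {c s : ℕ} (h5 : 5 ≤ d) (hc : d ≤ c) (hs : s < c) :
    ∃ lo u p, IsRidge d c lo u p ∧ (∀ j, OnRidge d c s j ↔ InRidge lo u p j) ∧
      ((s = 0 ∧ lo = 0 ∧ u + 1 = d ∧ p = u) ∨
        (0 < s ∧ s + 1 < c ∧ lo = s + 2 - d ∧ lo + u = s ∧ lo + p = min (c - 1) (s + d - 2)) ∨
        (s + 1 = c ∧ lo + d = c ∧ u = 0 ∧ p + 1 = d)) := by
  rcases (by omega : s = 0 ∨ (0 < s ∧ s + 1 < c) ∨ s + 1 = c) with h | h | h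
  · exact ⟨0, d - 1, d - 1, by unfold IsRidge; omega,
      fun j => by unfold OnRidge InRidge; omega, by omega⟩
  · refine ⟨s + 2 - d, s - (s + 2 - d), min (c - 1) (s + d - 2) - (s + 2 - d), ?_, fun j => ?_, ?_⟩
    · unfold IsRidge; omega
    · unfold OnRidge InRidge; omega
    · omega
  · exact ⟨c - d, 0, d - 1, by unfold IsRidge; omega,
      fun j => by unfold OnRidge InRidge; omega, by omega⟩

lemma exists_of_isRidge {c lo u p : ℕ} (h5 : 5 ≤ d) (hR : IsRidge d c lo u p) :
    ∃ s < c, ∀ j, OnRidge d c s j ↔ InRidge lo u p j := by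
  unfold IsRidge at hR
  rcases hR with ⟨h1, h2, h | h | h⟩
  · exact ⟨lo + u, by omega, fun j => by unfold OnRidge InRidge; omega⟩
  · exact ⟨0, by omega, fun j => by unfold OnRidge InRidge; omega⟩
  · exact ⟨c - 1, by omega, fun j => by unfold OnRidge InRidge; omega⟩

namespace FacetSystem

variable (hS : FacetSystem d n S)
include hS

lemma early_of_le (hκ : IsSpread d S κ) (hF : F ∈ S) {s : ℕ} (hs : 1 ≤ s) (hsL : s + d ≤ F.card) :
    Early d S F s := by
  have h5 := hS.five_le
  have hLd := hS.add_two_le hκ hF (L := F.card - d) (by omega) (by omega)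
  obtain ⟨G, hG, hGF, h⟩ :=
    hS.exists_early_of_le hκ hF (L := F.card - d) (s := s) (by omega) hs (by omega)
  refine ⟨G, hG, hGF, fun j hj => h j ?_⟩
  unfold OnRidge at hj
  unfold InRidge
  omega

lemma early_zero (hκ : IsSpread d S κ) (hF : F ∈ S) (hc : d < F.card) : Early d S F 0 := by
  have h5 := hS.five_le
  obtain ⟨G, hG, hGF, h⟩ := hS.exists_early_zero hκ hF hc
  refine ⟨G, hG, hGF, fun j hj => h j ?_⟩
  unfold OnRidge at hj
  unfold InRidge
  omega

lemma card_eq_of_early_last (hκ : IsSpread d S κ) (hF : F ∈ S) (h : Early d S F (F.card - 1)) :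
    F.card = d := by
  have h5 := hS.five_le
  have hc := hS.le_card F hF
  obtain ⟨G, hG, ⟨y, hGF⟩, h⟩ := h
  by_contra hne
  exact hS.not_early_last hκ hF hG (L := F.card - d) (by omega) (by omega) hGF
    (fun j h1 h2 => h j (by unfold OnRidge; omega))

/-- If a new vertex is removed from a block of `F`, what remains is contained in an earlier block,
which is either the preceding one of `F` or a block of an earlier facet. -/
theorem exists_window_of_isNew (hF : F ∈ S) {l i : ℕ} (hl : l + d ≤ F.card)
    (hi : IsNew d S F l i) : (0 < l ∧ i + 1 = l + d) ∨
      ∃ G ∈ S, (∃ y, ColexDiff G F y) ∧ ∃ r, r + d ≤ G.card ∧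
        ∀ j, l ≤ j → j < l + d → j ≠ i → ∃ k, r ≤ k ∧ k < r + d ∧ en G k = en F j := by
  have h5 := hS.five_le
  by_cases hl0 : 0 < l ∧ i + 1 = l + d
  · exact Or.inl hl0
  obtain ⟨s, hs, hcase, hE⟩ : ∃ s < F.card, ((s = 0 ∧ l = 0 ∧ i + 1 = d) ∨
      (s = i ∧ l < i ∧ i + 1 < l + d) ∨ (s + 1 = F.card ∧ i = l ∧ l + d = F.card)) ∧
      Early d S F s := by
    rcases hi with ⟨h1, h2⟩ | ⟨h1, h2, h3⟩ | ⟨h1, h2, h3⟩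
    · exact ⟨0, by omega, by omega, h2.resolve_left (fun h => hl0 ⟨h, h1⟩)⟩
    · exact ⟨i, by omega, by omega, h3⟩
    · exact ⟨_, by omega, by omega, h3⟩
  obtain ⟨lo, u, p, hR, hiff, hform⟩ := exists_isRidge h5 (hS.le_card F hF) hs
  obtain ⟨G, hG, ⟨y, hGF⟩, hE⟩ := hE
  obtain ⟨G', hG', v, w, hA⟩ := hS.exists_adjacent F hF _ _ _ hR
  have hGG : G = G' := hS.unique F hF G hG G' hG' _ _ _ hR hGF.ne (hA.ne hR)
    (fun j hj => hE j ((hiff j).2 hj)) (fun j hj => hA.mem hR hj)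
  subst hGG
  have hR' := hA.isRidge
  have hil := hi.le h5
  have h1 : lo ≤ l ∧ l + d ≤ lo + p + 1 ∧ lo + u = i := by
    clear hR hR' hl0 hiff
    omega
  have h2 : v + p + 1 ≤ G.card := hR'.1
  clear hform hcase hR hR' hl0
  refine Or.inr ⟨G, hG, ⟨y, hGF⟩, v + l - lo, by omega, fun j hj1 hj2 hj3 => ?_⟩
  obtain ⟨k, hk, hk'⟩ := hA.index j (by unfold InRidge; omega)
  exact ⟨k, by omega, by omega, hk⟩

/-- No earlier facet contains all new vertices of a block. -/
theorem exists_isNew_notMem (hκ : IsSpread d S κ) (hF : F ∈ S) {l : ℕ} (hl : l + d ≤ F.card)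
    (hH : H ∈ S) {y : ℕ} (hHF : ColexDiff H F y) : ∃ i, IsNew d S F l i ∧ en F i ∉ H := by
  have h5 := hS.five_le
  by_contra hcon
  push Not at hcon
  obtain ⟨p, hp, rfl⟩ := exists_en hHF.1
  have habove : ∀ j, p < j → j < F.card → en F j ∈ H := fun j hj hjc =>
    (hHF.2.2 _ (en_lt_iff.2 hj)).1 (en_mem hjc)
  have hnot : ∀ r, r + d ≤ F.card → p < r → False := fun r hr hpr =>
    hHF.ne (hS.eq_of_window_subset hF hH hr (fun j h1 h2 => habove j (by omega) (by omega))).symm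
  rcases (by omega : p < l ∨ (p = l ∧ l + d < F.card) ∨ (p = l ∧ l + d = F.card) ∨
      (l < p ∧ p + 1 < l + d) ∨ p + 1 = l + d ∨ l + d ≤ p) with h | ⟨rfl, h⟩ | ⟨rfl, h⟩ | h | h | h
  · exact hnot l hl h
  · exact hnot (p + 1) (by omega) (by omega)
  · refine hHF.2.1 (hcon p (Or.inr (Or.inr ⟨rfl, h, H, hH, ⟨_, hHF⟩, fun j hj => ?_⟩)))
    unfold OnRidge at hj
    exact habove j (by omega) hj.1
  · refine hHF.2.1 (hcon p (Or.inr (Or.inl ⟨h.1, h.2, ?_⟩)))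
    rcases Nat.lt_or_ge F.card (p + d) with hpL | hpL
    · obtain ⟨G, hG, hGF, hsub⟩ := hS.exists_early_of_colexDiff hκ hF hH (L := F.card - d)
        (q := F.card - 1) (s := p) (by omega) (by omega) (by omega) (by omega) hHF
      refine ⟨G, hG, hGF, fun j hj => hsub j ?_⟩
      unfold OnRidge at hj
      unfold InRidge
      omega
    · exact hS.early_of_le hκ hF (by omega) hpL
  · refine hHF.2.1 (hcon p (Or.inl ⟨h, ?_⟩))
    rcases Nat.eq_zero_or_pos l with rfl | hl0
    · refine Or.inr ?_
      rcases (by omega : d < F.card ∨ F.card = d) with hc | hc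
      · exact hS.early_zero hκ hF hc
      · rw [show p = d - 1 by omega] at hHF
        obtain ⟨G, hG, hGF, hsub⟩ := hS.exists_early_zero_of_simplex hκ hF hc hH hHF
        refine ⟨G, hG, hGF, fun j hj => hsub j ?_⟩
        unfold OnRidge at hj
        unfold InRidge
        omega
    · exact Or.inl hl0
  · have hLd := hS.add_two_le hκ hF (L := F.card - d) (by omega) (by omega)
    refine hS.not_mem_of_colexDiff hκ hF hH (L := F.card - d) (l := l) (by omega) (by omega) h hp
      hHF (fun i h1 h2 => hcon i (Or.inr (Or.inl ⟨h1, by omega, ?_⟩)))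
      (hcon _ (Or.inl ⟨by omega, Or.inr (hS.early_zero hκ hF (by omega))⟩))
    exact hS.early_of_le hκ hF (by omega) (by omega)

/-- The new vertices of the last block of `F` are those common to all ridges of `F` that are not
contained in an earlier facet. -/
theorem isNew_last_iff (hκ : IsSpread d S κ) (hF : F ∈ S) {L i : ℕ} (hL : L + d = F.card) :
    IsNew d S F L i ↔ i < F.card ∧ ∀ s < F.card, ¬ OnRidge d F.card s i → Early d S F s := by
  have h5 := hS.five_le
  constructor
  · intro hi
    have hiL := hi.le h5
    refine ⟨by omega, fun s hs hns => ?_⟩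
    by_cases h1 : 1 ≤ s ∧ s + d ≤ F.card
    · exact hS.early_of_le hκ hF h1.1 h1.2
    by_cases h2 : s = 0 ∧ d < F.card
    · exact h2.1 ▸ hS.early_zero hκ hF h2.2
    unfold OnRidge at hns
    rcases hi with ⟨h3, h4⟩ | ⟨h3, h4, h6⟩ | ⟨h3, h4, h6⟩
    · rw [show s = 0 by omega]
      exact h4.resolve_left (by omega)
    · rwa [show s = i by omega]
    · have := hS.card_eq_of_early_last hκ hF h6
      rwa [show s = F.card - 1 by omega]
  · rintro ⟨hi, h⟩
    have h1 : i ≤ L → Early d S F (F.card - 1) := fun hiL =>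
      h _ (by omega) (by unfold OnRidge; omega)
    rcases (by omega : i < L ∨ i = L ∨ (L < i ∧ i + 1 < L + d) ∨ i + 1 = L + d) with
      h2 | h2 | h2 | h2
    · have := hS.card_eq_of_early_last hκ hF (h1 h2.le)
      omega
    · exact Or.inr (Or.inr ⟨h2, hL, h1 h2.le⟩)
    · exact Or.inr (Or.inl ⟨h2.1, h2.2, h i hi (by unfold OnRidge; omega)⟩)
    · exact Or.inl ⟨h2, Or.inr (h 0 (by omega) (by unfold OnRidge; omega))⟩

end FacetSystem

end NewVertices

/-! ### The facets of an ordinary polytope as sets of numbers -/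

section Translation

variable {n d : ℕ} {x : Fin (n + 1) → EuclideanSpace ℝ (Fin d)} {A B F G : Finset (Fin (n + 1))}

/-- A set of vertex indices as a set of natural numbers. -/
def nums (A : Finset (Fin (n + 1))) : Finset ℕ := A.map Fin.valEmbedding

@[simp] lemma card_nums (A : Finset (Fin (n + 1))) : (nums A).card = A.card := Finset.card_map _

@[simp] lemma val_mem_nums {a : Fin (n + 1)} : (a : ℕ) ∈ nums A ↔ a ∈ A := by
  simp [nums, Fin.val_inj]

lemma exists_val_of_mem_nums {y : ℕ} (h : y ∈ nums A) : ∃ a ∈ A, (a : ℕ) = y := by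
  simpa [nums] using h

lemma exists_val_eq_en {j : ℕ} (hj : j < A.card) : ∃ a ∈ A, (a : ℕ) = en (nums A) j :=
  exists_val_of_mem_nums (en_mem (by simpa using hj))

lemma rank_eq {a : Fin (n + 1)} {j : ℕ} (hj : j < A.card) (h : en (nums A) j = a) :
    rank A a = j := by
  have : (A.filter (fun b => b < a)).map Fin.valEmbedding =
      (Finset.range j).image (en (nums A)) := by
    ext y
    simp only [Finset.mem_map, Finset.mem_filter, Fin.valEmbedding_apply, Finset.mem_image,
      Finset.mem_range]
    constructor
    · rintro ⟨b, ⟨hb, hba⟩, rfl⟩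
      obtain ⟨i, -, hi⟩ := exists_en (val_mem_nums.2 hb)
      refine ⟨i, ?_, hi⟩
      rw [← en_lt_iff (F := nums A), hi, h]
      exact hba
    · rintro ⟨i, hi, rfl⟩
      obtain ⟨b, hb, hbi⟩ := exists_val_eq_en (hi.trans hj)
      refine ⟨b, ⟨hb, ?_⟩, hbi⟩
      rw [Fin.lt_def, hbi, ← h, en_lt_iff]
      exact hi
  rw [rank, ← Finset.card_map Fin.valEmbedding, this,
    Finset.card_image_of_injective _ (en_strictMono _).injective, Finset.card_range]

lemma rank_lt_card {a : Fin (n + 1)} (ha : a ∈ A) : rank A a < A.card := by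
  obtain ⟨j, hj, h⟩ := exists_en (val_mem_nums.2 ha)
  rw [card_nums] at hj
  rwa [rank_eq hj h]

lemma en_rank {a : Fin (n + 1)} (ha : a ∈ A) : en (nums A) (rank A a) = a := by
  obtain ⟨j, hj, h⟩ := exists_en (val_mem_nums.2 ha)
  rw [card_nums] at hj
  rw [rank_eq hj h, h]

lemma mem_multiplexFacet (h5 : 5 ≤ d) (hc : d ≤ A.card) {s : ℕ} (hs : s < A.card)
    {a : Fin (n + 1)} :
    a ∈ multiplexFacet A (d - 1) s ↔ a ∈ A ∧ OnRidge d A.card s (rank A a) := by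
  rw [multiplexFacet, Finset.mem_filter]
  refine and_congr_right (fun ha => ?_)
  have hr := rank_lt_card ha
  simp only [Finset.mem_erase, Finset.mem_Ioo]
  unfold OnRidge
  constructor
  · rintro ⟨t, ⟨h0, h1, h2⟩, h⟩
    omega
  · rintro ⟨-, h | h | h⟩
    · rcases Nat.eq_zero_or_pos (rank A a) with h0 | h0
      · exact ⟨-1, by omega, by omega⟩
      · exact ⟨rank A a, by omega, by omega⟩
    · exact ⟨(rank A a : ℤ) - s, by omega, by omega⟩
    · rcases (by omega : rank A a + 1 = A.card ∨ rank A a + 1 < A.card) with h0 | h0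
      · exact ⟨1, by omega, by omega⟩
      · exact ⟨(rank A a : ℤ) - s, by omega, by omega⟩

lemma en_mem_multiplexFacet (h5 : 5 ≤ d) (hc : d ≤ A.card) {s j : ℕ} (hs : s < A.card)
    (hj : j < A.card) :
    en (nums A) j ∈ nums (multiplexFacet A (d - 1) s) ↔ OnRidge d A.card s j := by
  obtain ⟨a, ha, haj⟩ := exists_val_eq_en hj
  rw [← haj, val_mem_nums, mem_multiplexFacet h5 hc hs, rank_eq hj haj.symm]
  simp [ha]

lemma toColex_lt_iff : toColex G < toColex F ↔ ∃ y, ColexDiff (nums G) (nums F) y := by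
  rw [Finset.Colex.lt_iff_exists_filter_lt]
  constructor
  · rintro ⟨a, ha, h⟩
    rw [Finset.mem_sdiff] at ha
    refine ⟨a, val_mem_nums.2 ha.1, fun h => ha.2 (val_mem_nums.1 h), fun z hz => ?_⟩
    constructor
    · intro hzF
      obtain ⟨b, hb, rfl⟩ := exists_val_of_mem_nums hzF
      have : b ∈ F.filter (fun c => a < c) := Finset.mem_filter.2 ⟨hb, hz⟩
      rw [← h] at this
      exact val_mem_nums.2 (Finset.mem_filter.1 this).1
    · intro hzG
      obtain ⟨b, hb, rfl⟩ := exists_val_of_mem_nums hzG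
      have : b ∈ G.filter (fun c => a < c) := Finset.mem_filter.2 ⟨hb, hz⟩
      rw [h] at this
      exact val_mem_nums.2 (Finset.mem_filter.1 this).1
  · rintro ⟨y, h1, h2, h3⟩
    obtain ⟨a, ha, rfl⟩ := exists_val_of_mem_nums h1
    refine ⟨a, Finset.mem_sdiff.2 ⟨ha, fun h => h2 (val_mem_nums.2 h)⟩, ?_⟩
    ext b
    simp only [Finset.mem_filter]
    refine and_congr_left (fun hab => ?_)
    rw [← val_mem_nums, ← val_mem_nums (A := F)]
    exact (h3 b hab).symm

/-- A strictly increasing enumeration of a finite set is the standard one. -/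
lemma eq_en_of_strictMono {B : Finset ℕ} {f : ℕ → ℕ} (hf : StrictMono f) {p : ℕ}
    (hB : ∀ y, y ∈ B ↔ ∃ i < p, f i = y) : B.card = p ∧ ∀ i < p, f i = en B i := by
  have hBi : B = (Finset.range p).image f := by
    ext y
    simp [hB]
  have hc : B.card = p := by
    rw [hBi, Finset.card_image_of_injective _ hf.injective, Finset.card_range]
  subst hc
  refine ⟨rfl, fun i hi => ?_⟩
  have := Finset.orderEmbOfFin_unique (s := B) rfl (f := fun i : Fin B.card => f i)
    (fun i => (hB _).2 ⟨i, i.2, rfl⟩) (fun i j hij => hf hij)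
  rw [en, dif_pos hi, ← this]

/-- The set of all vertex sets of facets, in terms of natural numbers. -/
def facetNums (x : Fin (n + 1) → EuclideanSpace ℝ (Fin d)) : Set (Finset ℕ) :=
  nums '' {F | IsFacet x Finset.univ F}

lemma le_card_of_isFacet (hfull : affineSpan ℝ (Set.range x) = ⊤)
    (hF : IsFacet x Finset.univ F) : d ≤ F.card := by
  have h := hF.2.2
  rw [polytopeDim_univ hfull] at h
  have hpos := hF.2.1.card_pos
  have := finrank_vectorSpan_image_finset_le ℝ x F (n := F.card - 1) (by omega)
  rw [Finset.coe_image] at this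
  change polytopeDim x F ≤ _ at this
  omega

/-- The enumeration of a ridge, given by its positions in a facet. -/
lemma en_ridge {c lo u p s : ℕ} (h5 : 5 ≤ d) (hc : A.card = c) (hdc : d ≤ c) (hs : s < c)
    (hR : IsRidge d c lo u p) (hiff : ∀ j, OnRidge d c s j ↔ InRidge lo u p j) :
    (multiplexFacet A (d - 1) s).card = p ∧
      ∀ i < p, en (nums A) (if i < u then lo + i else lo + i + 1) =
        en (nums (multiplexFacet A (d - 1) s)) i := by
  subst hc
  have hmono : StrictMono (fun i => en (nums A) (if i < u then lo + i else lo + i + 1)) := by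
    intro i j hij
    simp only [en_lt_iff]
    split_ifs <;> omega
  rw [← card_nums]
  refine eq_en_of_strictMono hmono (fun y => ?_)
  have hlt : ∀ j, InRidge lo u p j → j < A.card := by
    intro j hj
    have := hR.1
    unfold InRidge at hj
    omega
  have hup : u ≤ p := by
    unfold IsRidge at hR
    omega
  constructor
  · intro hy
    obtain ⟨a, ha, rfl⟩ := exists_val_of_mem_nums hy
    rw [mem_multiplexFacet h5 hdc hs, hiff] at ha
    have hin := ha.2
    unfold InRidge at hin
    refine ⟨if rank A a < lo + u then rank A a - lo else rank A a - lo - 1, ?_, ?_⟩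
    · split_ifs <;> omega
    · rw [← en_rank ha.1]
      congr 1
      split_ifs <;> omega
  · rintro ⟨i, hi, rfl⟩
    have hin : InRidge lo u p (if i < u then lo + i else lo + i + 1) := by
      unfold InRidge
      split_ifs <;> omega
    exact (en_mem_multiplexFacet h5 hdc hs (hlt _ hin)).2 ((hiff _).2 hin)

lemma gap_mod_two (hF : IsGaleSubset F) {i i' y y' : ℕ} (hyn' : y' ≤ n) (hyy : y < y')
    (h : IsGap (nums F) i y) (h' : IsGap (nums F) i' y') : i % 2 = i' % 2 := by
  have hii : i ≤ i' := by
    by_contra hcon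
    have h1 := h.2.1 i' (by omega)
    have h2 := h'.2.2 i' le_rfl (by have := h.1; omega)
    omega
  have hnot : ∀ {i y : ℕ}, IsGap (nums F) i y → y ∉ nums F := by
    rintro i y h hy
    obtain ⟨j, hj, rfl⟩ := exists_en hy
    rcases Nat.lt_or_ge j i with hji | hij
    · exact absurd (h.2.1 j hji) (lt_irrefl _)
    · exact absurd (h.2.2 j hij hj) (lt_irrefl _)
  have he := hF ⟨y, by omega⟩ ⟨y', by omega⟩ (fun hy => hnot h (val_mem_nums.2 hy))
    (fun hy => hnot h' (val_mem_nums.2 hy)) hyy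
  have hcard : (F.filter (fun b => (⟨y, by omega⟩ : Fin (n + 1)) < b ∧ b < ⟨y', by omega⟩)).map
      Fin.valEmbedding = (Finset.Ico i i').image (en (nums F)) := by
    ext z
    simp only [Finset.mem_map, Finset.mem_filter, Fin.valEmbedding_apply, Finset.mem_image,
      Finset.mem_Ico, Fin.lt_def]
    constructor
    · rintro ⟨b, ⟨hb, h1, h2⟩, rfl⟩
      obtain ⟨j, hj, hjb⟩ := exists_en (val_mem_nums.2 hb)
      refine ⟨j, ⟨?_, ?_⟩, hjb⟩
      · by_contra hcon
        have := h.2.1 j (by omega)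
        omega
      · by_contra hcon
        have := h'.2.2 j (by omega) hj
        omega
    · rintro ⟨j, ⟨h1, h2⟩, rfl⟩
      have hj : j < (nums F).card := lt_of_lt_of_le h2 h'.1
      obtain ⟨b, hb, hbj⟩ := exists_val_eq_en (by simpa using hj)
      exact ⟨b, ⟨hb, hbj ▸ h.2.2 j h1 hj, hbj ▸ h'.2.1 j h2⟩, hbj⟩
  rw [← Finset.card_map Fin.valEmbedding, hcard,
    Finset.card_image_of_injective _ (en_strictMono _).injective, Nat.card_Ico] at he
  obtain ⟨m, hm⟩ := he
  omega

/-- The facets of an ordinary polytope form a system of facets in the combinatorial sense. -/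
theorem IsOrdinaryPolytope.facetSystem (hd : Odd d) (h5 : 5 ≤ d) (hx : IsOrdinaryPolytope x) :
    FacetSystem d n (facetNums x) := by
  have hci := hx.convexIndependent
  have hfull := hx.full_dimensional
  have hcard : ∀ F, IsFacet x Finset.univ F → d ≤ F.card := fun F hF => le_card_of_isFacet hfull hF
  refine ⟨hd, h5, ?_, ?_, ?_, ?_, ?_, ?_⟩
  · rintro _ ⟨F, -, rfl⟩ y hy
    obtain ⟨a, -, rfl⟩ := exists_val_of_mem_nums hy
    exact Nat.lt_succ_iff.1 a.2
  · rintro _ ⟨F, hF, rfl⟩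
    rw [card_nums]
    exact hcard F hF
  · rintro _ ⟨F, hF, rfl⟩ i i' y y' hy hy' h h'
    rcases lt_trichotomy y y' with hlt | rfl | hlt
    · exact gap_mod_two (hx.gale F hF) hy' hlt h h'
    · have : i = i' := by
        rcases lt_trichotomy i i' with hlt | heq | hlt
        · have h1 := h'.2.1 i hlt
          have h2 := h.2.2 i le_rfl (by have := h'.1; omega)
          omega
        · exact heq
        · have h1 := h.2.1 i' hlt
          have h2 := h'.2.2 i' le_rfl (by have := h.1; omega)
          omega
      rw [this]
    · exact (gap_mod_two (hx.gale F hF) hy hlt h' h).symm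
  · rintro _ ⟨F, hF, rfl⟩ lo u p hR
    rw [card_nums] at hR
    obtain ⟨s, hs, hiff⟩ := exists_of_isRidge h5 hR
    have hB := ((hx.multiplex F hF).2 _).2 ⟨s, hs, rfl⟩
    obtain ⟨G, hG, hFG, hGB⟩ := exists_isFacet_inter_eq hci hF hB
    obtain ⟨t, ht, hBt⟩ := ((hx.multiplex G hG).2 _).1 hGB
    obtain ⟨v, w, p', hR', hiff', -⟩ := exists_isRidge h5 (hcard G hG) ht
    obtain ⟨e1, e2⟩ := en_ridge h5 rfl (hcard F hF) hs hR hiff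
    obtain ⟨e3, e4⟩ := en_ridge h5 rfl (hcard G hG) ht hR' hiff'
    rw [← hBt] at e3 e4
    obtain rfl : p' = p := by omega
    refine ⟨nums G, ⟨G, hG, rfl⟩, v, w, by rwa [card_nums], fun j hj => ?_, fun j hj hjG => ?_⟩
    · have hup : u ≤ p' := by
        unfold IsRidge at hR
        omega
      unfold InRidge at hj
      obtain ⟨i, hi, hij⟩ : ∃ i < p', (i < u ∧ j = lo + i) ∨ (u ≤ i ∧ j = lo + i + 1) := by
        rcases lt_or_gt_of_ne hj.2.2 with h | h
        · exact ⟨j - lo, by omega, by omega⟩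
        · exact ⟨j - lo - 1, by omega, by omega⟩
      refine ⟨if i < w then v + i else v + i + 1, ?_, ?_⟩
      · rw [e4 i hi, ← e2 i hi]
        congr 1
        split_ifs <;> omega
      · split_ifs <;> omega
    · rw [card_nums] at hj
      rw [← hiff, ← en_mem_multiplexFacet h5 (hcard F hF) hs hj, ← hFG]
      obtain ⟨a, ha, haj⟩ := exists_val_eq_en hj
      rw [← haj, val_mem_nums] at hjG ⊢
      exact Finset.mem_inter.2 ⟨ha, hjG⟩
  · rintro _ ⟨F, hF, rfl⟩ _ ⟨G, hG, rfl⟩ _ ⟨H, hH, rfl⟩ lo u p hR hGF hHF h1 h2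
    rw [card_nums] at hR
    obtain ⟨s, hs, hiff⟩ := exists_of_isRidge h5 hR
    have hB := ((hx.multiplex F hF).2 _).2 ⟨s, hs, rfl⟩
    have hsub : ∀ K, (∀ j, InRidge lo u p j → en (nums F) j ∈ nums K) →
        multiplexFacet F (d - 1) s ⊆ K := by
      intro K hK a ha
      rw [mem_multiplexFacet h5 (hcard F hF) hs] at ha
      have := hK _ ((hiff _).1 ha.2)
      rwa [en_rank ha.1, val_mem_nums] at this
    rw [eq_of_ridge_subset hci hfull hF hB hG hH (fun h => hGF (h ▸ rfl)) (fun h => hHF (h ▸ rfl))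
      (hsub G h1) (hsub H h2)]
  · rintro _ ⟨F, hF, rfl⟩ _ ⟨G, hG, rfl⟩ hFG
    have hc := hcard F hF
    obtain ⟨B, hB, hsub⟩ := exists_ridge_inter_subset hci hfull hF hG (fun h => hFG (h ▸ rfl))
      (by omega)
    obtain ⟨s, hs, rfl⟩ := ((hx.multiplex F hF).2 _).1 hB
    obtain ⟨lo, u, p, hR, hiff, -⟩ := exists_isRidge h5 hc hs
    refine ⟨lo, u, p, by rwa [card_nums], fun j hj hjG => ?_⟩
    rw [card_nums] at hj
    rw [← hiff, ← en_mem_multiplexFacet h5 hc hs hj]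
    obtain ⟨a, ha, haj⟩ := exists_val_eq_en hj
    rw [← haj, val_mem_nums] at hjG ⊢
    exact hsub (Finset.mem_inter.2 ⟨ha, hjG⟩)

end Translation

/-! ### Shellings of the boundary of a simplex -/

section SimplexBoundary

variable {V : Type*} [DecidableEq V]

lemma maximal_simplexBoundary_iff {T S : Finset V} (hT : 2 ≤ T.card) :
    Maximal (fun A => A ∈ simplexBoundary T) S ↔ ∃ u ∈ T, S = T.erase u := by
  have hmem : ∀ A, A ∈ simplexBoundary T ↔ A.Nonempty ∧ A ⊂ T := fun A => Iff.rfl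
  have herase : ∀ u ∈ T, T.erase u ∈ simplexBoundary T := fun u hu =>
    (hmem _).2 ⟨Finset.card_pos.1 (by rw [Finset.card_erase_of_mem hu]; omega),
      Finset.erase_ssubset hu⟩
  constructor
  · rintro ⟨hS, hmax⟩
    obtain ⟨u, hu, huS⟩ := Finset.exists_of_ssubset ((hmem _).1 hS).2
    have hsub : S ⊆ T.erase u := Finset.subset_erase.2 ⟨((hmem _).1 hS).2.1, huS⟩
    exact ⟨u, hu, hsub.antisymm (hmax (herase u hu) hsub)⟩
  · rintro ⟨u, hu, rfl⟩
    refine ⟨herase u hu, fun A hA hsub => ?_⟩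
    obtain ⟨w, hw, hwA⟩ := Finset.exists_of_ssubset ((hmem _).1 hA).2
    refine Finset.subset_erase.2 ⟨((hmem _).1 hA).2.1, fun huA => ?_⟩
    refine hwA (hsub (Finset.mem_erase.2 ⟨?_, hw⟩))
    rintro rfl
    exact hwA huA

lemma enumeratesFacets_simplexBoundary {e : ℕ} {T : Finset V} (hT : T.card = e + 2) {us : List V}
    (hnd : us.Nodup) (hus : ∀ u, u ∈ us ↔ u ∈ T) :
    EnumeratesFacets e (simplexBoundary T) (us.map (fun u => T.erase u)) := by
  refine ⟨?_, fun S => ?_, fun S hS => ?_⟩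
  · refine hnd.map_on (fun u hu w hw h => ?_)
    exact (Finset.erase_inj _ ((hus u).1 hu)).1 h
  · rw [maximal_simplexBoundary_iff (by omega)]
    simp only [List.mem_map, hus]
    exact exists_congr (fun u => and_congr_right (fun _ => eq_comm))
  · obtain ⟨u, hu, rfl⟩ := List.mem_map.1 hS
    rw [Finset.card_erase_of_mem ((hus u).1 hu), hT]
    rfl

/-- Every ordering of the facets of a simplex is a shelling of its boundary. -/
theorem isShelling_simplexBoundary {e : ℕ} {T : Finset V} (hT : T.card = e + 2) {us : List V}
    (hnd : us.Nodup) (hus : ∀ u, u ∈ us ↔ u ∈ T) :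
    IsShelling e (simplexBoundary T) (us.map (fun u => T.erase u)) := by
  induction e generalizing T us with
  | zero => exact enumeratesFacets_simplexBoundary hT hnd hus
  | succ e ih =>
    refine ⟨enumeratesFacets_simplexBoundary hT hnd hus, fun L₁ E L₂ hL hne => ?_⟩
    obtain ⟨us₁, us', rfl, rfl, h⟩ := List.map_eq_append_iff.1 hL
    obtain ⟨u, us₂, rfl, rfl, rfl⟩ := List.map_eq_cons_iff.1 h
    have huT : u ∈ T := (hus u).1 (by simp)
    have hperm : (us₁ ++ u :: us₂).Perm (u :: (us₁ ++ us₂)) := List.perm_middle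
    have hnd' := List.nodup_cons.1 (hperm.nodup_iff.1 hnd)
    refine ⟨us₁.map (fun w => (T.erase u).erase w), us₂.map (fun w => (T.erase u).erase w), ?_,
      by simpa using hne, fun A _ hAE => ?_⟩
    · rw [← List.map_append]
      refine ih (by rw [Finset.card_erase_of_mem huT, hT]; rfl) hnd'.2 (fun w => ?_)
      rw [Finset.mem_erase, ← hus w, hperm.mem_iff, List.mem_cons]
      constructor
      · intro hw
        refine ⟨?_, Or.inr hw⟩
        rintro rfl
        exact hnd'.1 hw
      · rintro ⟨hwu, hw⟩
        exact hw.resolve_left hwu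
    · have hAT : A ⊆ T := hAE.trans (Finset.erase_subset _ _)
      simp only [List.mem_map, exists_exists_and_eq_and]
      refine exists_congr (fun w => and_congr_right (fun _ => ?_))
      rw [Finset.subset_erase, Finset.subset_erase]
      exact and_congr_left (fun _ => by simp [hAT, hAE])

end SimplexBoundary

/-! ### The list of simplices -/

section SimplexList

variable {n d v : ℕ} {F : Fin v → Finset (Fin (n + 1))}

lemma card_window {A : Finset (Fin (n + 1))} {l : ℕ} (hl : l + d ≤ A.card) :
    (window A d l).card = d := by
  have : (window A d l).map Fin.valEmbedding = (Finset.Ico l (l + d)).image (en (nums A)) := by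
    ext y
    simp only [window, Finset.mem_map, Finset.mem_filter, Fin.valEmbedding_apply, Finset.mem_image,
      Finset.mem_Ico]
    constructor
    · rintro ⟨a, ⟨ha, h⟩, rfl⟩
      exact ⟨_, h, en_rank ha⟩
    · rintro ⟨j, hj, rfl⟩
      obtain ⟨a, ha, haj⟩ := exists_val_eq_en (show j < A.card by omega)
      refine ⟨a, ⟨ha, ?_⟩, haj⟩
      rwa [rank_eq (by omega) haj.symm]
  rw [← Finset.card_map Fin.valEmbedding, this,
    Finset.card_image_of_injective _ (en_strictMono _).injective, Nat.card_Ico]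
  omega

/-- The index pairs of the simplices, in the order of the list. -/
def indexList (F : Fin v → Finset (Fin (n + 1))) (d : ℕ) : List (Fin v × ℕ) :=
  (List.finRange v).flatMap (fun j => (List.range ((F j).card + 1 - d)).map (fun l => (j, l)))

lemma simplexList_eq_map :
    simplexList F d = (indexList F d).map (fun p => window (F p.1) d p.2) := by
  simp [simplexList, indexList, List.map_flatMap, Function.comp_def]

lemma mem_indexList {p : Fin v × ℕ} :
    p ∈ indexList F d ↔ p.2 + d ≤ (F p.1).card := by
  obtain ⟨j, l⟩ := p
  simp only [indexList, List.mem_flatMap, List.mem_finRange, true_and, List.mem_map,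
    List.mem_range, Prod.mk.injEq]
  constructor
  · rintro ⟨_, _, h, rfl, rfl⟩
    omega
  · intro h
    exact ⟨j, l, by omega, rfl, rfl⟩

lemma pairwise_indexList :
    (indexList F d).Pairwise (fun p q => p.1 < q.1 ∨ (p.1 = q.1 ∧ p.2 < q.2)) := by
  rw [indexList, List.pairwise_flatMap]
  refine ⟨fun j _ => ?_, ?_⟩
  · rw [List.pairwise_map]
    exact List.pairwise_lt_range.imp (fun h => Or.inr ⟨rfl, h⟩)
  · refine (List.pairwise_lt_finRange v).imp (fun h p hp q hq => Or.inl ?_)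
    obtain ⟨_, _, rfl⟩ := List.mem_map.1 hp
    obtain ⟨_, _, rfl⟩ := List.mem_map.1 hq
    exact h

lemma mem_simplexList {S : Finset (Fin (n + 1))} :
    S ∈ simplexList F d ↔ ∃ j l, l + d ≤ (F j).card ∧ S = window (F j) d l := by
  rw [simplexList_eq_map, List.mem_map]
  constructor
  · rintro ⟨p, hp, rfl⟩
    exact ⟨p.1, p.2, mem_indexList.1 hp, rfl⟩
  · rintro ⟨j, l, h, rfl⟩
    exact ⟨(j, l), mem_indexList.2 h, rfl⟩

/-- The simplices that stand in the list before a given entry are the earlier ones. -/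
lemma exists_of_simplexList_eq {L₁ L₂ : List (Finset (Fin (n + 1)))}
    {T : Finset (Fin (n + 1))} (h : simplexList F d = L₁ ++ T :: L₂) :
    ∃ j l, l + d ≤ (F j).card ∧ T = window (F j) d l ∧
      ∀ E, E ∈ L₁ ↔ E ∈ earlierSimplices F d j l := by
  rw [simplexList_eq_map] at h
  obtain ⟨P₁, P', hP, rfl, hP'⟩ := List.map_eq_append_iff.1 h
  obtain ⟨⟨j, l⟩, P₂, rfl, rfl, rfl⟩ := List.map_eq_cons_iff.1 hP'
  have hpw := pairwise_indexList (F := F) (d := d)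
  rw [hP, List.pairwise_append, List.pairwise_cons] at hpw
  obtain ⟨-, ⟨h2, -⟩, h3⟩ := hpw
  have hmem : ∀ p, p ∈ P₁ ∨ p = (j, l) ∨ p ∈ P₂ ↔ p.2 + d ≤ (F p.1).card := fun p => by
    rw [← mem_indexList, hP]
    simp
  refine ⟨j, l, (hmem (j, l)).1 (Or.inr (Or.inl rfl)), rfl, fun E => ?_⟩
  rw [List.mem_map]
  constructor
  · rintro ⟨p, hp, rfl⟩
    exact ⟨p.1, p.2, (hmem p).1 (Or.inl hp), h3 p hp (j, l) (by simp), rfl⟩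
  · rintro ⟨i, r, hr, hlt, rfl⟩
    refine ⟨(i, r), ?_, rfl⟩
    rcases (hmem (i, r)).2 hr with hp | hp | hp
    · exact hp
    · rw [Prod.mk.injEq] at hp
      obtain ⟨rfl, rfl⟩ := hp
      simp at hlt
    · have := h2 _ hp
      simp only [Fin.lt_def, Fin.ext_iff] at this hlt
      omega

end SimplexList

/-! ### The minimal new faces -/

section MinimalFaces

variable {n d v κ : ℕ} {x : Fin (n + 1) → EuclideanSpace ℝ (Fin d)}
  {F : Fin v → Finset (Fin (n + 1))}

open Classical in
/-- The set of the new vertices of the block of `A` that starts at position `l`. -/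
noncomputable def newFace (x : Fin (n + 1) → EuclideanSpace ℝ (Fin d)) (A : Finset (Fin (n + 1)))
    (l : ℕ) : Finset (Fin (n + 1)) :=
  A.filter (fun a => IsNew d (facetNums x) (nums A) l (rank A a))

lemma mem_newFace {A : Finset (Fin (n + 1))} {l : ℕ} {a : Fin (n + 1)} :
    a ∈ newFace x A l ↔ a ∈ A ∧ IsNew d (facetNums x) (nums A) l (rank A a) := by
  classical
  exact Finset.mem_filter

lemma mem_window {A : Finset (Fin (n + 1))} {l : ℕ} {a : Fin (n + 1)} :
    a ∈ window A d l ↔ a ∈ A ∧ l ≤ rank A a ∧ rank A a < l + d :=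
  Finset.mem_filter

lemma newFace_subset_window (h5 : 5 ≤ d) {A : Finset (Fin (n + 1))} {l : ℕ} :
    newFace x A l ⊆ window A d l := by
  intro a ha
  rw [mem_newFace] at ha
  exact mem_window.2 ⟨ha.1, ha.2.le h5⟩

variable (hF : ∀ A, IsFacet x Finset.univ A ↔ ∃ j, F j = A)
  (hcolex : StrictMono (fun j => toColex (F j)))
include hF

lemma isFacet_apply (j : Fin v) : IsFacet x Finset.univ (F j) := (hF _).2 ⟨j, rfl⟩

lemma nums_mem_facetNums (j : Fin v) : nums (F j) ∈ facetNums x := ⟨_, isFacet_apply hF j, rfl⟩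

include hcolex

lemma exists_lt_of_colexDiff {j : Fin v} {G : Finset ℕ} (hG : G ∈ facetNums x) {y : ℕ}
    (h : ColexDiff G (nums (F j)) y) : ∃ i < j, G = nums (F i) := by
  obtain ⟨A, hA, rfl⟩ := hG
  obtain ⟨i, rfl⟩ := (hF A).1 hA
  exact ⟨i, hcolex.lt_iff_lt.1 (toColex_lt_iff.2 ⟨y, h⟩), rfl⟩

omit hF in
lemma exists_colexDiff_of_lt {i j : Fin v} (h : i < j) :
    ∃ y, ColexDiff (nums (F i)) (nums (F j)) y :=
  toColex_lt_iff.1 (hcolex h)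

variable (hS : FacetSystem d n (facetNums x)) (hκ : IsSpread d (facetNums x) κ)
include hS

/-- Without one of its new vertices, a block lies in an earlier one. -/
lemma exists_erase_subset {j : Fin v} {l : ℕ} (hl : l + d ≤ (F j).card) {a : Fin (n + 1)}
    (ha : a ∈ newFace x (F j) l) :
    ∃ E ∈ earlierSimplices F d j l, (window (F j) d l).erase a ⊆ E := by
  have h5 := hS.five_le
  rw [mem_newFace] at ha
  rcases hS.exists_window_of_isNew (nums_mem_facetNums hF j) (by rwa [card_nums]) ha.2 with
    h | ⟨G, hG, ⟨y, hGF⟩, r, hr, hw⟩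
  · refine ⟨_, ⟨j, l - 1, by omega, Or.inr ⟨rfl, by omega⟩, rfl⟩, fun b hb => ?_⟩
    rw [Finset.mem_erase, mem_window] at hb
    have hne : rank (F j) b ≠ rank (F j) a := by
      intro h'
      refine hb.1 (Fin.ext ?_)
      rw [← en_rank hb.2.1, ← en_rank ha.1, h']
    exact mem_window.2 ⟨hb.2.1, by omega, by omega⟩
  · obtain ⟨i, hij, rfl⟩ := exists_lt_of_colexDiff hF hcolex hG hGF
    rw [card_nums] at hr
    refine ⟨_, ⟨i, r, hr, Or.inl hij, rfl⟩, fun b hb => ?_⟩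
    rw [Finset.mem_erase, mem_window] at hb
    have hne : rank (F j) b ≠ rank (F j) a := by
      intro h'
      refine hb.1 (Fin.ext ?_)
      rw [← en_rank hb.2.1, ← en_rank ha.1, h']
    obtain ⟨k, hk1, hk2, hk⟩ := hw _ hb.2.2.1 hb.2.2.2 hne
    rw [en_rank hb.2.1] at hk
    have hbi : b ∈ F i := by
      rw [← val_mem_nums, ← hk]
      exact en_mem (by rw [card_nums]; omega)
    rw [mem_window, rank_eq (by omega) hk]
    exact ⟨hbi, hk1, hk2⟩

include hκ

lemma newFace_not_subset_of_lt {i j : Fin v} (hij : i < j) {l : ℕ} (hl : l + d ≤ (F j).card) :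
    ¬ newFace x (F j) l ⊆ F i := by
  have h5 := hS.five_le
  intro hsub
  obtain ⟨y, hy⟩ := exists_colexDiff_of_lt hcolex hij
  obtain ⟨m, hm, hmn⟩ := hS.exists_isNew_notMem hκ (nums_mem_facetNums hF j) (by rwa [card_nums])
    (nums_mem_facetNums hF i) hy
  have hmc : m < (F j).card := by
    have := hm.le h5
    omega
  obtain ⟨a, ha, ham⟩ := exists_val_eq_en hmc
  rw [← ham, val_mem_nums] at hmn
  exact hmn (hsub (mem_newFace.2 ⟨ha, by rwa [rank_eq hmc ham.symm]⟩))

lemma newFace_not_subset_of_mem {j : Fin v} {l : ℕ} (hl : l + d ≤ (F j).card)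
    {E : Finset (Fin (n + 1))} (hE : E ∈ earlierSimplices F d j l) : ¬ newFace x (F j) l ⊆ E := by
  have h5 := hS.five_le
  intro hsub
  obtain ⟨i, r, hr, hij | ⟨rfl, hrl⟩, rfl⟩ := hE
  · exact newFace_not_subset_of_lt hF hcolex hS hκ hij hl
      (hsub.trans (Finset.filter_subset _ _))
  -- the last vertex of a block that is not the first one of its facet is new
  · have hmc : l + d - 1 < (F i).card := by omega
    obtain ⟨a, ha, ham⟩ := exists_val_eq_en hmc
    have har := rank_eq hmc ham.symm
    have := mem_window.1 (hsub (mem_newFace.2 ⟨ha, Or.inl ⟨by omega, Or.inl (by omega)⟩⟩))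
    omega

/-- A face of a block is new if and only if it contains all new vertices of the block. -/
lemma newFace_subset_iff {j : Fin v} {l : ℕ} (hl : l + d ≤ (F j).card) {A : Finset (Fin (n + 1))}
    (hA : A ⊆ window (F j) d l) :
    newFace x (F j) l ⊆ A ↔ ∀ E ∈ earlierSimplices F d j l, ¬ A ⊆ E := by
  constructor
  · intro h E hE hAE
    exact newFace_not_subset_of_mem hF hcolex hS hκ hl hE (h.trans hAE)
  · intro h a ha
    by_contra haA
    obtain ⟨E, hE, hsub⟩ := exists_erase_subset hF hcolex hS hl ha
    exact h E hE ((Finset.subset_erase.2 ⟨hA, haA⟩).trans hsub)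

lemma isMinimalNewFace_window {j : Fin v} {l : ℕ} (hl : l + d ≤ (F j).card) :
    IsMinimalNewFace {A | A ⊆ window (F j) d l} (earlierSimplices F d j l) (newFace x (F j) l) := by
  refine ⟨⟨newFace_subset_window hS.five_le, ?_⟩, fun A hA => ?_⟩
  · exact (newFace_subset_iff hF hcolex hS hκ hl (newFace_subset_window hS.five_le)).1 subset_rfl
  · exact (newFace_subset_iff hF hcolex hS hκ hl hA.1).2 hA.2

omit hF hcolex hS hκ in
lemma isFace_filter (hci : ConvexIndependent ℝ x) {A : Finset (Fin (n + 1))} (p : ℕ → Prop)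
    [DecidablePred p] {B : ℕ → Finset (Fin (n + 1))} (m : ℕ)
    (hB : ∀ s < m, p s → IsFace x A (B s)) :
    IsFace x A (A.filter (fun a => ∀ s < m, p s → a ∈ B s)) := by
  induction m with
  | zero => simpa using isFace_self hci A
  | succ m ih =>
    have h1 := ih (fun s hs => hB s (by omega))
    by_cases hm : p m
    · convert h1.inter hci (hB m (by omega) hm) using 1
      ext a
      simp only [Finset.mem_inter, Finset.mem_filter, Nat.lt_succ_iff_lt_or_eq]
      constructor
      · rintro ⟨ha, h⟩
        exact ⟨⟨ha, fun s hs => h s (Or.inl hs)⟩, h m (Or.inr rfl) hm⟩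
      · rintro ⟨⟨ha, h⟩, h'⟩
        refine ⟨ha, ?_⟩
        rintro s (hs | rfl) hps
        · exact h s hs hps
        · exact h'
    · convert h1 using 1
      ext a
      simp only [Finset.mem_filter, Nat.lt_succ_iff_lt_or_eq]
      refine and_congr_right (fun _ => ⟨fun h s hs => h s (Or.inl hs), ?_⟩)
      rintro h s (hs | rfl) hps
      · exact h s hs hps
      · exact absurd hps hm

/-- The set of the new vertices of the last block of a facet is the least face of this facet that is
not contained in an earlier facet. -/
lemma isMinimalNewFace_facet (hx : IsOrdinaryPolytope x) (j : Fin v) :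
    IsMinimalNewFace {A | IsFace x (F j) A} {E | ∃ i, i < j ∧ E = F i}
      (newFace x (F j) ((F j).card - d)) := by
  classical
  have h5 := hS.five_le
  have hci := hx.convexIndependent
  have hmem := nums_mem_facetNums hF j
  have hc : d ≤ (F j).card := le_card_of_isFacet hx.full_dimensional (isFacet_apply hF j)
  have hmul := (hx.multiplex _ (isFacet_apply hF j)).2
  have hnew : ∀ a ∈ F j, (a ∈ newFace x (F j) ((F j).card - d) ↔ ∀ s < (F j).card,
      ¬ Early d (facetNums x) (nums (F j)) s → a ∈ multiplexFacet (F j) (d - 1) s) := by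
    intro a ha
    rw [mem_newFace, hS.isNew_last_iff hκ hmem (by rw [card_nums]; omega), card_nums]
    simp only [ha, rank_lt_card ha, true_and]
    refine forall₂_congr (fun s hs => ?_)
    rw [mem_multiplexFacet h5 hc hs]
    simp only [ha, true_and]
    tauto
  refine ⟨⟨?_, ?_⟩, fun A hA a ha => ?_⟩
  · have := isFace_filter hci (A := F j) (fun s => ¬ Early d (facetNums x) (nums (F j)) s)
      (B := multiplexFacet (F j) (d - 1)) (F j).card
      (fun s hs _ => ((hmul _).2 ⟨s, hs, rfl⟩).1)
    change IsFace x (F j) _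
    convert this using 1
    ext a
    rw [Finset.mem_filter]
    by_cases ha : a ∈ F j
    · simp only [ha, true_and]
      exact hnew a ha
    · simp [mem_newFace, ha]
  · rintro _ ⟨i, hij, rfl⟩
    exact newFace_not_subset_of_lt hF hcolex hS hκ hij (by omega)
  · -- A face that misses a new vertex lies in a ridge that misses it, and such ridges are contained
    -- in earlier facets.
    by_contra haA
    have haF : a ∈ F j := (mem_newFace.1 ha).1
    obtain ⟨C, hC, hAC, haC⟩ := exists_isFacet_of_notMem hci (by omega) hA.1 haF haA
    obtain ⟨s, hs, rfl⟩ := (hmul C).1 hC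
    have hE : Early d (facetNums x) (nums (F j)) s := by
      by_contra hE
      exact haC ((hnew a haF).1 ha s hs hE)
    obtain ⟨G, hG, ⟨y, hGF⟩, hsub⟩ := hE
    obtain ⟨i, hij, rfl⟩ := exists_lt_of_colexDiff hF hcolex hG hGF
    refine hA.2 (F i) ⟨i, hij, rfl⟩ (hAC.trans (fun b hb => ?_))
    rw [mem_multiplexFacet h5 hc hs] at hb
    have := hsub _ (by rw [card_nums]; exact hb.2)
    rwa [en_rank hb.1, val_mem_nums] at this

/-! ### The shelling -/

lemma enumeratesFacets_simplexList {e : ℕ} (he : d = e + 1) :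
    EnumeratesFacets e (boundaryTriangulation x) (simplexList F d) := by
  have h5 := hS.five_le
  have hmem : ∀ S, S ∈ boundaryTriangulation x ↔ S.Nonempty ∧
      ∃ A, IsFacet x Finset.univ A ∧ ∃ l, l + d ≤ A.card ∧ S ⊆ window A d l := fun S => Iff.rfl
  have hwin : ∀ (j : Fin v) (l : ℕ), l + d ≤ (F j).card →
      window (F j) d l ∈ boundaryTriangulation x := fun j l hl =>
    (hmem _).2 ⟨Finset.card_pos.1 (by rw [card_window hl]; omega), F j, isFacet_apply hF j, l, hl,
      subset_rfl⟩
  refine ⟨?_, fun S => ?_, fun S hS' => ?_⟩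
  · rw [simplexList_eq_map, List.Nodup, List.pairwise_map]
    refine (pairwise_indexList (F := F) (d := d)).imp_of_mem (fun {p q} hp hq hpq h => ?_)
    have hq' := mem_indexList.1 hq
    refine newFace_not_subset_of_mem hF hcolex hS hκ hq' (E := window (F q.1) d q.2)
      ⟨p.1, p.2, mem_indexList.1 hp, hpq, h.symm⟩ (newFace_subset_window h5)
  · rw [mem_simplexList]
    constructor
    · rintro ⟨j, l, hl, rfl⟩
      refine ⟨hwin j l hl, fun A hA hsub => ?_⟩
      obtain ⟨-, B, -, r, hr, hAB⟩ := (hmem A).1 hA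
      have h1 := Finset.eq_of_subset_of_card_le (hsub.trans hAB)
        (by rw [card_window hr, card_window hl])
      exact h1 ▸ hAB
    · rintro ⟨hSm, hmax⟩
      obtain ⟨-, B, hB, r, hr, hSB⟩ := (hmem S).1 hSm
      obtain ⟨j, rfl⟩ := (hF B).1 hB
      exact ⟨j, r, hr, hSB.antisymm (hmax (hwin j r hr) hSB)⟩
  · obtain ⟨j, l, hl, rfl⟩ := mem_simplexList.1 hS'
    rw [card_window hl, he]

theorem isShelling_simplexList :
    IsShelling (d - 1) (boundaryTriangulation x) (simplexList F d) := by
  have h5 := hS.five_le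
  obtain ⟨e, he⟩ : ∃ e, d = e + 2 := ⟨d - 2, by omega⟩
  rw [show d - 1 = e + 1 by omega]
  refine ⟨enumeratesFacets_simplexList hF hcolex hS hκ he, fun L₁ T L₂ hL hne => ?_⟩
  obtain ⟨j, l, hl, rfl, hmem⟩ := exists_of_simplexList_eq hL
  have hsubT := newFace_subset_window (x := x) h5 (A := F j) (l := l)
  refine ⟨(newFace x (F j) l).toList.map (fun u => (window (F j) d l).erase u),
    (window (F j) d l \ newFace x (F j) l).toList.map (fun u => (window (F j) d l).erase u),
    ?_, ?_, fun A _ hA => ?_⟩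
  · rw [← List.map_append]
    refine isShelling_simplexBoundary (by rw [card_window hl, he]) ?_ (fun u => ?_)
    · rw [List.nodup_append]
      refine ⟨Finset.nodup_toList _, Finset.nodup_toList _, ?_⟩
      rintro a ha b hb rfl
      rw [Finset.mem_toList] at ha hb
      exact (Finset.mem_sdiff.1 hb).2 ha
    · simp only [List.mem_append, Finset.mem_toList, Finset.mem_sdiff]
      constructor
      · rintro (h | h)
        · exact hsubT h
        · exact h.1
      · intro h
        by_cases hu : u ∈ newFace x (F j) l
        · exact Or.inl hu
        · exact Or.inr ⟨h, hu⟩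
  · obtain ⟨E, hE⟩ := List.exists_mem_of_ne_nil L₁ hne
    have := newFace_not_subset_of_mem hF hcolex hS hκ hl ((hmem E).1 hE)
    obtain ⟨u, hu, -⟩ := Finset.not_subset.1 this
    intro h
    rw [List.map_eq_nil_iff, Finset.toList_eq_nil] at h
    rw [h] at hu
    exact absurd hu (Finset.notMem_empty u)
  · have h1 := newFace_subset_iff hF hcolex hS hκ hl hA
    rw [← not_iff_not] at h1
    push Not at h1
    simp only [hmem, List.mem_map, Finset.mem_toList, exists_exists_and_eq_and,
      Finset.subset_erase, hA, true_and]
    rw [← h1, Finset.not_subset]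

end MinimalFaces

end OrdinaryPolytope

theorem mainTheorem2 (d k n : ℕ) (hd : Odd d) (hd5 : 5 ≤ d) (hdk : d ≤ k) (hkn : k ≤ n)
    (x : Fin (n + 1) → EuclideanSpace ℝ (Fin d))
    (hx : OrdinaryPolytope.IsOrdinaryPolytope x)
    (hk : OrdinaryPolytope.firstVertexDegree x = k)
    (v : ℕ) (F : Fin v → Finset (Fin (n + 1)))
    (hF : ∀ A, OrdinaryPolytope.IsFacet x Finset.univ A ↔ ∃ j, F j = A)
    (hcolex : StrictMono (fun j => toColex (F j))) :
    OrdinaryPolytope.IsShelling (d - 1) (OrdinaryPolytope.boundaryTriangulation x)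
        (OrdinaryPolytope.simplexList F d) ∧
      ∃ U : Fin v → ℕ → Finset (Fin (n + 1)),
        (∀ j l, l + d ≤ (F j).card →
          OrdinaryPolytope.IsMinimalNewFace
            {A | A ⊆ OrdinaryPolytope.window (F j) d l}
            (OrdinaryPolytope.earlierSimplices F d j l) (U j l)) ∧
        ∀ j, OrdinaryPolytope.IsMinimalNewFace
            {A | OrdinaryPolytope.IsFace x (F j) A}
            {E | ∃ i, i < j ∧ E = F i} (U j ((F j).card - d)) := by
  have hS := hx.facetSystem hd hd5
  have hne : (OrdinaryPolytope.facetNums x).Nonempty := by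
    have h0 : OrdinaryPolytope.IsFace x Finset.univ ∅ :=
      (OrdinaryPolytope.isFace_iff hx.convexIndependent).2 (by simp)
    obtain ⟨A, hA, -⟩ := OrdinaryPolytope.exists_isFacet_of_notMem hx.convexIndependent
      (by simp; omega) h0 (Finset.mem_univ 0) (Finset.notMem_empty _)
    exact ⟨_, A, hA, rfl⟩
  obtain ⟨κ, hκ⟩ := hS.exists_spread hne
  exact ⟨OrdinaryPolytope.isShelling_simplexList hF hcolex hS hκ,
    fun j l => OrdinaryPolytope.newFace x (F j) l,
    fun j l hl => OrdinaryPolytope.isMinimalNewFace_window hF hcolex hS hκ hl,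
    fun j => OrdinaryPolytope.isMinimalNewFace_facet hF hcolex hS hκ hx j⟩
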